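/- For $|q|<1$ write $(a;q)_n=\prod_{k=0}^{n-1}(1-aq^k)$, $(a;q)_\infty=\prod_{k\ge 0}(1-aq^k)$ and $(a_1,\dots,a_m;q)_\infty=\prod_{k=1}^m(a_k;q)_\infty$. (1) For every complex $q$ with $|q|<1$, the following double series converge absolutely and $$\sum_{i,j\ge0}\frac{q^{\frac32 i^2-ij+\frac32 j^2-\frac12 i+\frac12 j}}{(q;q)_{2i}(q;q)_{2j}}=\frac{(-q^3,-q^5,q^8;q^8)_\infty}{(q;q)_\infty(q^2,q^8;q^{10})_\infty},$$ $$\sum_{i,j\ge0}\frac{q^{\frac32 i^2-ij+\frac32 j^2+\frac12 i+\frac32 j}}{(q;q)_{2i+1}(q;q)_{2j+1}}=\frac{(-q,-q^7,q^8;q^8)_\infty}{(q;q)_\infty(q^2,q^8;q^{10})_\infty},$$ $$\sum_{i,j\ge0}\frac{q^{\frac32 i^2-ij+\frac32 j^2+\frac32 i+\frac12 j}}{(q;q)_{2i+1}(q;q)_{2j}}=\frac{(-q^3,-q^5,q^8;q^8)_\infty}{(q;q)_\infty(q^4,q^6;q^{10})_\infty},$$ $$\sum_{i,j\ge0}\frac{q^{\frac32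 i^2-ij+\frac32 j^2-\frac12 i+\frac52 j}}{(q;q)_{2i}(q;q)_{2j+1}}=\frac{(-q,-q^7,q^8;q^8)_\infty}{(q;q)_\infty(q^4,q^6;q^{10})_\infty}.$$ (2) For a symmetric $A\in\mathbb{Q}^{2\times2}$, $B\in\mathbb{Q}^2$, $C\in\mathbb{Q}$, a lattice $L\subseteq\mathbb{Z}^2$ and $v\in\mathbb{Z}^2$, put $$f_{A,B,C,v+L}(\tau)=\sum_{n\in v+L}\frac{q^{\frac12 n^{\mathrm T}An+n^{\mathrm T}B+C}}{(q;q)_{n_1}(q;q)_{n_2}},\qquad q^x=e^{2\pi i x\tau},\ \operatorname{Im}\tau>0,$$ with the convention $1/(q;q)_m=0$ for $m<0$. Call $(A,B,C,v+L)$ a modular quadruple if this series converges absolutely for every $\tau$ in the upper half-plane and $f_{A,B,C,v+L}$ is a modular function of weight $0$, i.e. it is holomorphic on the upper half-plane, invariant under some congruence subgroup of $\mathrm{SL}_2(\mathbb{Z})$, and meromorphic at all cusps. Let $$A=\begin{pmatrix}3/4&-1/4\\-1/4&3/4\end{pmatrix},\qquad L=\mathbb{Z}(2,0)^{\mathrm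 T}+\mathbb{Z}(0,2)^{\mathrm T}.$$ Then $(A,B,C,v+L)$ is a modular quadruple for $C=-1/80$, each $B\in\{(-1/4,1/4)^{\mathrm T},(1/4,-1/4)^{\mathrm T}\}$ and each $v\in\{(0,0)^{\mathrm T},(1,1)^{\mathrm T}\}$; and also for $C=1/80$, each $B\in\{(0,1/2)^{\mathrm T},(1/2,0)^{\mathrm T}\}$ and each $v\in\{(1,0)^{\mathrm T},(0,1)^{\mathrm T}\}$. -/

import Mathlib

open scoped MatrixGroups Manifold

/-- The infinite `q`-shifted factorial `(a; q)_∞ = ∏_{k ≥ 0} (1 - a q^k)`, for `‖q‖ < 1`. -/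
noncomputable def qPochInf (a q : ℂ) : ℂ := ∏' k : ℕ, (1 - a * q ^ k)

/-- The finite `q`-shifted factorial `(a; q)_n = (1 - a)(1 - a q) ⋯ (1 - a q^(n-1))`. -/
noncomputable def qPoch (a q : ℂ) (n : ℕ) : ℂ := ∏ k ∈ Finset.range n, (1 - a * q ^ k)

/-- The reciprocal `1 / (q; q)_n` for an integer `n`, which is `0` by convention for `n < 0`. -/
noncomputable def invQPoch (q : ℂ) (n : ℤ) : ℂ := if n < 0 then 0 else 1 / qPoch q q n.toNat

/-- The power `q^x = exp(2πi x τ)` of the nome `q = exp(2πi τ)`, for a rational exponent `x`. -/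
noncomputable def nomePow (τ : UpperHalfPlane) (x : ℚ) : ℂ :=
  Complex.exp (2 * (Real.pi : ℂ) * Complex.I * (x : ℂ) * (τ : ℂ))

/-- The exponent `(1/2) nᵀ A n + nᵀ B + C` in a Nahm sum. -/
def nahmExponent {r : ℕ} (A : Matrix (Fin r) (Fin r) ℚ) (B : Fin r → ℚ) (C : ℚ)
    (n : Fin r → ℤ) : ℚ :=
  1 / 2 * ((fun k ↦ (n k : ℚ)) ⬝ᵥ (A.mulVec fun k ↦ (n k : ℚ)))
    + (fun k ↦ (n k : ℚ)) ⬝ᵥ B + C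

/-- The summand `q^((1/2) nᵀ A n + nᵀ B + C) / ((q; q)_{n_1} ⋯ (q; q)_{n_r})` of a Nahm sum, as a
function of `τ`, where `q = exp(2πi τ)`. -/
noncomputable def nahmTerm {r : ℕ} (A : Matrix (Fin r) (Fin r) ℚ) (B : Fin r → ℚ) (C : ℚ)
    (τ : UpperHalfPlane) (n : Fin r → ℤ) : ℂ :=
  nomePow τ (nahmExponent A B C n) * ∏ k, invQPoch (nomePow τ 1) (n k)

/-- The coset `v + L` of a lattice `L ⊆ ℤ^r`. -/
def latticeCoset {r : ℕ} (v : Fin r → ℤ) (L : AddSubgroup (Fin r → ℤ)) : Set (Fin r → ℤ) :=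
  {n | n - v ∈ L}

/-- The Nahm sum `f_{A,B,C,v+L}` on the lattice coset `v + L`, as a function of `τ`. -/
noncomputable def latticeNahmSum {r : ℕ} (A : Matrix (Fin r) (Fin r) ℚ) (B : Fin r → ℚ) (C : ℚ)
    (v : Fin r → ℤ) (L : AddSubgroup (Fin r → ℤ)) (τ : UpperHalfPlane) : ℂ :=
  ∑' n : latticeCoset v L, nahmTerm A B C τ n

/-- A function on the upper half-plane is a modular function (a holomorphic one, of weight zero) if
it is holomorphic on the upper half-plane, invariant under some congruence subgroup of `SL(2, ℤ)`,
and meromorphic at every cusp: for each `γ ∈ SL(2, ℤ)`, the function `f(γτ)` has at most a pole of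
finite order at `i∞`, that is, `exp(2πi N τ) f(γτ)` is bounded as `Im τ → ∞` for some `N`. -/
def IsModularFunction (f : UpperHalfPlane → ℂ) : Prop :=
  MDifferentiable 𝓘(ℂ) 𝓘(ℂ) f ∧
  (∃ Γ : Subgroup SL(2, ℤ), CongruenceSubgroup.IsCongruenceSubgroup Γ ∧
    ∀ γ ∈ Γ, ∀ τ : UpperHalfPlane, f (γ • τ) = f τ) ∧
  ∀ γ : SL(2, ℤ), ∃ N : ℕ,
    UpperHalfPlane.IsBoundedAtImInfty fun τ ↦ nomePow τ N * f (γ • τ)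

/-- `(A, B, C, v + L)` is a modular quadruple if the Nahm sum on the lattice coset `v + L` converges
absolutely for all `τ` in the upper half-plane and is a modular function of `τ`. -/
def IsModularQuadruple {r : ℕ} (A : Matrix (Fin r) (Fin r) ℚ) (B : Fin r → ℚ) (C : ℚ)
    (v : Fin r → ℤ) (L : AddSubgroup (Fin r → ℤ)) : Prop :=
  (∀ τ : UpperHalfPlane, Summable fun n : latticeCoset v L ↦ ‖nahmTerm A B C τ n‖) ∧
  IsModularFunction (latticeNahmSum A B C v L)

/-- The symmetric matrix `M(a, b, c)` with rows `(a, b)` and `(b, c)`. -/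
def symMat (a b c : ℚ) : Matrix (Fin 2) (Fin 2) ℚ := !![a, b; b, c]

/-- The lattice `ℤ(2,0)ᵀ + ℤ(0,2)ᵀ`. -/
def evenLattice : AddSubgroup (Fin 2 → ℤ) := AddSubgroup.closure {![2, 0], ![0, 2]}

/-!
The double sums are evaluated two at a time. With `q = x²`, the sums over `n₁ ≡ n₂` modulo `2` are
the parts even and odd in `x` of a single series `∑ doubleTerm 0 x`, and those over `n₁ ≢ n₂` are
the parts of `∑ doubleTerm 1 x`. The finite Durfee rectangle identity `invQPoch_mul_invQPoch` splits
the product `1 / ((q; q)_{n₁} (q; q)_{n₂})` and turns the double sum into a triple sum. In the new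
variables two of the sums decouple: one is Euler's expansion of `(-x^(2r+2ε+1); q)_∞`, the other is
the Rogers–Szegő polynomial at the point where it factors (`hasSum_rogers_szego`). What remains is
`(-x; q)_∞` times a single sum in `q`, which is one of Slater's identities modulo `10`
(`hasSum_slater_zero`, `hasSum_slater_one`). These follow from a Bailey pair whose `β`-side
`baileyBeta` has a closed form, and from the Jacobi triple product. As the single sum is even in
`x`, the parity parts are read off from those of `(-x; q)_∞ (q²; q²)_∞ = ∑ x^(2n²+n)`, which are
theta series modulo `8` (`theta_split`, `hasSum_parity_parts`).

For the modularity, let `charTheta v τ` be the odd Jacobi theta function at `v₀ τ + v₁` with the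
exponential factor that makes `SL(2, ℤ)` act on the row vector `v` by right multiplication. The
automorphy factor does not depend on `v` (`exists_charTheta_smul`), so a quotient of two such
functions with rational characteristics is invariant under a principal congruence subgroup. By the
triple product it has no poles in the upper half-plane and grows at most exponentially at the cusps
(`isModularFunction_charTheta_div`). Each of the four products is the reciprocal of nine symmetric
pairs `(q^x, q^(n-x); q^n)_∞`, eight with `n = 16` and one with `n = 10`. Up to a constant and a
power of `q`, each pair is the product of the `n` functions `charTheta (x/n, j/n)` divided by
`(q; q)_∞^n`. The factors `(q; q)_∞` are removed by the fact that the product of the three even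
theta constants is a multiple of `η³` (`exists_thetaCompl_eq`); this works out because
`8 * 16 + 10` is divisible by `3`. The result is a product of quotients of theta functions
(`isModularFunction_symmPoch`).
-/

open Filter Topology

/-! ### Infinite `q`-shifted factorials -/

lemma summable_norm_mul_pow (a : ℂ) {q : ℂ} (hq : ‖q‖ < 1) :
    Summable fun k : ℕ ↦ ‖-(a * q ^ k)‖ := by
  simpa [norm_mul, norm_pow] using
    (summable_geometric_of_lt_one (norm_nonneg q) hq).mul_left ‖a‖

lemma multipliable_qPochInf (a : ℂ) {q : ℂ} (hq : ‖q‖ < 1) :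
    Multipliable fun k : ℕ ↦ 1 - a * q ^ k := by
  simpa [sub_eq_add_neg] using multipliable_one_add_of_summable (summable_norm_mul_pow a hq)

lemma tendsto_qPoch (a : ℂ) {q : ℂ} (hq : ‖q‖ < 1) :
    Tendsto (qPoch a q) atTop (𝓝 (qPochInf a q)) :=
  (multipliable_qPochInf a hq).hasProd.tendsto_prod_nat

lemma qPochInf_ne_zero {a q : ℂ} (hq : ‖q‖ < 1) (h : ∀ k : ℕ, a * q ^ k ≠ 1) :
    qPochInf a q ≠ 0 := by
  have := tprod_one_add_ne_zero_of_summable (f := fun k : ℕ ↦ -(a * q ^ k))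
    (fun k ↦ by rw [← sub_eq_add_neg]; exact sub_ne_zero.2 (h k).symm) (summable_norm_mul_pow a hq)
  simpa [qPochInf, sub_eq_add_neg] using this

lemma mul_pow_ne_one_of_norm_lt_one {a q : ℂ} (ha : ‖a‖ < 1) (hq : ‖q‖ < 1) (k : ℕ) :
    a * q ^ k ≠ 1 := by
  intro h
  have h1 : ‖a * q ^ k‖ = 1 := by rw [h, norm_one]
  rw [norm_mul, norm_pow] at h1
  have : ‖q‖ ^ k ≤ 1 := pow_le_one₀ (norm_nonneg _) hq.le
  nlinarith [norm_nonneg a, norm_nonneg q]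

lemma qPochInf_ne_zero_of_norm_lt_one {a q : ℂ} (ha : ‖a‖ < 1) (hq : ‖q‖ < 1) :
    qPochInf a q ≠ 0 :=
  qPochInf_ne_zero hq (mul_pow_ne_one_of_norm_lt_one ha hq)

@[simp] lemma qPoch_zero (a q : ℂ) : qPoch a q 0 = 1 := by simp [qPoch]

lemma qPoch_succ (a q : ℂ) (n : ℕ) : qPoch a q (n + 1) = qPoch a q n * (1 - a * q ^ n) := by
  simp [qPoch, Finset.prod_range_succ]

lemma qPoch_ne_zero_of_norm_lt_one {a q : ℂ} (ha : ‖a‖ < 1) (hq : ‖q‖ < 1) (n : ℕ) :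
    qPoch a q n ≠ 0 :=
  Finset.prod_ne_zero_iff.2 fun k _ ↦
    sub_ne_zero.2 (mul_pow_ne_one_of_norm_lt_one ha hq k).symm

lemma qPoch_mul_qPochInf (a : ℂ) {q : ℂ} (hq : ‖q‖ < 1) (n : ℕ) :
    qPoch a q n * qPochInf (a * q ^ n) q = qPochInf a q := by
  have h1 : Tendsto (fun k ↦ qPoch a q (n + k)) atTop (𝓝 (qPochInf a q)) :=
    (tendsto_qPoch a hq).comp (tendsto_atTop_mono (fun k ↦ Nat.le_add_left k n) tendsto_id)
  refine tendsto_nhds_unique ((tendsto_qPoch (a * q ^ n) hq).const_mul _) (h1.congr fun k ↦ ?_)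
  simp only [qPoch, Finset.prod_range_add, pow_add, mul_assoc]

lemma qPochInf_eq_one_sub_mul (a : ℂ) {q : ℂ} (hq : ‖q‖ < 1) :
    qPochInf a q = (1 - a) * qPochInf (a * q) q := by
  simpa [qPoch] using (qPoch_mul_qPochInf a hq 1).symm

@[simp] lemma qPochInf_zero_left (q : ℂ) : qPochInf 0 q = 1 := by simp [qPochInf]

lemma norm_pow_lt_one {q : ℂ} (hq : ‖q‖ < 1) {n : ℕ} (hn : n ≠ 0) : ‖q ^ n‖ < 1 := by
  rw [norm_pow]; exact pow_lt_one₀ (norm_nonneg q) hq hn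

/-- Dissection of `(a; q)_∞` according to the residue of the exponent modulo `m`. -/
lemma prod_qPochInf_residues (a : ℂ) {q : ℂ} (hq : ‖q‖ < 1) {m : ℕ} (hm : m ≠ 0) :
    ∏ r ∈ Finset.range m, qPochInf (a * q ^ r) (q ^ m) = qPochInf a q := by
  have h1 : Tendsto (fun n ↦ ∏ r ∈ Finset.range m, qPoch (a * q ^ r) (q ^ m) n) atTop
      (𝓝 (∏ r ∈ Finset.range m, qPochInf (a * q ^ r) (q ^ m))) :=
    tendsto_finsetProd _ fun r _ ↦ tendsto_qPoch _ (norm_pow_lt_one hq hm)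
  have h2 : Tendsto (fun n : ℕ ↦ qPoch a q (m * n)) atTop (𝓝 (qPochInf a q)) :=
    (tendsto_qPoch a hq).comp (tendsto_id.const_mul_atTop' (Nat.pos_of_ne_zero hm))
  refine tendsto_nhds_unique h1 (h2.congr fun n ↦ ?_)
  induction n with
  | zero => simp
  | succ n ih =>
    simp only [qPoch_succ, Finset.prod_mul_distrib, ← ih]
    rw [qPoch, qPoch, Nat.mul_succ, Finset.prod_range_add]
    congr 1
    refine Finset.prod_congr rfl fun r _ ↦ ?_
    rw [pow_add, pow_mul]; ring

lemma prod_qPochInf_rootsOfUnity {ζ : ℂ} {n : ℕ} (hn : n ≠ 0) (hζ : IsPrimitiveRoot ζ n) (u : ℂ)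
    {q : ℂ} (hq : ‖q‖ < 1) :
    ∏ j ∈ Finset.range n, qPochInf (ζ ^ j * u) q = qPochInf (u ^ n) (q ^ n) := by
  have h1 : Tendsto (fun k ↦ ∏ j ∈ Finset.range n, qPoch (ζ ^ j * u) q k) atTop
      (𝓝 (∏ j ∈ Finset.range n, qPochInf (ζ ^ j * u) q)) :=
    tendsto_finsetProd _ fun r _ ↦ tendsto_qPoch _ hq
  refine tendsto_nhds_unique h1 ((tendsto_qPoch _ (norm_pow_lt_one hq hn)).congr fun k ↦ ?_)
  simp only [qPoch]
  rw [Finset.prod_comm]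
  refine Finset.prod_congr rfl fun k _ ↦ ?_
  have := hζ.pow_sub_pow_eq_prod_sub_mul 1 (u * q ^ k) (Nat.pos_of_ne_zero hn)
  rw [one_pow] at this
  rw [← pow_mul, mul_comm n k, pow_mul, ← mul_pow, this]
  classical
  symm
  refine Finset.prod_nbij (fun j ↦ ζ ^ j) ?_ ?_ ?_ ?_
  · intro j _
    rw [Polynomial.mem_nthRootsFinset (Nat.pos_of_ne_zero hn), ← pow_mul, mul_comm, pow_mul,
      hζ.pow_eq_one, one_pow]
  · intro i hi j hj h
    exact hζ.pow_inj (by simpa using hi) (by simpa using hj) h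
  · intro x hx
    have hx' : x ^ n = 1 := by simpa [Nat.pos_of_ne_zero hn] using hx
    have : NeZero n := ⟨hn⟩
    obtain ⟨i, hi, rfl⟩ := hζ.eq_pow_of_pow_eq_one hx'
    exact ⟨i, by simpa using hi, rfl⟩
  · intro j _
    ring

lemma qPochInf_mul_qPochInf_neg (a : ℂ) {q : ℂ} (hq : ‖q‖ < 1) :
    qPochInf a q * qPochInf (-a) q = qPochInf (a ^ 2) (q ^ 2) := by
  have := prod_qPochInf_rootsOfUnity two_ne_zero (IsPrimitiveRoot.neg_one 0 (by norm_num)) a hq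
  simpa [Finset.prod_range_succ] using this

/-! ### The reciprocals `1 / (q; q)_n` -/

lemma invQPoch_of_neg (q : ℂ) {n : ℤ} (hn : n < 0) : invQPoch q n = 0 := by simp [invQPoch, hn]

lemma invQPoch_natCast (q : ℂ) (n : ℕ) : invQPoch q n = 1 / qPoch q q n := by
  simp [invQPoch]

@[simp] lemma invQPoch_zero (q : ℂ) : invQPoch q 0 = 1 := by simp [invQPoch]

/-- The recurrence holds for every integer `n`, because `1 / (q; q)_n` vanishes for `n < 0`. -/
lemma one_sub_zpow_mul_invQPoch {q : ℂ} (hq : ‖q‖ < 1) (n : ℤ) :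
    (1 - q ^ n) * invQPoch q n = invQPoch q (n - 1) := by
  rcases lt_trichotomy n 0 with hn | rfl | hn
  · rw [invQPoch_of_neg q hn, invQPoch_of_neg q (by lia), mul_zero]
  · rw [invQPoch_of_neg q (by lia : (0 : ℤ) - 1 < 0)]; simp
  · obtain ⟨m, rfl⟩ : ∃ m : ℕ, n = m + 1 := ⟨(n - 1).toNat, by lia⟩
    have h0 := qPoch_ne_zero_of_norm_lt_one hq hq (m + 1)
    rw [add_sub_cancel_right, invQPoch_natCast, ← Nat.cast_succ, invQPoch_natCast, zpow_natCast]
    rw [Nat.succ_eq_add_one, qPoch_succ] at *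
    have h1 := left_ne_zero_of_mul h0
    have h2 := right_ne_zero_of_mul h0
    rw [pow_succ']
    field_simp

lemma tendsto_invQPoch {q : ℂ} (hq : ‖q‖ < 1) :
    Tendsto (invQPoch q) atTop (𝓝 (1 / qPochInf q q)) := by
  have : Tendsto (fun n : ℕ ↦ 1 / qPoch q q n) atTop (𝓝 (1 / qPochInf q q)) :=
    tendsto_const_nhds.div (tendsto_qPoch q hq) (qPochInf_ne_zero_of_norm_lt_one hq hq)
  have h2 : Tendsto Int.toNat atTop atTop :=
    tendsto_atTop.2 fun b ↦ (eventually_ge_atTop (b : ℤ)).mono fun a ha ↦ by lia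
  refine (this.comp h2).congr' ?_
  filter_upwards [eventually_ge_atTop 0] with a ha
  simp [invQPoch, ha.not_gt]

lemma exists_norm_invQPoch_le {q : ℂ} (hq : ‖q‖ < 1) :
    ∃ C : ℝ, 0 < C ∧ ∀ n, ‖invQPoch q n‖ ≤ C := by
  have h : Tendsto (fun n : ℕ ↦ ‖invQPoch q n‖) atTop (𝓝 ‖1 / qPochInf q q‖) :=
    ((tendsto_invQPoch hq).comp tendsto_natCast_atTop_atTop).norm
  obtain ⟨C, hC⟩ := h.bddAbove_range
  refine ⟨max C 1, by positivity, fun n ↦ ?_⟩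
  rcases lt_or_ge n 0 with hn | hn
  · simp [invQPoch_of_neg q hn]
  · lift n to ℕ using hn
    exact (hC ⟨n, rfl⟩).trans (le_max_left _ _)

/-! ### Summability of Gaussian series -/

lemma summable_pow_sq_mul_pow {ρ : ℝ} (h0 : 0 ≤ ρ) (h1 : ρ < 1) {w : ℝ} (hw : 0 ≤ w) :
    Summable fun n : ℕ ↦ ρ ^ (n ^ 2) * w ^ n := by
  have ht : Tendsto (fun n : ℕ ↦ ρ ^ n * w) atTop (𝓝 0) := by
    simpa using (tendsto_pow_atTop_nhds_zero_of_lt_one h0 h1).mul_const w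
  refine Summable.of_norm_bounded_eventually_nat
    (summable_geometric_of_lt_one (by norm_num : (0 : ℝ) ≤ 1 / 2) (by norm_num)) ?_
  filter_upwards [ht.eventually (gt_mem_nhds (by norm_num : (0 : ℝ) < 1 / 2))] with n hn
  rw [Real.norm_of_nonneg (by positivity), sq, pow_mul, ← mul_pow]
  exact pow_le_pow_left₀ (by positivity) hn.le n

lemma summable_zpow_sq_mul_zpow {ρ : ℝ} (h0 : 0 < ρ) (h1 : ρ < 1) {w : ℝ} (hw : 0 < w) :
    Summable fun n : ℤ ↦ ρ ^ (n ^ 2) * w ^ n := by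
  refine Summable.of_nat_of_neg ?_ ?_
  · refine (summable_pow_sq_mul_pow h0.le h1 hw.le).congr fun n ↦ ?_
    rw [← zpow_natCast, ← zpow_natCast]; push_cast; rfl
  · refine (summable_pow_sq_mul_pow h0.le h1 (inv_pos.2 hw).le).congr fun n ↦ ?_
    rw [← zpow_natCast, inv_pow, ← zpow_natCast, zpow_neg]; push_cast; rw [neg_sq]

/-! ### Euler's expansion and the Durfee rectangle identity -/

lemma summable_euler {x : ℂ} (hx : ‖x‖ < 1) (z : ℂ) :
    Summable fun t : ℕ ↦ ‖x ^ (t ^ 2) * z ^ t * invQPoch (x ^ 2) t‖ := by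
  obtain ⟨C, hC0, hC⟩ := exists_norm_invQPoch_le (norm_pow_lt_one hx two_ne_zero)
  refine ((summable_pow_sq_mul_pow (norm_nonneg x) hx (norm_nonneg z)).mul_right C).of_nonneg_of_le
    (fun _ ↦ norm_nonneg _) fun t ↦ ?_
  rw [norm_mul, norm_mul, norm_pow, norm_pow]
  gcongr
  exact hC t

/-- Euler's expansion of `(-z x; x²)_∞` in powers of `z`. Both sides satisfy
`f (z) = (1 + z x) f (z x²)` and tend to `1` as `z → 0`. -/
lemma hasSum_euler {x : ℂ} (hx : ‖x‖ < 1) (z : ℂ) :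
    HasSum (fun t : ℕ ↦ x ^ (t ^ 2) * z ^ t * invQPoch (x ^ 2) t)
      (qPochInf (-(z * x)) (x ^ 2)) := by
  have hq := norm_pow_lt_one hx two_ne_zero
  set f : ℂ → ℂ := fun z ↦ ∑' t : ℕ, x ^ (t ^ 2) * z ^ t * invQPoch (x ^ 2) t with hf
  have hs (z : ℂ) := (summable_euler hx z).of_norm
  have hfun (z : ℂ) : f z = (1 + z * x) * f (z * x ^ 2) := by
    have h1 : f z - f (z * x ^ 2) = z * x * f (z * x ^ 2) := by
      rw [hf]
      dsimp only
      rw [← (hs z).tsum_sub (hs _), ((hs z).sub (hs _)).tsum_eq_zero_add, ← tsum_mul_left]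
      simp only [pow_zero, mul_one, ne_eq, OfNat.ofNat_ne_zero, not_false_eq_true, zero_pow,
        sub_self, zero_add]
      refine tsum_congr fun t ↦ ?_
      have h := one_sub_zpow_mul_invQPoch hq ((t + 1 : ℕ) : ℤ)
      rw [zpow_natCast, Nat.cast_add_one, add_sub_cancel_right] at h
      rw [← h, Nat.cast_add_one]
      ring
    linear_combination h1
  have hiter (n : ℕ) : f z = qPoch (-(z * x)) (x ^ 2) n * f (z * (x ^ 2) ^ n) := by
    induction n with
    | zero => simp
    | succ n ih =>
      rw [ih, hfun, qPoch_succ, pow_succ (x ^ 2) n, mul_assoc z ((x ^ 2) ^ n) (x ^ 2)]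
      ring
  have hlim : Tendsto (fun n : ℕ ↦ f (z * (x ^ 2) ^ n)) atTop (𝓝 1) := by
    have h := tendsto_tsum_of_dominated_convergence (𝓕 := atTop)
      (f := fun (n : ℕ) (t : ℕ) ↦ x ^ (t ^ 2) * (z * (x ^ 2) ^ n) ^ t * invQPoch (x ^ 2) t)
      (g := fun t ↦ if t = 0 then 1 else 0) (summable_euler hx z) ?_ ?_
    · simpa using h
    · intro t
      rcases eq_or_ne t 0 with rfl | ht
      · simp
      · have h0 : Tendsto (fun n : ℕ ↦ z * (x ^ 2) ^ n) atTop (𝓝 0) := by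
          simpa using (tendsto_pow_atTop_nhds_zero_of_norm_lt_one hq).const_mul z
        simpa [ht] using ((h0.pow t).const_mul (x ^ (t ^ 2))).mul_const (invQPoch (x ^ 2) t)
    · refine Eventually.of_forall fun n t ↦ ?_
      have : ‖z * (x ^ 2) ^ n‖ ≤ ‖z‖ := by
        rw [norm_mul, norm_pow (x ^ 2)]
        exact mul_le_of_le_one_right (norm_nonneg z) (pow_le_one₀ (norm_nonneg _) hq.le)
      rw [norm_mul, norm_mul, norm_mul, norm_mul, norm_pow (z * _), norm_pow z]
      gcongr
  have hval : f z = qPochInf (-(z * x)) (x ^ 2) := by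
    have h2 := (tendsto_qPoch (-(z * x)) hq).mul hlim
    rw [mul_one] at h2
    exact tendsto_nhds_unique (tendsto_const_nhds.congr hiter) h2
  rw [← hval]
  exact (hs z).hasSum

/-- The finite Durfee rectangle identity, a form of the `q`-Chu–Vandermonde summation. -/
lemma invQPoch_mul_invQPoch {q : ℂ} (hq : ‖q‖ < 1) (h0 : q ≠ 0) (a : ℤ) (b : ℕ) :
    invQPoch q a * invQPoch q b = ∑ t ∈ Finset.range (b + 1),
      q ^ ((a - t) * (b - t)) * (invQPoch q t * invQPoch q (a - t) * invQPoch q (b - t)) := by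
  induction b with
  | zero => simp
  | succ b ih =>
    have hb : (1 - q ^ (b + 1)) ≠ 0 :=
      sub_ne_zero.2 (by
        have := mul_pow_ne_one_of_norm_lt_one hq hq b
        rw [pow_succ']; exact this.symm)
    have hstep (n : ℤ) := one_sub_zpow_mul_invQPoch hq n
    have hb1 := hstep ((b + 1 : ℕ) : ℤ)
    rw [zpow_natCast, Nat.cast_add_one, add_sub_cancel_right] at hb1
    refine mul_left_cancel₀ hb ?_
    rw [Finset.mul_sum, Nat.cast_add_one, mul_left_comm, hb1, ih]
    have hsplit : ∀ t ∈ Finset.range (b + 1 + 1), (1 - q ^ (b + 1)) *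
        (q ^ ((a - t) * ((b + 1 : ℤ) - t)) *
          (invQPoch q t * invQPoch q (a - t) * invQPoch q (b + 1 - t))) =
        q ^ ((a - t) * ((b + 1 : ℤ) - t)) *
          (invQPoch q t * invQPoch q (a - t) * invQPoch q (b - t)) +
        q ^ ((a - t) * ((b + 1 : ℤ) - t) + (b + 1 - t)) *
          (invQPoch q (t - 1) * invQPoch q (a - t) * invQPoch q (b + 1 - t)) := by
      intro t _
      have e1 := hstep ((b : ℤ) + 1 - t)
      rw [show (b : ℤ) + 1 - t - 1 = b - t by ring] at e1
      rw [← e1, ← hstep t, zpow_add₀ h0]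
      have e2 : q ^ (b + 1) = q ^ ((b : ℤ) + 1 - t) * q ^ (t : ℤ) := by
        rw [← zpow_add₀ h0, ← zpow_natCast]; congr 1; push_cast; ring
      rw [e2]
      ring
    rw [Finset.sum_congr rfl hsplit, Finset.sum_add_distrib, Finset.sum_range_succ _ (b + 1),
      Finset.sum_range_succ' (fun t : ℕ ↦ q ^ ((a - t) * ((b + 1 : ℤ) - t) + (b + 1 - t)) *
          (invQPoch q (t - 1) * invQPoch q (a - t) * invQPoch q (b + 1 - t))) (b + 1)]
    rw [invQPoch_of_neg q (show (b : ℤ) - (b + 1 : ℕ) < 0 by push_cast; lia),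
      invQPoch_of_neg q (show ((0 : ℕ) : ℤ) - 1 < 0 by simp)]
    simp only [mul_zero, zero_mul, add_zero]
    rw [← Finset.sum_add_distrib]
    refine Finset.sum_congr rfl fun u _ ↦ ?_
    have e1 := hstep (a - u)
    rw [show (a : ℤ) - u - 1 = a - (u + 1 : ℕ) by push_cast; ring] at e1
    rw [← e1, show (a - u) * ((b + 1 : ℤ) - u) = (a - u) * (b - u) + (a - u) by ring,
      show (a - (u + 1 : ℕ)) * ((b + 1 : ℤ) - (u + 1 : ℕ)) + (b + 1 - (u + 1 : ℕ))
        = (a - u) * (b - u) by push_cast; ring, zpow_add₀ h0,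
      show ((u + 1 : ℕ) : ℤ) - 1 = u by push_cast; ring,
      show (b : ℤ) + 1 - (u + 1 : ℕ) = b - u by push_cast; ring]
    ring

/-- Cauchy's Durfee rectangle identity, the limit of `invQPoch_mul_invQPoch`. -/
lemma hasSum_durfee {q : ℂ} (hq : ‖q‖ < 1) (h0 : q ≠ 0) (n : ℤ) :
    HasSum (fun u : ℕ ↦ q ^ ((u : ℤ) * (u + n)) * (invQPoch q u * invQPoch q (u + n)))
      (1 / qPochInf q q) := by
  obtain ⟨C, hC0, hC⟩ := exists_norm_invQPoch_le hq
  have hpow (u : ℕ) : ‖q ^ ((u : ℤ) * (u + n))‖ = ‖q‖ ^ (u ^ 2) * (‖q‖ ^ n) ^ u := by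
    rw [norm_zpow, ← zpow_natCast, ← zpow_natCast, ← zpow_mul, ← zpow_add₀ (norm_ne_zero_iff.2 h0)]
    congr 1; push_cast; ring
  have hsum := summable_pow_sq_mul_pow (norm_nonneg q) hq (w := ‖q‖ ^ n) (by positivity)
  have hs : Summable fun u : ℕ ↦ q ^ ((u : ℤ) * (u + n)) * (invQPoch q u * invQPoch q (u + n)) := by
    refine (hsum.mul_right (C * C)).of_norm_bounded fun u ↦ ?_
    rw [norm_mul, norm_mul, hpow]
    gcongr
    exacts [hC _, hC _]
  have hP := qPochInf_ne_zero_of_norm_lt_one hq hq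
  have hT : Tendsto (fun b : ℕ ↦ invQPoch q (b : ℤ)) atTop (𝓝 (1 / qPochInf q q)) :=
    (tendsto_invQPoch hq).comp tendsto_natCast_atTop_atTop
  have hfin (b : ℕ) : invQPoch q (b + n) * invQPoch q b =
      ∑' u : ℕ, invQPoch q (b - u) *
        (q ^ ((u : ℤ) * (u + n)) * (invQPoch q u * invQPoch q (u + n))) := by
    rw [invQPoch_mul_invQPoch hq h0, tsum_eq_sum (s := Finset.range (b + 1)),
      ← Finset.sum_range_reflect]
    · refine Finset.sum_congr rfl fun u hu ↦ ?_
      have hu' : u ≤ b := by simpa [Nat.lt_succ_iff] using hu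
      have e : ((b + 1 - 1 - u : ℕ) : ℤ) = b - u := by push_cast [hu']; simp
      rw [e, show (b : ℤ) + n - (b - u) = u + n by ring, show (b : ℤ) - (b - u) = u by ring,
        mul_comm ((u : ℤ) + n)]
      ring
    · intro u hu
      rw [invQPoch_of_neg q (by simp at hu; lia), zero_mul]
  have h1 := tendsto_tsum_of_dominated_convergence (𝓕 := atTop)
    (f := fun (b u : ℕ) ↦ invQPoch q (b - u) *
        (q ^ ((u : ℤ) * (u + n)) * (invQPoch q u * invQPoch q (u + n))))
    (g := fun u ↦ 1 / qPochInf q q *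
        (q ^ ((u : ℤ) * (u + n)) * (invQPoch q u * invQPoch q (u + n))))
    (hs.norm.mul_left C) (fun u ↦ ?_) (Eventually.of_forall fun b u ↦ ?_)
  · rw [tsum_mul_left] at h1
    have h2 : Tendsto (fun b : ℕ ↦ invQPoch q (b + n) * invQPoch q b) atTop
        (𝓝 (1 / qPochInf q q * (1 / qPochInf q q))) :=
      Tendsto.mul ((tendsto_invQPoch hq).comp
        (tendsto_atTop_add_const_right _ n tendsto_natCast_atTop_atTop)) hT
    have h3 := tendsto_nhds_unique (h1.congr fun b ↦ (hfin b).symm) h2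
    have h4 := mul_left_cancel₀ (one_div_ne_zero hP) h3
    rw [← h4]
    exact hs.hasSum
  · refine Tendsto.mul_const _ ((tendsto_invQPoch hq).comp ?_)
    simpa [sub_eq_add_neg] using
      tendsto_atTop_add_const_right _ (-(u : ℤ)) (tendsto_natCast_atTop_atTop (R := ℤ))
  · rw [norm_mul]
    gcongr
    exact hC _

lemma hasSum_mul_of_summable_norm {ι κ : Type*} {f : ι → ℂ} {g : κ → ℂ} {s t : ℂ}
    (hf : HasSum f s) (hg : HasSum g t) (hf' : Summable fun n ↦ ‖f n‖)
    (hg' : Summable fun n ↦ ‖g n‖) : HasSum (fun p : ι × κ ↦ f p.1 * g p.2) (s * t) :=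
  hf.mul hg (summable_mul_of_summable_norm hf' hg')

/-- The Jacobi triple product: multiply the Euler expansions of `(-z x; x²)_∞` and
`(-x / z; x²)_∞`, collect the terms with a given power of `z`, and sum them by `hasSum_durfee`. -/
lemma hasSum_jacobi_triple_product {x z : ℂ} (hx : ‖x‖ < 1) (hx0 : x ≠ 0) (hz : z ≠ 0) :
    HasSum (fun n : ℤ ↦ x ^ (n ^ 2) * z ^ n)
      (qPochInf (x ^ 2) (x ^ 2) * (qPochInf (-(z * x)) (x ^ 2) * qPochInf (-(x / z)) (x ^ 2))) := by
  have hq := norm_pow_lt_one hx two_ne_zero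
  have hP := qPochInf_ne_zero_of_norm_lt_one hq hq
  have h1 := hasSum_euler hx z
  have h2 := hasSum_euler hx z⁻¹
  rw [inv_mul_eq_div] at h2
  have h12 := hasSum_mul_of_summable_norm h1 h2 (summable_euler hx z) (summable_euler hx z⁻¹)
  let φ : ℕ × ℕ → ℤ × ℕ := fun p ↦ ((p.1 : ℤ) - p.2, p.2)
  have hφ : Function.Injective φ := by
    rintro ⟨a, b⟩ ⟨c, d⟩ h
    simp only [φ, Prod.mk.injEq] at h ⊢
    lia
  let F : ℤ × ℕ → ℂ := fun p ↦ x ^ (p.1 ^ 2) * z ^ p.1 * ((x ^ 2) ^ ((p.2 : ℤ) * (p.2 + p.1)) *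
    (invQPoch (x ^ 2) p.2 * invQPoch (x ^ 2) (p.2 + p.1)))
  have hF : HasSum F (qPochInf (-(z * x)) (x ^ 2) * qPochInf (-(x / z)) (x ^ 2)) := by
    refine (hφ.hasSum_iff ?_).1 (h12.congr_fun ?_)
    · rintro ⟨n, u⟩ hn
      have : (u : ℤ) + n < 0 := by
        by_contra! h
        exact hn ⟨((u + n).toNat, u), by simp only [φ, Prod.mk.injEq]; lia⟩
      simp [F, invQPoch_of_neg _ this]
    · rintro ⟨a, b⟩
      simp only [Function.comp_apply, F, φ]
      rw [add_sub_cancel, zpow_sub₀ hz, zpow_natCast, zpow_natCast, inv_pow]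
      have e : x ^ (a ^ 2) * x ^ (b ^ 2) =
          x ^ (((a : ℤ) - b) ^ 2) * (x ^ 2) ^ ((b : ℤ) * a) := by
        rw [← zpow_natCast, ← zpow_natCast, ← zpow_natCast x 2, ← zpow_mul, ← zpow_add₀ hx0,
          ← zpow_add₀ hx0]
        congr 1; push_cast; ring
      linear_combination
        -(z ^ a * (z ^ b)⁻¹ * invQPoch (x ^ 2) a * invQPoch (x ^ 2) b) * e
  have h3 := (hF.prod_fiberwise fun n ↦ (hasSum_durfee hq (pow_ne_zero 2 hx0) n).mul_left
    (x ^ (n ^ 2) * z ^ n)).mul_left (qPochInf (x ^ 2) (x ^ 2))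
  refine h3.congr_fun fun n ↦ ?_
  field_simp

/-! ### Two Rogers–Ramanujan type identities modulo 10 -/

/-- Interchange of the order of summation in an absolutely convergent double series. -/
lemma HasSum.of_prod_swap {β γ : Type*} {F : β × γ → ℂ} {g : β → ℂ} {g' : γ → ℂ} {s : ℂ}
    (hF : Summable F) (h1 : ∀ b, HasSum (fun c ↦ F (b, c)) (g b))
    (h2 : ∀ c, HasSum (fun b ↦ F (b, c)) (g' c)) (hs : HasSum g s) : HasSum g' s := by
  have e1 := hF.hasSum.prod_fiberwise h1
  have e2 := (((Equiv.prodComm γ β).hasSum_iff (f := F)).2 hF.hasSum).prod_fiberwise h2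
  rwa [e1.unique hs] at e2

lemma summable_zpow_quadratic {ρ : ℝ} (h0 : 0 < ρ) (h1 : ρ < 1) (α : ℕ) (hα : α ≠ 0) (β : ℤ) :
    Summable fun n : ℤ ↦ ρ ^ (α * n ^ 2 + β * n) := by
  refine (summable_zpow_sq_mul_zpow (ρ := ρ ^ α) (w := ρ ^ β) (by positivity)
    (pow_lt_one₀ h0.le h1 hα) (by positivity)).congr fun n ↦ ?_
  rw [← zpow_natCast, ← zpow_mul, ← zpow_mul, ← zpow_add₀ h0.ne']

lemma summable_zpow_mul_of_bounded {q : ℂ} (hq : ‖q‖ < 1) (h0 : q ≠ 0) (α : ℕ) (hα : α ≠ 0)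
    (β : ℤ) {g : ℤ → ℂ} {C : ℝ} (hg : ∀ n, ‖g n‖ ≤ C) :
    Summable fun n : ℤ ↦ ‖q ^ (α * n ^ 2 + β * n) * g n‖ := by
  refine ((summable_zpow_quadratic (norm_pos_iff.2 h0) hq α hα β).mul_right C).of_nonneg_of_le
    (fun _ ↦ norm_nonneg _) fun n ↦ ?_
  rw [norm_mul, norm_zpow]
  gcongr
  exact hg n

lemma hasSum_int_of_nat {f : ℤ → ℂ} {s : ℂ} (hf : ∀ n < 0, f n = 0)
    (h : HasSum (fun n : ℕ ↦ f n) s) : HasSum f s := by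
  refine (Nat.cast_injective.hasSum_iff fun n hn ↦ hf n ?_).1 h
  by_contra! h0
  exact hn ⟨n.toNat, by simp [h0]⟩

lemma HasSum.nat_of_int {f : ℤ → ℂ} {s : ℂ} (hf : ∀ n < 0, f n = 0) (h : HasSum f s) :
    HasSum (fun n : ℕ ↦ f n) s := by
  refine (Nat.cast_injective.hasSum_iff fun n hn ↦ hf n ?_).2 h
  by_contra! h0
  exact hn ⟨n.toNat, by simp [h0]⟩

lemma hasSum_durfee_int {q : ℂ} (hq : ‖q‖ < 1) (h0 : q ≠ 0) (k l : ℤ) :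
    HasSum (fun r : ℤ ↦ q ^ ((r - k) * (r + l)) * (invQPoch q (r - k) * invQPoch q (r + l)))
      (1 / qPochInf q q) := by
  have h := hasSum_int_of_nat (f := fun u : ℤ ↦ q ^ (u * (u + (l + k))) *
    (invQPoch q u * invQPoch q (u + (l + k)))) (fun n hn ↦ by simp [invQPoch_of_neg q hn])
    (hasSum_durfee hq h0 (l + k))
  refine ((Equiv.subRight k).hasSum_iff.2 h).congr_fun fun r ↦ ?_
  simp only [Function.comp_apply, Equiv.subRight_apply]
  rw [show r - k + (l + k) = r + l by ring]

/-- The `q`-Pascal rule for `1 / ((q; q)_a (q; q)_b)`. -/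
lemma one_sub_mul_invQPoch_mul_invQPoch {q : ℂ} (hq : ‖q‖ < 1) (h0 : q ≠ 0) (a b : ℤ) :
    (1 - q ^ (a + b)) * (invQPoch q a * invQPoch q b) =
      invQPoch q (a - 1) * invQPoch q b + q ^ a * (invQPoch q a * invQPoch q (b - 1)) := by
  rw [← one_sub_zpow_mul_invQPoch hq a, ← one_sub_zpow_mul_invQPoch hq b, zpow_add₀ h0]
  ring

/-- The sum `∑ₙ (-1)ⁿ q^(n² + n) / ((q; q)_(r - 2n) (q; q)_(r + 2n + ε))`, that is, the `β`-side of
a Bailey pair relative to `q^ε` whose `α`-side is supported on even indices. -/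
noncomputable def baileyBeta (q : ℂ) (ε r : ℤ) : ℂ :=
  ∑' n : ℤ, (-1) ^ n * q ^ (n ^ 2 + n) * (invQPoch q (r - 2 * n) * invQPoch q (r + 2 * n + ε))

lemma norm_neg_one_zpow (n : ℤ) : ‖(-1 : ℂ) ^ n‖ = 1 := by simp [norm_zpow]

lemma neg_one_zpow_neg (n : ℤ) : (-1 : ℂ) ^ (-n) = (-1) ^ n := by
  rw [zpow_neg, ← inv_zpow, inv_neg, inv_one]

lemma summable_alternating_zpow_mul {q : ℂ} (hq : ‖q‖ < 1) (h0 : q ≠ 0) (β : ℤ) (f g : ℤ → ℤ) :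
    Summable fun n : ℤ ↦ (-1) ^ n * q ^ (n ^ 2 + β * n) *
      (invQPoch q (f n) * invQPoch q (g n)) := by
  obtain ⟨C, hC0, hC⟩ := exists_norm_invQPoch_le hq
  refine (summable_zpow_mul_of_bounded hq h0 1 one_ne_zero β (C := C * C)
    (g := fun n ↦ (-1) ^ n * (invQPoch q (f n) * invQPoch q (g n))) fun n ↦ ?_).of_norm.congr
    fun n ↦ ?_
  · rw [norm_mul, norm_neg_one_zpow, one_mul, norm_mul]
    gcongr
    exacts [hC _, hC _]
  · push_cast; ring_nf

/-- First of the two recurrences that determine `baileyBeta`: apply the `q`-Pascal rule termwise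
and drop a sum that vanishes by antisymmetry. -/
lemma one_sub_mul_baileyBeta_one {q : ℂ} (hq : ‖q‖ < 1) (h0 : q ≠ 0) (m : ℤ) :
    (1 - q ^ (2 * m + 1)) * baileyBeta q 1 m = q ^ m * baileyBeta q 0 m := by
  -- the reflection `n ↦ -1 - n` changes the sign of this sum
  have hanti : ∑' n : ℤ, (-1) ^ n * q ^ (n ^ 2 + 1 * n) *
      (invQPoch q (m - 2 * n - 1) * invQPoch q (m + 2 * n + 1)) = 0 := by
    rw [← self_eq_neg, ← tsum_neg]
    conv_lhs => rw [← (Equiv.subLeft (-1 : ℤ)).tsum_eq]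
    refine tsum_congr fun n ↦ ?_
    simp only [Equiv.subLeft_apply]
    rw [show (-1 - n) ^ 2 + 1 * (-1 - n) = n ^ 2 + 1 * n by ring,
      show m - 2 * (-1 - n) - 1 = m + 2 * n + 1 by ring,
      show m + 2 * (-1 - n) + 1 = m - 2 * n - 1 by ring, sub_eq_add_neg (-1 : ℤ) n,
      zpow_add₀ (by norm_num), neg_one_zpow_neg n, show (-1 : ℂ) ^ (-1 : ℤ) = -1 by norm_num]
    ring
  have hrefl : baileyBeta q 0 m = ∑' n : ℤ, (-1) ^ n * q ^ (n ^ 2 + (-1) * n) *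
      (invQPoch q (m - 2 * n) * invQPoch q (m + 2 * n)) := by
    rw [baileyBeta, ← (Equiv.neg ℤ).tsum_eq]
    refine tsum_congr fun n ↦ ?_
    simp only [Equiv.neg_apply]
    rw [neg_one_zpow_neg, mul_comm (invQPoch q _)]
    congr 3 <;> ring_nf
  rw [hrefl, baileyBeta, ← tsum_mul_left, ← tsum_mul_left, ← add_zero (∑' n : ℤ, q ^ m * _),
    ← hanti, ← Summable.tsum_add]
  · refine tsum_congr fun n ↦ ?_
    have hp := one_sub_mul_invQPoch_mul_invQPoch hq h0 (m - 2 * n) (m + 2 * n + 1)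
    rw [show m - 2 * n + (m + 2 * n + 1) = 2 * m + 1 by ring, add_sub_cancel_right] at hp
    have e : q ^ (n ^ 2 + n) * q ^ (m - 2 * n) = q ^ m * q ^ (n ^ 2 + (-1) * n) := by
      rw [← zpow_add₀ h0, ← zpow_add₀ h0]; congr 1; ring
    rw [one_mul]
    linear_combination (-1) ^ n * q ^ (n ^ 2 + n) * hp +
      (-1) ^ n * (invQPoch q (m - 2 * n) * invQPoch q (m + 2 * n)) * e
  · exact (summable_alternating_zpow_mul hq h0 _ _ _).mul_left _
  · exact summable_alternating_zpow_mul hq h0 _ _ _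

/-- Second recurrence for `baileyBeta`: the two sums given by the `q`-Pascal rule are reflections of
each other. -/
lemma one_sub_mul_baileyBeta_zero {q : ℂ} (hq : ‖q‖ < 1) (h0 : q ≠ 0) (m : ℤ) :
    (1 - q ^ (2 * m + 2)) * baileyBeta q 0 (m + 1) = (1 + q ^ (m + 1)) * baileyBeta q 1 m := by
  have hrefl : baileyBeta q 1 m = ∑' n : ℤ, (-1) ^ n * q ^ (n ^ 2 + (-1) * n) *
      (invQPoch q (m + 1 - 2 * n) * invQPoch q (m + 2 * n)) := by
    rw [baileyBeta, ← (Equiv.neg ℤ).tsum_eq]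
    refine tsum_congr fun n ↦ ?_
    simp only [Equiv.neg_apply]
    rw [neg_one_zpow_neg, mul_comm (invQPoch q _)]
    congr 3 <;> ring_nf
  have hone : baileyBeta q 1 m = ∑' n : ℤ, (-1) ^ n * q ^ (n ^ 2 + 1 * n) *
      (invQPoch q (m - 2 * n) * invQPoch q (m + 2 * n + 1)) := by simp [baileyBeta]
  rw [add_mul (1 : ℂ), one_mul]
  nth_rw 2 [hrefl]
  rw [hone, baileyBeta, ← tsum_mul_left, ← tsum_mul_left, ← Summable.tsum_add]
  · refine tsum_congr fun n ↦ ?_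
    have hp := one_sub_mul_invQPoch_mul_invQPoch hq h0 (m + 1 - 2 * n) (m + 1 + 2 * n)
    rw [show m + 1 - 2 * n + (m + 1 + 2 * n) = 2 * m + 2 by ring,
      show m + 1 - 2 * n - 1 = m - 2 * n by ring, show m + 1 + 2 * n - 1 = m + 2 * n by ring,
      show m + 1 + 2 * n = m + 2 * n + 1 by ring] at hp
    have e : q ^ (n ^ 2 + n) * q ^ (m + 1 - 2 * n) = q ^ (m + 1) * q ^ (n ^ 2 + (-1) * n) := by
      rw [← zpow_add₀ h0, ← zpow_add₀ h0]; congr 1; ring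
    rw [one_mul, add_zero, show m + 1 + 2 * n = m + 2 * n + 1 by ring]
    linear_combination (-1) ^ n * q ^ (n ^ 2 + n) * hp +
      (-1) ^ n * (invQPoch q (m + 1 - 2 * n) * invQPoch q (m + 2 * n)) * e
  · exact summable_alternating_zpow_mul hq h0 _ _ _
  · exact (summable_alternating_zpow_mul hq h0 _ _ _).mul_left _

lemma baileyBeta_of_neg (q : ℂ) {ε r : ℤ} (h : 2 * r + ε < 0) : baileyBeta q ε r = 0 := by
  rw [baileyBeta, ← tsum_zero]
  refine tsum_congr fun n ↦ ?_
  rcases lt_or_ge (r - 2 * n) 0 with h1 | h1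
  · simp [invQPoch_of_neg q h1]
  · simp [invQPoch_of_neg q (show r + 2 * n + ε < 0 by lia)]

lemma baileyBeta_zero_zero (q : ℂ) : baileyBeta q 0 0 = 1 := by
  rw [baileyBeta, tsum_eq_single 0]
  · simp
  · intro n hn
    rcases lt_or_gt_of_ne hn with h | h
    · rw [invQPoch_of_neg q (show 0 + 2 * n + 0 < 0 by lia), mul_zero, mul_zero]
    · rw [invQPoch_of_neg q (show 0 - 2 * n < 0 by lia), zero_mul, mul_zero]

/-- The closed form of `baileyBeta`, by alternating between the two recurrences. -/
lemma baileyBeta_eq {q : ℂ} (hq : ‖q‖ < 1) (h0 : q ≠ 0) (m : ℕ) :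
    baileyBeta q 0 m = q ^ (m.choose 2) / (qPoch q q m * qPoch q (q ^ 2) m) ∧
    baileyBeta q 1 m = q ^ ((m + 1).choose 2) / (qPoch q q m * qPoch q (q ^ 2) (m + 1)) := by
  have hq2 := norm_pow_lt_one hq two_ne_zero
  have key (m : ℕ)
      (h : baileyBeta q 0 m = q ^ (m.choose 2) / (qPoch q q m * qPoch q (q ^ 2) m)) :
      baileyBeta q 1 m = q ^ ((m + 1).choose 2) / (qPoch q q m * qPoch q (q ^ 2) (m + 1)) := by
    have hr := one_sub_mul_baileyBeta_one hq h0 m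
    have h1 := qPoch_ne_zero_of_norm_lt_one hq hq m
    have h2 := qPoch_ne_zero_of_norm_lt_one hq hq2 (m + 1)
    have e : q ^ (2 * (m : ℤ) + 1) = q * (q ^ 2) ^ m := by
      rw [zpow_add_one₀ h0, zpow_mul, zpow_natCast, mul_comm]; rfl
    rw [e, h, zpow_natCast] at hr
    rw [Nat.choose_succ_succ', Nat.choose_one_right, pow_add]
    rw [qPoch_succ] at h2 ⊢
    have h3 := left_ne_zero_of_mul h2
    have h4 := right_ne_zero_of_mul h2
    refine mul_left_cancel₀ h4 (hr.trans ?_)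
    field_simp
  suffices h : baileyBeta q 0 m = q ^ (m.choose 2) / (qPoch q q m * qPoch q (q ^ 2) m) from
    ⟨h, key m h⟩
  induction m with
  | zero => simp [baileyBeta_zero_zero]
  | succ m ih =>
    have hr := one_sub_mul_baileyBeta_zero hq h0 m
    have h1 := qPoch_ne_zero_of_norm_lt_one hq hq (m + 1)
    have h2 := qPoch_ne_zero_of_norm_lt_one hq hq2 (m + 1)
    rw [key m ih] at hr
    have e1 : q ^ ((m : ℤ) + 1) = q * q ^ m := by
      rw [zpow_add_one₀ h0, zpow_natCast, mul_comm]
    have e2 : q ^ (2 * (m : ℤ) + 2) = (q * q ^ m) ^ 2 := by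
      rw [← e1, ← zpow_natCast, ← zpow_mul]; congr 1; push_cast; ring
    have h5 : 1 + q * q ^ m ≠ 0 := by
      intro h
      have := mul_pow_ne_one_of_norm_lt_one hq2 hq2 m
      apply this
      rw [← pow_mul, mul_comm 2 m, pow_mul, ← mul_pow]
      linear_combination (q * q ^ m - 1) * h
    rw [e1, e2] at hr
    rw [qPoch_succ q q] at h1 ⊢
    have h3 := left_ne_zero_of_mul h1
    have h4 := right_ne_zero_of_mul h1
    rw [Nat.cast_add_one]
    refine mul_left_cancel₀ (mul_ne_zero h4 h5) ?_
    refine (Eq.trans (by ring) hr).trans ?_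
    field_simp

/-- Summing the Bailey pair over `r` with weight `q^(r² + ε r)` turns it into a theta series. -/
lemma hasSum_baileyBeta {q : ℂ} (hq : ‖q‖ < 1) (h0 : q ≠ 0) (ε : ℤ) {s : ℂ}
    (hs : HasSum (fun n : ℤ ↦ (-1) ^ n * q ^ (5 * n ^ 2 + (1 + 2 * ε) * n)) s) :
    HasSum (fun r : ℤ ↦ q ^ (r ^ 2 + ε * r) * baileyBeta q ε r) (s / qPochInf q q) := by
  obtain ⟨C, hC0, hC⟩ := exists_norm_invQPoch_le hq
  have hρ := norm_pos_iff.2 h0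
  have hF : Summable fun p : ℤ × ℤ ↦ q ^ (p.2 ^ 2 + ε * p.2) *
      ((-1) ^ p.1 * q ^ (p.1 ^ 2 + p.1) *
        (invQPoch q (p.2 - 2 * p.1) * invQPoch q (p.2 + 2 * p.1 + ε))) := by
    have h3 := (summable_zpow_quadratic hρ hq 1 one_ne_zero 1).mul_of_nonneg
      (summable_zpow_quadratic hρ hq 1 one_ne_zero ε) (fun _ ↦ by positivity)
      (fun _ ↦ by positivity)
    refine Summable.of_norm_bounded (h3.mul_right (C * C)) fun p ↦ ?_
    rw [norm_mul, norm_mul, norm_mul, norm_neg_one_zpow, norm_zpow, norm_zpow, norm_mul, one_mul,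
      ← mul_assoc, mul_comm (‖q‖ ^ (p.2 ^ 2 + ε * p.2))]
    push_cast
    rw [one_mul, one_mul, one_mul]
    gcongr
    exacts [hC _, hC _]
  -- for fixed `n`, the sum over `r` is the Durfee rectangle identity
  have h1 (n : ℤ) : HasSum (fun r : ℤ ↦ q ^ (r ^ 2 + ε * r) * ((-1) ^ n * q ^ (n ^ 2 + n) *
      (invQPoch q (r - 2 * n) * invQPoch q (r + 2 * n + ε))))
      ((-1) ^ n * q ^ (5 * n ^ 2 + (1 + 2 * ε) * n) * (1 / qPochInf q q)) := by
    refine ((hasSum_durfee_int hq h0 (2 * n) (2 * n + ε)).mul_left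
      ((-1) ^ n * q ^ (5 * n ^ 2 + (1 + 2 * ε) * n))).congr_fun fun r ↦ ?_
    have e : q ^ (r ^ 2 + ε * r) * q ^ (n ^ 2 + n) = q ^ (5 * n ^ 2 + (1 + 2 * ε) * n) *
        q ^ ((r - 2 * n) * (r + (2 * n + ε))) := by
      rw [← zpow_add₀ h0, ← zpow_add₀ h0]; congr 1; ring
    rw [← add_assoc r] at e ⊢
    linear_combination (-1) ^ n *
      (invQPoch q (r - 2 * n) * invQPoch q (r + 2 * n + ε)) * e
  have h2 (r : ℤ) : HasSum (fun n : ℤ ↦ q ^ (r ^ 2 + ε * r) * ((-1) ^ n * q ^ (n ^ 2 + n) *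
      (invQPoch q (r - 2 * n) * invQPoch q (r + 2 * n + ε))))
      (q ^ (r ^ 2 + ε * r) * baileyBeta q ε r) := by
    have := summable_alternating_zpow_mul hq h0 1 (fun n ↦ r - 2 * n) (fun n ↦ r + 2 * n + ε)
    simp only [one_mul] at this
    exact this.hasSum.mul_left _
  rw [← mul_one_div]
  exact HasSum.of_prod_swap hF h1 h2 (hs.mul_right _)

/-- One of Slater's identities modulo `10`: insert the closed form of `baileyBeta` in
`hasSum_baileyBeta` and evaluate the theta series by the Jacobi triple product. -/
lemma hasSum_slater_zero {q : ℂ} (hq : ‖q‖ < 1) (h0 : q ≠ 0) :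
    HasSum (fun r : ℕ ↦ q ^ (r ^ 2 + r.choose 2) / (qPoch q q r * qPoch q (q ^ 2) r))
      (qPochInf (q ^ 10) (q ^ 10) * (qPochInf (q ^ 6) (q ^ 10) * qPochInf (q ^ 4) (q ^ 10)) /
        qPochInf q q) := by
  have ht := hasSum_jacobi_triple_product (norm_pow_lt_one hq (n := 5) (by norm_num))
    (pow_ne_zero 5 h0) (neg_ne_zero.2 h0)
  have e1 : q ^ 5 / -q = -q ^ 4 := by field_simp
  rw [e1, neg_neg, neg_mul, neg_neg, ← pow_mul, ← pow_succ'] at ht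
  have h := (hasSum_baileyBeta hq h0 0 (ht.congr_fun fun n ↦ ?_)).nat_of_int fun n hn ↦ by
    rw [baileyBeta_of_neg q (by lia), mul_zero]
  · refine h.congr_fun fun r ↦ ?_
    rw [(baileyBeta_eq hq h0 r).1, zero_mul, add_zero, ← Nat.cast_pow, zpow_natCast, pow_add]
    ring
  · rw [← neg_one_mul q, mul_zpow, zpow_add₀ h0, zpow_mul]
    norm_num
    ring

/-- The companion of `hasSum_slater_zero`, from the Bailey pair relative to `q`. -/
lemma hasSum_slater_one {q : ℂ} (hq : ‖q‖ < 1) (h0 : q ≠ 0) :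
    HasSum (fun r : ℕ ↦ q ^ (r ^ 2 + r + (r + 1).choose 2) /
        (qPoch q q r * qPoch q (q ^ 2) (r + 1)))
      (qPochInf (q ^ 10) (q ^ 10) * (qPochInf (q ^ 8) (q ^ 10) * qPochInf (q ^ 2) (q ^ 10)) /
        qPochInf q q) := by
  have ht := hasSum_jacobi_triple_product (norm_pow_lt_one hq (n := 5) (by norm_num))
    (pow_ne_zero 5 h0) (neg_ne_zero.2 (pow_ne_zero 3 h0))
  have e1 : q ^ 5 / -q ^ 3 = -q ^ 2 := by field_simp
  rw [e1, neg_neg, neg_mul, neg_neg, ← pow_mul, ← pow_add] at ht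
  have h := (hasSum_baileyBeta hq h0 1 (ht.congr_fun fun n ↦ ?_)).nat_of_int fun n hn ↦ by
    rw [baileyBeta_of_neg q (by lia), mul_zero]
  · refine h.congr_fun fun r ↦ ?_
    rw [(baileyBeta_eq hq h0 r).2, one_mul, ← Nat.cast_pow, ← Nat.cast_add, zpow_natCast, pow_add]
    ring
  · rw [← neg_one_mul (q ^ 3), mul_zpow, zpow_add₀ h0, zpow_mul, zpow_mul q (1 + 2 * 1)]
    norm_num
    norm_cast
    ring

/-! ### Reduction of the double sums to single sums -/

/-- `invQPoch_mul_invQPoch` as a sum over all integers, for arbitrary integers `a` and `b`. -/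
lemma hasSum_invQPoch_mul_invQPoch {q : ℂ} (hq : ‖q‖ < 1) (h0 : q ≠ 0) (a b : ℤ) :
    HasSum (fun t : ℤ ↦ q ^ ((a - t) * (b - t)) *
      (invQPoch q t * invQPoch q (a - t) * invQPoch q (b - t))) (invQPoch q a * invQPoch q b) := by
  rcases lt_or_ge b 0 with hb | hb
  · rw [invQPoch_of_neg q hb, mul_zero]
    refine hasSum_zero.congr_fun fun t ↦ ?_
    rcases lt_or_ge t 0 with ht | ht
    · simp [invQPoch_of_neg q ht]
    · simp [invQPoch_of_neg q (show b - t < 0 by lia)]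
  · lift b to ℕ using hb
    rw [invQPoch_mul_invQPoch hq h0]
    refine hasSum_int_of_nat (fun t ht ↦ by simp [invQPoch_of_neg q ht])
      (hasSum_sum_of_ne_finset_zero fun t ht ↦ ?_)
    rw [invQPoch_of_neg q (show (b : ℤ) - t < 0 by simp at ht; lia)]
    simp

/-- The value `∑ⱼ xʲ [N, j]_{x²} = (-x; x)_N` of the Rogers–Szegő polynomial. -/
lemma hasSum_rogers_szego {x : ℂ} (hx : ‖x‖ < 1) (h0 : x ≠ 0) (N : ℤ) :
    HasSum (fun j : ℤ ↦ x ^ j * (invQPoch (x ^ 2) j * invQPoch (x ^ 2) (N - j)))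
      (invQPoch x N) := by
  have hq := norm_pow_lt_one hx two_ne_zero
  have hq0 := pow_ne_zero 2 h0
  have hs (e : ℤ → ℂ) (N : ℤ) :
      Summable fun j : ℤ ↦ e j * (invQPoch (x ^ 2) j * invQPoch (x ^ 2) (N - j)) := by
    refine summable_of_ne_finset_zero (s := Finset.Icc 0 N) fun j hj ↦ ?_
    rw [Finset.mem_Icc, not_and_or, not_le, not_le] at hj
    rcases hj with hj | hj
    · simp [invQPoch_of_neg _ hj]
    · simp [invQPoch_of_neg _ (show N - j < 0 by lia)]
  rcases lt_or_ge N 0 with hN | hN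
  · rw [invQPoch_of_neg x hN]
    refine hasSum_zero.congr_fun fun j ↦ ?_
    rcases lt_or_ge j 0 with hj | hj
    · simp [invQPoch_of_neg _ hj]
    · simp [invQPoch_of_neg _ (show N - j < 0 by lia)]
  lift N to ℕ using hN
  suffices h : ∑' j : ℤ, x ^ j * (invQPoch (x ^ 2) j * invQPoch (x ^ 2) (N - j)) = invQPoch x N from
    h ▸ (hs _ N).hasSum
  induction N with
  | zero =>
    rw [tsum_eq_single 0]
    · simp
    · intro j hj
      rcases lt_or_gt_of_ne hj with h | h
      · simp [invQPoch_of_neg _ h]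
      · simp [invQPoch_of_neg _ (show -j < 0 by simp [h])]
  | succ N ih =>
    rw [Nat.cast_add_one]
    have hsh : ∑' j : ℤ, x ^ (-(j : ℤ)) * (invQPoch (x ^ 2) (j - 1) *
        invQPoch (x ^ 2) (N + 1 - j)) = x ^ (-(N + 1 : ℤ)) * invQPoch x N := by
      rw [← ih, ← tsum_mul_left, ← (Equiv.subLeft ((N : ℤ) + 1)).tsum_eq]
      refine tsum_congr fun j ↦ ?_
      simp only [Equiv.subLeft_apply]
      rw [show -((N : ℤ) + 1 - j) = -(N + 1) + j by ring, zpow_add₀ h0, sub_sub_cancel,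
        show (N : ℤ) + 1 - j - 1 = N - j by ring]
      ring
    have hshs : Summable fun j : ℤ ↦ x ^ (-(j : ℤ)) * (invQPoch (x ^ 2) (j - 1) *
        invQPoch (x ^ 2) (N + 1 - j)) := by
      refine ((Equiv.subRight (1 : ℤ)).summable_iff.2 (hs (fun j ↦ x ^ (-(j + 1))) N)).congr
        fun j ↦ ?_
      simp only [Function.comp_apply, Equiv.subRight_apply]
      rw [sub_add_cancel, show (N : ℤ) - (j - 1) = N + 1 - j by ring]
    have hne : 1 - (x ^ 2) ^ ((N : ℤ) + 1) ≠ 0 := by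
      rw [zpow_add_one₀ hq0, zpow_natCast, mul_comm]
      exact sub_ne_zero.2 (mul_pow_ne_one_of_norm_lt_one hq hq N).symm
    refine mul_left_cancel₀ hne ?_
    have hstep := one_sub_zpow_mul_invQPoch hx ((N : ℤ) + 1)
    rw [add_sub_cancel_right] at hstep
    have hrec : (1 - (x ^ 2) ^ ((N : ℤ) + 1)) *
        ∑' j : ℤ, x ^ j * (invQPoch (x ^ 2) j * invQPoch (x ^ 2) (N + 1 - j)) =
        invQPoch x N + (x ^ 2) ^ ((N : ℤ) + 1) * (x ^ (-(N + 1 : ℤ)) * invQPoch x N) := by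
      rw [← hsh, ← tsum_mul_left, ← tsum_mul_left, ← ih, ← (hs _ N).tsum_add (hshs.mul_left _)]
      refine tsum_congr fun j ↦ ?_
      have h1 := one_sub_mul_invQPoch_mul_invQPoch hq hq0 (N + 1 - j) j
      rw [sub_add_cancel, show (N : ℤ) + 1 - j - 1 = N - j by ring] at h1
      have e : x ^ j * (x ^ 2) ^ ((N : ℤ) + 1 - j) = (x ^ 2) ^ ((N : ℤ) + 1) * x ^ (-j) := by
        rw [← zpow_natCast x 2, ← zpow_mul, ← zpow_mul, ← zpow_add₀ h0, ← zpow_add₀ h0]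
        congr 1; push_cast; ring
      linear_combination x ^ j * h1 +
        invQPoch (x ^ 2) (N + 1 - j) * invQPoch (x ^ 2) (j - 1) * e
    have e2 : (x ^ 2) ^ ((N : ℤ) + 1) = x ^ ((N : ℤ) + 1) * x ^ ((N : ℤ) + 1) := by
      rw [← mul_zpow, sq]
    have e3 : x ^ ((N : ℤ) + 1) * x ^ (-(N + 1 : ℤ)) = 1 := by
      rw [← zpow_add₀ h0, add_neg_cancel, zpow_zero]
    rw [hrec, e2]
    linear_combination (x ^ ((N : ℤ) + 1) * invQPoch x N) * e3 - (1 + x ^ ((N : ℤ) + 1)) * hstep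

/-- The summand of the double sums in the variables `m`, `k`, where `n₁ = m + k + ε` and
`n₂ = m - k` are the original summation indices and `q = x²`. -/
noncomputable def doubleTerm (ε : ℤ) (x : ℂ) (p : ℤ × ℤ) : ℂ :=
  x ^ (p.1 ^ 2 + 2 * ε * p.1 + 2 * p.2 ^ 2 + 2 * ε * p.2 - p.2) *
    (invQPoch (x ^ 2) (p.1 + p.2 + ε) * invQPoch (x ^ 2) (p.1 - p.2))

/-- The summand of the triple sum obtained from `doubleTerm` by the Durfee rectangle identity. -/
noncomputable def tripleTerm (ε : ℤ) (x : ℂ) (r s k : ℤ) : ℂ :=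
  x ^ ((r + s) ^ 2 + 2 * ε * (r + s) + 2 * r ^ 2 + 2 * ε * r - k) *
    (invQPoch (x ^ 2) s * invQPoch (x ^ 2) (r - k) * invQPoch (x ^ 2) (r + k + ε))

lemma summable_tripleTerm {x : ℂ} (hx : ‖x‖ < 1) (h0 : x ≠ 0) {ε : ℤ} (h1 : 0 ≤ ε) (h2 : ε ≤ 1) :
    Summable fun p : (ℤ × ℤ) × ℤ ↦ tripleTerm ε x p.2 (p.1.1 - p.2) p.1.2 := by
  have hρ := norm_pos_iff.2 h0
  obtain ⟨C, hC0, hC⟩ := exists_norm_invQPoch_le (norm_pow_lt_one hx two_ne_zero)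
  have hA := (summable_zpow_quadratic hρ hx 1 one_ne_zero 0).mul_of_nonneg
    (summable_zpow_quadratic hρ hx 1 one_ne_zero (-1)) (fun _ ↦ by positivity)
    (fun _ ↦ by positivity)
  have hB := hA.mul_of_nonneg (summable_zpow_quadratic hρ hx 2 two_ne_zero (-2))
    (fun _ ↦ by positivity) (fun _ ↦ by positivity)
  let e : (ℤ × ℤ) × ℤ ≃ (ℤ × ℤ) × ℤ :=
    { toFun := fun p ↦ ((p.1.1 - p.2, p.1.2), p.2)
      invFun := fun p ↦ ((p.1.1 + p.2, p.1.2), p.2)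
      left_inv := fun p ↦ by simp
      right_inv := fun p ↦ by simp }
  have hB' := (e.summable_iff.2 hB).mul_right (‖x‖ ^ (-1 : ℤ) * (C * C * C))
  refine Summable.of_norm_bounded hB' fun p ↦ ?_
  obtain ⟨⟨m, k⟩, r⟩ := p
  simp only [e, Function.comp_apply, Equiv.coe_fn_mk]
  obtain ⟨s, hs⟩ : ∃ s, s = m - r := ⟨_, rfl⟩
  rw [← hs]
  by_cases hsup : 0 ≤ s ∧ 0 ≤ r - k ∧ 0 ≤ r + k + ε
  · obtain ⟨hs0, hk1, hk2⟩ := hsup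
    rw [tripleTerm, norm_mul, norm_mul, norm_mul, norm_zpow, ← mul_assoc (_ * _ * _)]
    refine mul_le_mul ?_ ?_ (by positivity) (by positivity)
    · rw [← zpow_add₀ hρ.ne', ← zpow_add₀ hρ.ne', ← zpow_add₀ hρ.ne']
      refine zpow_le_zpow_right_of_le_one₀ hρ hx.le ?_
      have hr : 0 ≤ r := by lia
      -- on the support of the term, its exponent dominates a diagonal form in `s`, `k`, `r`
      push_cast
      nlinarith [mul_nonneg hr hs0, mul_nonneg h1 hr, mul_nonneg h1 hs0,
        mul_nonneg hk1 hk2, mul_nonneg hk1 (sub_nonneg.2 h2)]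
    · gcongr
      exacts [hC _, hC _, hC _]
  · have : tripleTerm ε x r s k = 0 := by
      rw [tripleTerm]
      rcases lt_or_ge s 0 with h | h
      · simp [invQPoch_of_neg _ h]
      rcases lt_or_ge (r - k) 0 with h' | h'
      · simp [invQPoch_of_neg _ h']
      · rw [invQPoch_of_neg _ (show r + k + ε < 0 by lia)]; simp
    rw [this, norm_zero]
    positivity

/-- Summed over `r` with `r + s` fixed, the triple sum gives back the double sum. -/
lemma hasSum_tripleTerm_fst {x : ℂ} (hx : ‖x‖ < 1) (h0 : x ≠ 0) (ε : ℤ) (p : ℤ × ℤ) :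
    HasSum (fun r ↦ tripleTerm ε x r (p.1 - r) p.2) (doubleTerm ε x p) := by
  have hq := norm_pow_lt_one hx two_ne_zero
  have hq0 := pow_ne_zero 2 h0
  have h := ((Equiv.subLeft p.1).hasSum_iff.2
    (hasSum_invQPoch_mul_invQPoch hq hq0 (p.1 + p.2 + ε) (p.1 - p.2))).mul_left
    (x ^ (p.1 ^ 2 + 2 * ε * p.1 + 2 * p.2 ^ 2 + 2 * ε * p.2 - p.2))
  refine h.congr_fun fun r ↦ ?_
  simp only [Function.comp_apply, Equiv.subLeft_apply, tripleTerm]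
  have e : x ^ ((r + (p.1 - r)) ^ 2 + 2 * ε * (r + (p.1 - r)) + 2 * r ^ 2 + 2 * ε * r - p.2) =
      x ^ (p.1 ^ 2 + 2 * ε * p.1 + 2 * p.2 ^ 2 + 2 * ε * p.2 - p.2) *
        (x ^ 2) ^ ((p.1 + p.2 + ε - (p.1 - r)) * (p.1 - p.2 - (p.1 - r))) := by
    rw [← zpow_natCast x 2, ← zpow_mul, ← zpow_add₀ h0]; congr 1; push_cast; ring
  rw [e, show p.1 + p.2 + ε - (p.1 - r) = r + p.2 + ε by ring,
    show p.1 - p.2 - (p.1 - r) = r - p.2 by ring]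
  ring

lemma hasSum_euler_int {x : ℂ} (hx : ‖x‖ < 1) (h0 : x ≠ 0) (n : ℤ) :
    HasSum (fun s : ℤ ↦ x ^ (s ^ 2 + 2 * n * s) * invQPoch (x ^ 2) s)
      (qPochInf (-(x ^ (2 * n + 1))) (x ^ 2)) := by
  refine hasSum_int_of_nat (fun s hs ↦ by simp [invQPoch_of_neg _ hs]) ?_
  have h := hasSum_euler hx (x ^ (2 * n))
  rw [← zpow_add_one₀ h0] at h
  refine h.congr_fun fun t ↦ ?_
  rw [zpow_add₀ h0, zpow_mul _ _ (t : ℤ), zpow_natCast, ← Nat.cast_pow, zpow_natCast]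

/-- For fixed `r`, the sums over `s` and `k` separate: Euler's expansion evaluates the first and the
Rogers–Szegő polynomial the second. -/
lemma hasSum_tripleTerm_snd {x : ℂ} (hx : ‖x‖ < 1) (h0 : x ≠ 0) (ε r : ℤ) :
    HasSum (fun p : ℤ × ℤ ↦ tripleTerm ε x r (p.1 - r) p.2)
      (x ^ (3 * r ^ 2 + (4 * ε - 1) * r) * (qPochInf (-(x ^ (2 * (r + ε) + 1))) (x ^ 2) *
        invQPoch x (2 * r + ε))) := by
  have hq := norm_pow_lt_one hx two_ne_zero
  have hE := hasSum_euler_int hx h0 (r + ε)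
  have hR := hasSum_rogers_szego hx h0 (2 * r + ε)
  have hR' := (Equiv.subLeft r).hasSum_iff.2 hR
  have h1 := hasSum_mul_of_summable_norm hE hR' hE.summable.norm hR'.summable.norm
  let e : ℤ × ℤ ≃ ℤ × ℤ := (Equiv.subRight r).prodCongr (Equiv.refl ℤ)
  have h2 := (e.hasSum_iff.2 h1).mul_left (x ^ (3 * r ^ 2 + (4 * ε - 1) * r))
  refine h2.congr_fun fun p ↦ ?_
  obtain ⟨m, k⟩ := p
  simp only [e, Function.comp_apply, Equiv.prodCongr_apply, Prod.map, Equiv.subRight_apply,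
    Equiv.refl_apply, Equiv.subLeft_apply, tripleTerm]
  rw [show 2 * r + ε - (r - k) = r + k + ε by ring]
  have e : x ^ ((r + (m - r)) ^ 2 + 2 * ε * (r + (m - r)) + 2 * r ^ 2 + 2 * ε * r - k) =
      x ^ (3 * r ^ 2 + (4 * ε - 1) * r) * (x ^ ((m - r) ^ 2 + 2 * (r + ε) * (m - r)) *
        x ^ (r - k)) := by
    rw [← zpow_add₀ h0, ← zpow_add₀ h0]; congr 1; ring
  rw [e]
  ring

/-- Interchanging the sums in the triple sum leaves a single sum over `r`. -/
lemma hasSum_doubleTerm_of_hasSum {x : ℂ} (hx : ‖x‖ < 1) (h0 : x ≠ 0) {ε : ℤ} (h1 : 0 ≤ ε)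
    (h2 : ε ≤ 1) {s : ℂ}
    (hs : HasSum (fun r : ℕ ↦ x ^ (3 * (r : ℤ) ^ 2 + (4 * ε - 1) * r) *
      (qPochInf (-(x ^ (2 * (r + ε) + 1))) (x ^ 2) * invQPoch x (2 * r + ε))) s) :
    HasSum (doubleTerm ε x) s := by
  have hF := summable_tripleTerm hx h0 h1 h2
  have hs' := hasSum_int_of_nat (f := fun r : ℤ ↦ x ^ (3 * r ^ 2 + (4 * ε - 1) * r) *
      (qPochInf (-(x ^ (2 * (r + ε) + 1))) (x ^ 2) * invQPoch x (2 * r + ε)))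
      (fun r hr ↦ by rw [invQPoch_of_neg _ (show 2 * r + ε < 0 by lia)]; simp) hs
  refine HasSum.of_prod_swap (F := fun p : ℤ × (ℤ × ℤ) ↦ tripleTerm ε x p.1 (p.2.1 - p.1) p.2.2)
    ((Equiv.prodComm ℤ (ℤ × ℤ)).summable_iff.2 hF) ?_ ?_ hs'
  · exact fun r ↦ hasSum_tripleTerm_snd hx h0 ε r
  · exact fun p ↦ hasSum_tripleTerm_fst hx h0 ε p

lemma choose_two_mul_two (r : ℕ) : (r.choose 2 : ℤ) * 2 = r * (r - 1) := by
  have h := Nat.cast_choose_two ℚ r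
  have h2 : (r.choose 2 : ℚ) * 2 = r * (r - 1) := by rw [h]; ring
  exact_mod_cast h2

lemma qPoch_two_mul {x : ℂ} (r : ℕ) :
    qPoch x x (2 * r) = qPoch x (x ^ 2) r * qPoch (x ^ 2) (x ^ 2) r := by
  induction r with
  | zero => simp
  | succ r ih =>
    rw [mul_add, mul_one, show 2 * r + 2 = 2 * r + 1 + 1 by rfl, qPoch_succ, qPoch_succ, ih,
      qPoch_succ, qPoch_succ]
    ring

lemma qPoch_mul_qPoch_neg (a q : ℂ) (r : ℕ) :
    qPoch a q r * qPoch (-a) q r = qPoch (a ^ 2) (q ^ 2) r := by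
  simp only [qPoch, ← Finset.prod_mul_distrib]
  exact Finset.prod_congr rfl fun k _ ↦ by ring

lemma hasSum_doubleTerm_zero {x : ℂ} (hx : ‖x‖ < 1) (h0 : x ≠ 0) :
    HasSum (doubleTerm 0 x) (qPochInf (-x) (x ^ 2) *
      (qPochInf ((x ^ 2) ^ 10) ((x ^ 2) ^ 10) * (qPochInf ((x ^ 2) ^ 6) ((x ^ 2) ^ 10) *
        qPochInf ((x ^ 2) ^ 4) ((x ^ 2) ^ 10)) / qPochInf (x ^ 2) (x ^ 2))) := by
  have hq := norm_pow_lt_one hx two_ne_zero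
  refine hasSum_doubleTerm_of_hasSum hx h0 le_rfl zero_le_one
    (((hasSum_slater_zero hq (pow_ne_zero 2 h0)).mul_left _).congr_fun fun r ↦ ?_)
  rw [← qPoch_mul_qPochInf (-x) hq r, ← qPoch_mul_qPoch_neg x (x ^ 2) r, add_zero,
    show 2 * (r : ℤ) + 0 = (2 * r : ℕ) by push_cast; ring, invQPoch_natCast, qPoch_two_mul]
  have n1 := qPoch_ne_zero_of_norm_lt_one (by rwa [norm_neg] : ‖-x‖ < 1) hq r
  have n2 := qPoch_ne_zero_of_norm_lt_one hx hq r
  have n3 := qPoch_ne_zero_of_norm_lt_one hq hq r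
  have e : x ^ (3 * (r : ℤ) ^ 2 + (4 * 0 - 1) * r) = (x ^ 2) ^ (r ^ 2 + r.choose 2) := by
    rw [← pow_mul, ← zpow_natCast x (2 * _)]
    congr 1
    have h3 := choose_two_mul_two r
    push_cast
    linarith
  have e2 : -x ^ (2 * (r : ℤ) + 1) = -x * (x ^ 2) ^ r := by
    rw [zpow_add_one₀ h0, zpow_mul, zpow_natCast]; norm_cast; ring
  rw [e, e2]
  field_simp

lemma hasSum_doubleTerm_one {x : ℂ} (hx : ‖x‖ < 1) (h0 : x ≠ 0) :
    HasSum (doubleTerm 1 x) (qPochInf (-x) (x ^ 2) *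
      (qPochInf ((x ^ 2) ^ 10) ((x ^ 2) ^ 10) * (qPochInf ((x ^ 2) ^ 8) ((x ^ 2) ^ 10) *
        qPochInf ((x ^ 2) ^ 2) ((x ^ 2) ^ 10)) / qPochInf (x ^ 2) (x ^ 2))) := by
  have hq := norm_pow_lt_one hx two_ne_zero
  refine hasSum_doubleTerm_of_hasSum hx h0 zero_le_one le_rfl
    (((hasSum_slater_one hq (pow_ne_zero 2 h0)).mul_left _).congr_fun fun r ↦ ?_)
  rw [← qPoch_mul_qPochInf (-x) hq (r + 1), ← qPoch_mul_qPoch_neg x (x ^ 2) (r + 1),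
    show 2 * (r : ℤ) + 1 = (2 * r + 1 : ℕ) by push_cast; ring, invQPoch_natCast, qPoch_succ x x,
    qPoch_two_mul]
  have n1 := qPoch_ne_zero_of_norm_lt_one (by rwa [norm_neg] : ‖-x‖ < 1) hq (r + 1)
  have n2 := qPoch_ne_zero_of_norm_lt_one hx hq (r + 1)
  have n3 := qPoch_ne_zero_of_norm_lt_one hq hq r
  have e : x ^ (3 * (r : ℤ) ^ 2 + (4 * 1 - 1) * r) =
      (x ^ 2) ^ (r ^ 2 + r + (r + 1).choose 2) := by
    rw [← pow_mul, ← zpow_natCast x (2 * _)]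
    congr 1
    have h3 := choose_two_mul_two (r + 1)
    push_cast at h3 ⊢
    linarith
  have e2 : -x ^ (2 * ((r : ℤ) + 1) + 1) = -x * (x ^ 2) ^ (r + 1) := by
    rw [zpow_add_one₀ h0, zpow_mul]; norm_cast; ring
  rw [e, e2]
  rw [qPoch_succ x] at n2 ⊢
  have n4 := left_ne_zero_of_mul n2
  have n5 := right_ne_zero_of_mul n2
  have e3 : 1 - x * x ^ (2 * r) = 1 - x * (x ^ 2) ^ r := by rw [pow_mul]
  rw [e3]
  field_simp

/-! ### The four double-sum identities -/

lemma hasSum_of_two_ranges {α β γ : Type*} {F : γ → ℂ} {ψ₁ : α → γ} {ψ₂ : β → γ}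
    (h1 : ψ₁.Injective) (h2 : ψ₂.Injective) (hd : ∀ a b, ψ₁ a ≠ ψ₂ b)
    (hF : ∀ p, p ∉ Set.range ψ₁ → p ∉ Set.range ψ₂ → F p = 0) {s t : ℂ}
    (hs : HasSum (F ∘ ψ₁) s) (ht : HasSum (F ∘ ψ₂) t) : HasSum F (s + t) := by
  have e1 : HasSum ((Set.range ψ₁).indicator F) s := by
    refine (h1.hasSum_iff fun p hp ↦ Set.indicator_of_notMem hp F).1 (hs.congr_fun fun a ↦ ?_)
    simp
  have e2 : HasSum ((Set.range ψ₂).indicator F) t := by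
    refine (h2.hasSum_iff fun p hp ↦ Set.indicator_of_notMem hp F).1 (ht.congr_fun fun a ↦ ?_)
    simp
  refine (e1.add e2).congr_fun fun p ↦ ?_
  by_cases hp1 : p ∈ Set.range ψ₁
  · have hp2 : p ∉ Set.range ψ₂ := by
      rintro ⟨b, rfl⟩
      obtain ⟨a, ha⟩ := hp1
      exact hd a b ha
    simp [hp1, Set.indicator_of_notMem hp2]
  · by_cases hp2 : p ∈ Set.range ψ₂
    · simp [hp2, Set.indicator_of_notMem hp1]
    · rw [Set.indicator_of_notMem hp1, Set.indicator_of_notMem hp2, hF p hp1 hp2, add_zero]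

/-- The even and odd parts in `x` of `∑ₙ x^(2 n² + n)` are theta series in `q = x²`. -/
lemma theta_split {x q : ℂ} (hxq : x ^ 2 = q) (hx : ‖x‖ < 1) (h0 : x ≠ 0) :
    qPochInf (q ^ 2) (q ^ 2) * qPochInf (-x) q =
      qPochInf (q ^ 8) (q ^ 8) *
        (qPochInf (-q ^ 5) (q ^ 8) * qPochInf (-q ^ 3) (q ^ 8)) +
      x * (qPochInf (q ^ 8) (q ^ 8) *
        (qPochInf (-q ^ 7) (q ^ 8) * qPochInf (-q) (q ^ 8))) := by
  have hq : ‖q‖ < 1 := hxq ▸ norm_pow_lt_one hx two_ne_zero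
  have hq0 : q ≠ 0 := hxq ▸ pow_ne_zero 2 h0
  have hq4 := norm_pow_lt_one hq (n := 4) (by norm_num)
  have h := hasSum_jacobi_triple_product hq hq0 h0
  have hE := hasSum_jacobi_triple_product hq4 (pow_ne_zero 4 hq0) hq0
  have hO := (hasSum_jacobi_triple_product hq4 (pow_ne_zero 4 hq0) (pow_ne_zero 3 hq0)).mul_left x
  have hr := prod_qPochInf_residues (-x) hq two_ne_zero
  rw [Finset.prod_range_succ, Finset.prod_range_one, pow_zero, pow_one, mul_one, neg_mul] at hr
  have e1 : q / x = x := by rw [← hxq]; field_simp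
  have e2 : q ^ 4 / q = q ^ 3 := by field_simp
  have e3 : q ^ 4 / q ^ 3 = q := by field_simp
  have e4 : (q ^ 4) ^ 2 = q ^ 8 := by ring
  have e5 : q * q ^ 4 = q ^ 5 := by ring
  have e6 : q ^ 3 * q ^ 4 = q ^ 7 := by ring
  rw [e1] at h
  rw [e2, e4, e5] at hE
  rw [e3, e4, e6] at hO
  rw [← hr, mul_comm (qPochInf (-x) _)]
  refine h.unique (hasSum_of_two_ranges (ψ₁ := fun p : ℤ ↦ 2 * p) (ψ₂ := fun p : ℤ ↦ -(2 * p + 1))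
    (fun a b h ↦ by dsimp only at h; lia) (fun a b h ↦ by dsimp only at h; lia)
    (fun a b ↦ by lia) ?_ (hE.congr_fun fun p ↦ ?_) (hO.congr_fun fun p ↦ ?_))
  · intro p h1 h2
    exfalso
    rcases Int.even_or_odd p with ⟨a, ha⟩ | ⟨a, ha⟩
    · exact h1 ⟨a, by dsimp only; lia⟩
    · exact h2 ⟨-a - 1, by dsimp only; lia⟩
  · simp only [Function.comp_apply]
    simp only [← hxq, ← zpow_natCast, ← zpow_mul, ← zpow_add₀ h0]
    congr 1; push_cast; ring
  · simp only [Function.comp_apply]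
    simp only [← hxq, ← zpow_natCast, ← zpow_mul, ← zpow_add₀ h0]
    rw [← zpow_one_add₀ h0]
    congr 1; push_cast; ring

/-- If `f` and `g` are the terms of the double sum whose index lies in the two parity classes, then
both series are summable, and their sums are read off from the parts even and odd in `x`. -/
lemma hasSum_parity_parts {ε : ℤ} {x q : ℂ} (hxq : x ^ 2 = q) (hx : ‖x‖ < 1) (h0 : x ≠ 0)
    {f g : ℕ × ℕ → ℂ} {ψ₁ ψ₂ : ℕ × ℕ → ℤ × ℤ} (h1 : ψ₁.Injective) (h2 : ψ₂.Injective)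
    (hd : ∀ a b, ψ₁ a ≠ ψ₂ b)
    (hr : ∀ p : ℤ × ℤ, 0 ≤ p.1 + p.2 + ε → 0 ≤ p.1 - p.2 →
      p ∈ Set.range ψ₁ ∨ p ∈ Set.range ψ₂)
    (hf : ∀ y, y ^ 2 = q → ∀ p, doubleTerm ε y (ψ₁ p) = f p)
    (hg : ∀ y, y ^ 2 = q → ∀ p, doubleTerm ε y (ψ₂ p) = y * g p) {c : ℂ}
    (hs : ∀ y, y ^ 2 = q → HasSum (doubleTerm ε y) (qPochInf (-y) q * c)) :
    HasSum f (qPochInf (q ^ 8) (q ^ 8) *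
        (qPochInf (-q ^ 5) (q ^ 8) * qPochInf (-q ^ 3) (q ^ 8)) *
          (c / qPochInf (q ^ 2) (q ^ 2))) ∧
    HasSum g (qPochInf (q ^ 8) (q ^ 8) *
        (qPochInf (-q ^ 7) (q ^ 8) * qPochInf (-q) (q ^ 8)) *
          (c / qPochInf (q ^ 2) (q ^ 2))) := by
  have hq2 := norm_pow_lt_one (hxq ▸ norm_pow_lt_one hx two_ne_zero : ‖q‖ < 1) two_ne_zero
  have hP := qPochInf_ne_zero_of_norm_lt_one hq2 hq2
  have hfs : Summable f := ((hs x hxq).summable.comp_injective h1).congr (hf x hxq)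
  have hgs : Summable g := by
    have := (((hs x hxq).summable.comp_injective h2).congr (hg x hxq)).mul_left x⁻¹
    refine this.congr fun p ↦ ?_
    rw [inv_mul_cancel_left₀ h0]
  have key (y : ℂ) (hy : y ^ 2 = q) :
      qPochInf (-y) q * c = ∑' p, f p + y * ∑' p, g p := by
    refine (hs y hy).unique (hasSum_of_two_ranges h1 h2 hd (fun p hp1 hp2 ↦ ?_)
      (hfs.hasSum.congr_fun (hf y hy)) ((hgs.hasSum.mul_left y).congr_fun (hg y hy)))
    have := hr p
    rw [doubleTerm]
    rcases lt_or_ge (p.1 + p.2 + ε) 0 with h | h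
    · simp [invQPoch_of_neg _ h]
    · rcases lt_or_ge (p.1 - p.2) 0 with h' | h'
      · simp [invQPoch_of_neg _ h']
      · tauto
  have k1 := key x hxq
  -- the other square root of `q` changes the sign of the odd part
  have k2 := key (-x) ((neg_sq x).trans hxq)
  have t1 := theta_split hxq hx h0
  have t2 := theta_split (x := -x) ((neg_sq x).trans hxq) (by rwa [norm_neg]) (neg_ne_zero.2 h0)
  generalize qPochInf (q ^ 8) (q ^ 8) *
        (qPochInf (-q ^ 5) (q ^ 8) * qPochInf (-q ^ 3) (q ^ 8)) = A at *
  generalize qPochInf (q ^ 8) (q ^ 8) *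
        (qPochInf (-q ^ 7) (q ^ 8) * qPochInf (-q) (q ^ 8)) = B at *
  generalize qPochInf (q ^ 2) (q ^ 2) = D at *
  have hA : ∑' p, f p = A * (c / D) := by
    field_simp
    linear_combination (c / 2) * t1 + (c / 2) * t2 - D / 2 * k1 - D / 2 * k2
  have hB : ∑' p, g p = B * (c / D) := by
    field_simp
    refine mul_left_cancel₀ h0 ?_
    linear_combination (c / 2) * t1 - (c / 2) * t2 - D / 2 * k1 + D / 2 * k2
  exact ⟨hA ▸ hfs.hasSum, hB ▸ hgs.hasSum⟩

lemma exists_sq_root {q : ℂ} (hq : ‖q‖ < 1) (h0 : q ≠ 0) :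
    ∃ x : ℂ, x ^ 2 = q ∧ ‖x‖ < 1 ∧ x ≠ 0 := by
  obtain ⟨x, hx⟩ := IsAlgClosed.exists_pow_nat_eq q two_pos
  refine ⟨x, hx, ?_, fun h ↦ h0 (by rw [← hx, h]; simp)⟩
  rw [← hx, norm_pow] at hq
  exact (pow_lt_one_iff_of_nonneg (norm_nonneg x) two_ne_zero).1 hq

lemma qPochInf_two_residues {q : ℂ} (hq : ‖q‖ < 1) :
    qPochInf (q ^ 2) (q ^ 2) = qPochInf (q ^ 2) (q ^ 10) * qPochInf (q ^ 4) (q ^ 10) *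
      qPochInf (q ^ 6) (q ^ 10) * qPochInf (q ^ 8) (q ^ 10) * qPochInf (q ^ 10) (q ^ 10) := by
  have h := prod_qPochInf_residues (q ^ 2) (norm_pow_lt_one hq two_ne_zero) (m := 5) (by norm_num)
  simp only [Finset.prod_range_succ, Finset.prod_range_zero, one_mul, ← pow_mul, ← pow_add] at h
  exact h.symm

lemma zpow_half_eq {y q : ℂ} (hy : y ^ 2 = q) {a b : ℤ} (h : b = 2 * a) : y ^ b = q ^ a := by
  rw [h, zpow_mul, ← hy]; norm_cast

/-- The two sums with `n₁ ≡ n₂` modulo `2`, where `(n₁, n₂)` is `(2 i, 2 j)` or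
`(2 i + 1, 2 j + 1)`. -/
lemma hasSum_lattice_zero {q : ℂ} (hq : ‖q‖ < 1) (hq0 : q ≠ 0) :
    HasSum (fun p : ℕ × ℕ ↦
          q ^ ((3 * (p.1 : ℤ) ^ 2 - 2 * p.1 * p.2 + 3 * (p.2 : ℤ) ^ 2 - p.1 + p.2) / 2)
            / (qPoch q q (2 * p.1) * qPoch q q (2 * p.2)))
        (qPochInf (-q ^ 3) (q ^ 8) * qPochInf (-q ^ 5) (q ^ 8) * qPochInf (q ^ 8) (q ^ 8)
          / (qPochInf q q * (qPochInf (q ^ 2) (q ^ 10) * qPochInf (q ^ 8) (q ^ 10)))) ∧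
      HasSum (fun p : ℕ × ℕ ↦
          q ^ ((3 * (p.1 : ℤ) ^ 2 - 2 * p.1 * p.2 + 3 * (p.2 : ℤ) ^ 2 + p.1 + 3 * p.2) / 2)
            / (qPoch q q (2 * p.1 + 1) * qPoch q q (2 * p.2 + 1)))
        (qPochInf (-q) (q ^ 8) * qPochInf (-q ^ 7) (q ^ 8) * qPochInf (q ^ 8) (q ^ 8)
          / (qPochInf q q * (qPochInf (q ^ 2) (q ^ 10) * qPochInf (q ^ 8) (q ^ 10)))) := by
  obtain ⟨x, hxq, hx, hx0⟩ := exists_sq_root hq hq0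
  have hyn (y : ℂ) (hy : y ^ 2 = q) : ‖y‖ < 1 := by
    rw [← hy, norm_pow] at hq
    exact (pow_lt_one_iff_of_nonneg (norm_nonneg y) two_ne_zero).1 hq
  have hy0 (y : ℂ) (hy : y ^ 2 = q) : y ≠ 0 := by rintro rfl; simp [hq0.symm] at hy
  obtain ⟨h1, h2⟩ := hasSum_parity_parts (ε := 0) hxq hx hx0
    (f := fun p : ℕ × ℕ ↦
      q ^ ((3 * (p.1 : ℤ) ^ 2 - 2 * p.1 * p.2 + 3 * (p.2 : ℤ) ^ 2 - p.1 + p.2) / 2)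
      / (qPoch q q (2 * p.1) * qPoch q q (2 * p.2)))
    (g := fun p : ℕ × ℕ ↦
      q ^ ((3 * (p.1 : ℤ) ^ 2 - 2 * p.1 * p.2 + 3 * (p.2 : ℤ) ^ 2 + p.1 + 3 * p.2) / 2)
      / (qPoch q q (2 * p.1 + 1) * qPoch q q (2 * p.2 + 1)))
    (ψ₁ := fun p ↦ ((p.1 : ℤ) + p.2, (p.1 : ℤ) - p.2))
    (ψ₂ := fun p ↦ ((p.1 : ℤ) + p.2 + 1, (p.1 : ℤ) - p.2))
    (fun a b h ↦ by simp only [Prod.mk.injEq] at h; ext <;> lia)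
    (fun a b h ↦ by simp only [Prod.mk.injEq] at h; ext <;> lia)
    (fun a b h ↦ by simp only [Prod.mk.injEq] at h; lia)
    (fun p hp1 hp2 ↦ by
      simp only [Set.mem_range, Prod.exists, Prod.ext_iff]
      rcases Int.even_or_odd (p.1 + p.2) with ⟨a, ha⟩ | ⟨a, ha⟩
      · exact .inl ⟨a.toNat, (a - p.2).toNat, by lia, by lia⟩
      · exact .inr ⟨a.toNat, (a - p.2).toNat, by lia, by lia⟩)
    (fun y hy p ↦ by
      obtain ⟨i, j⟩ := p
      simp only [doubleTerm, hy]
      rw [show (i : ℤ) + j + ((i : ℤ) - j) + 0 = (2 * i : ℕ) by push_cast; ring,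
        show (i : ℤ) + j - ((i : ℤ) - j) = (2 * j : ℕ) by push_cast; ring,
        invQPoch_natCast, invQPoch_natCast, zpow_half_eq hy
          (a := (3 * (i : ℤ) ^ 2 - 2 * i * j + 3 * (j : ℤ) ^ 2 - i + j) / 2) ?_]
      · field_simp
      · rw [Int.mul_ediv_cancel' (by rw [← even_iff_two_dvd]; simp [parity_simps]; tauto)]
        ring)
    (fun y hy p ↦ by
      obtain ⟨i, j⟩ := p
      simp only [doubleTerm, hy]
      rw [show (i : ℤ) + j + 1 + ((i : ℤ) - j) + 0 = (2 * i + 1 : ℕ) by push_cast; ring,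
        show (i : ℤ) + j + 1 - ((i : ℤ) - j) = (2 * j + 1 : ℕ) by push_cast; ring,
        invQPoch_natCast, invQPoch_natCast, ← zpow_half_eq hy
          (a := (3 * (i : ℤ) ^ 2 - 2 * i * j + 3 * (j : ℤ) ^ 2 + i + 3 * j) / 2)
          (b := 3 * (i : ℤ) ^ 2 - 2 * i * j + 3 * (j : ℤ) ^ 2 + i + 3 * j)
          (Int.mul_ediv_cancel' (by rw [← even_iff_two_dvd]; simp [parity_simps]; tauto)).symm,
        one_div_mul_one_div, mul_one_div, ← mul_div_assoc, ← zpow_one_add₀ (hy0 y hy)]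
      congr 2
      ring)
    (fun y hy ↦ by simpa only [hy] using hasSum_doubleTerm_zero (hyn y hy) (hy0 y hy))
  have hr := qPochInf_two_residues hq
  have n0 := qPochInf_ne_zero_of_norm_lt_one hq hq
  have n10 := norm_pow_lt_one hq (n := 10) (by norm_num)
  have n1 := qPochInf_ne_zero_of_norm_lt_one (norm_pow_lt_one hq (n := 2) (by norm_num)) n10
  have n2 := qPochInf_ne_zero_of_norm_lt_one (norm_pow_lt_one hq (n := 4) (by norm_num)) n10
  have n3 := qPochInf_ne_zero_of_norm_lt_one (norm_pow_lt_one hq (n := 6) (by norm_num)) n10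
  have n4 := qPochInf_ne_zero_of_norm_lt_one (norm_pow_lt_one hq (n := 8) (by norm_num)) n10
  have n5 := qPochInf_ne_zero_of_norm_lt_one (norm_pow_lt_one hq (n := 10) (by norm_num)) n10
  rw [hr] at h1 h2
  constructor
  · convert h1 using 1
    field_simp
  · convert h2 using 1
    field_simp

/-- The two sums with `n₁ ≢ n₂` modulo `2`, where `(n₁, n₂)` is `(2 i + 1, 2 j)` or
`(2 i, 2 j + 1)`. -/
lemma hasSum_lattice_one {q : ℂ} (hq : ‖q‖ < 1) (hq0 : q ≠ 0) :
    HasSum (fun p : ℕ × ℕ ↦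
          q ^ ((3 * (p.1 : ℤ) ^ 2 - 2 * p.1 * p.2 + 3 * (p.2 : ℤ) ^ 2 + 3 * p.1 + p.2) / 2)
            / (qPoch q q (2 * p.1 + 1) * qPoch q q (2 * p.2)))
        (qPochInf (-q ^ 3) (q ^ 8) * qPochInf (-q ^ 5) (q ^ 8) * qPochInf (q ^ 8) (q ^ 8)
          / (qPochInf q q * (qPochInf (q ^ 4) (q ^ 10) * qPochInf (q ^ 6) (q ^ 10)))) ∧
      HasSum (fun p : ℕ × ℕ ↦
          q ^ ((3 * (p.1 : ℤ) ^ 2 - 2 * p.1 * p.2 + 3 * (p.2 : ℤ) ^ 2 - p.1 + 5 * p.2) / 2)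
            / (qPoch q q (2 * p.1) * qPoch q q (2 * p.2 + 1)))
        (qPochInf (-q) (q ^ 8) * qPochInf (-q ^ 7) (q ^ 8) * qPochInf (q ^ 8) (q ^ 8)
          / (qPochInf q q * (qPochInf (q ^ 4) (q ^ 10) * qPochInf (q ^ 6) (q ^ 10)))) := by
  obtain ⟨x, hxq, hx, hx0⟩ := exists_sq_root hq hq0
  have hyn (y : ℂ) (hy : y ^ 2 = q) : ‖y‖ < 1 := by
    rw [← hy, norm_pow] at hq
    exact (pow_lt_one_iff_of_nonneg (norm_nonneg y) two_ne_zero).1 hq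
  have hy0 (y : ℂ) (hy : y ^ 2 = q) : y ≠ 0 := by rintro rfl; simp [hq0.symm] at hy
  obtain ⟨h1, h2⟩ := hasSum_parity_parts (ε := 1) hxq hx hx0
    (f := fun p : ℕ × ℕ ↦
      q ^ ((3 * (p.1 : ℤ) ^ 2 - 2 * p.1 * p.2 + 3 * (p.2 : ℤ) ^ 2 + 3 * p.1 + p.2) / 2)
      / (qPoch q q (2 * p.1 + 1) * qPoch q q (2 * p.2)))
    (g := fun p : ℕ × ℕ ↦
      q ^ ((3 * (p.1 : ℤ) ^ 2 - 2 * p.1 * p.2 + 3 * (p.2 : ℤ) ^ 2 - p.1 + 5 * p.2) / 2)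
      / (qPoch q q (2 * p.1) * qPoch q q (2 * p.2 + 1)))
    (ψ₁ := fun p ↦ ((p.1 : ℤ) + p.2, (p.1 : ℤ) - p.2))
    (ψ₂ := fun p ↦ ((p.1 : ℤ) + p.2, (p.1 : ℤ) - p.2 - 1))
    (fun a b h ↦ by simp only [Prod.mk.injEq] at h; ext <;> lia)
    (fun a b h ↦ by simp only [Prod.mk.injEq] at h; ext <;> lia)
    (fun a b h ↦ by simp only [Prod.mk.injEq] at h; lia)
    (fun p hp1 hp2 ↦ by
      simp only [Set.mem_range, Prod.exists, Prod.ext_iff]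
      rcases Int.even_or_odd (p.1 + p.2) with ⟨a, ha⟩ | ⟨a, ha⟩
      · exact .inl ⟨a.toNat, (a - p.2).toNat, by lia, by lia⟩
      · exact .inr ⟨(a + 1).toNat, (a - p.2).toNat, by lia, by lia⟩)
    (fun y hy p ↦ by
      obtain ⟨i, j⟩ := p
      simp only [doubleTerm, hy]
      rw [show (i : ℤ) + j + ((i : ℤ) - j) + 1 = (2 * i + 1 : ℕ) by push_cast; ring,
        show (i : ℤ) + j - ((i : ℤ) - j) = (2 * j : ℕ) by push_cast; ring,
        invQPoch_natCast, invQPoch_natCast, zpow_half_eq hy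
          (a := (3 * (i : ℤ) ^ 2 - 2 * i * j + 3 * (j : ℤ) ^ 2 + 3 * i + j) / 2) ?_]
      · field_simp
      · rw [Int.mul_ediv_cancel' (by rw [← even_iff_two_dvd]; simp [parity_simps]; tauto)]
        ring)
    (fun y hy p ↦ by
      obtain ⟨i, j⟩ := p
      simp only [doubleTerm, hy]
      rw [show (i : ℤ) + j + ((i : ℤ) - j - 1) + 1 = (2 * i : ℕ) by push_cast; ring,
        show (i : ℤ) + j - ((i : ℤ) - j - 1) = (2 * j + 1 : ℕ) by push_cast; ring,
        invQPoch_natCast, invQPoch_natCast, ← zpow_half_eq hy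
          (a := (3 * (i : ℤ) ^ 2 - 2 * i * j + 3 * (j : ℤ) ^ 2 - i + 5 * j) / 2)
          (b := 3 * (i : ℤ) ^ 2 - 2 * i * j + 3 * (j : ℤ) ^ 2 - i + 5 * j)
          (Int.mul_ediv_cancel' (by rw [← even_iff_two_dvd]; simp [parity_simps]; tauto)).symm,
        one_div_mul_one_div, mul_one_div, ← mul_div_assoc, ← zpow_one_add₀ (hy0 y hy)]
      congr 2
      ring)
    (fun y hy ↦ by simpa only [hy] using hasSum_doubleTerm_one (hyn y hy) (hy0 y hy))
  have hr := qPochInf_two_residues hq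
  have n0 := qPochInf_ne_zero_of_norm_lt_one hq hq
  have n10 := norm_pow_lt_one hq (n := 10) (by norm_num)
  have n1 := qPochInf_ne_zero_of_norm_lt_one (norm_pow_lt_one hq (n := 2) (by norm_num)) n10
  have n2 := qPochInf_ne_zero_of_norm_lt_one (norm_pow_lt_one hq (n := 4) (by norm_num)) n10
  have n3 := qPochInf_ne_zero_of_norm_lt_one (norm_pow_lt_one hq (n := 6) (by norm_num)) n10
  have n4 := qPochInf_ne_zero_of_norm_lt_one (norm_pow_lt_one hq (n := 8) (by norm_num)) n10
  have n5 := qPochInf_ne_zero_of_norm_lt_one (norm_pow_lt_one hq (n := 10) (by norm_num)) n10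
  rw [hr] at h1 h2
  constructor
  · convert h1 using 1
    field_simp
  · convert h2 using 1
    field_simp

/-- At `q = 0` only the term `i = j = 0` survives. -/
lemma hasSum_zero_zpow {e : ℤ → ℤ → ℤ} (he : e 0 0 = 0)
    (he' : ∀ i j : ℤ, 0 ≤ i → 0 ≤ j → 0 < i + j → 2 ≤ e i j) (f g : ℕ → ℕ) :
    HasSum (fun p : ℕ × ℕ ↦ (0 : ℂ) ^ (e p.1 p.2 / 2) /
      (qPoch 0 0 (f p.1) * qPoch 0 0 (g p.2))) 1 := by
  have h := hasSum_single (f := fun p : ℕ × ℕ ↦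
    (0 : ℂ) ^ (e p.1 p.2 / 2) / (qPoch 0 0 (f p.1) * qPoch 0 0 (g p.2))) 0 fun p hp ↦ by
      have hp' : ¬ (p.1 = 0 ∧ p.2 = 0) := fun h ↦ hp (Prod.ext h.1 h.2)
      have := he' p.1 p.2 (by lia) (by lia) (by lia)
      rw [zero_zpow _ (by lia), zero_div]
  simpa [he, qPoch] using h

lemma two_le_quadratic {i j a b : ℤ} (hi : 0 ≤ i) (hj : 0 ≤ j) (h : 0 < i + j) (ha : -1 ≤ a)
    (hb : -1 ≤ b) : 2 ≤ 3 * i ^ 2 - 2 * i * j + 3 * j ^ 2 + a * i + b * j := by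
  have h1 : 0 ≤ i * (i - 1) := by
    rcases hi.eq_or_lt with rfl | h
    · simp
    · exact mul_nonneg hi (by lia)
  have h2 : 0 ≤ j * (j - 1) := by
    rcases hj.eq_or_lt with rfl | h
    · simp
    · exact mul_nonneg hj (by lia)
  have h3 := mul_nonneg hi (neg_le_iff_add_nonneg.1 ha)
  have h4 := mul_nonneg hj (neg_le_iff_add_nonneg.1 hb)
  rcases eq_or_ne i j with rfl | hij
  · nlinarith
  · have h5 : 1 ≤ (i - j) ^ 2 := by
      have : i - j ≠ 0 := sub_ne_zero.2 hij
      have := sq_pos_of_ne_zero this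
      lia
    nlinarith

/-- The four evaluations of the double sums as infinite products. -/
theorem hasSum_lattice_sums (q : ℂ) (hq : ‖q‖ < 1) :
      HasSum (fun p : ℕ × ℕ ↦
          q ^ ((3 * (p.1 : ℤ) ^ 2 - 2 * p.1 * p.2 + 3 * (p.2 : ℤ) ^ 2 - p.1 + p.2) / 2)
            / (qPoch q q (2 * p.1) * qPoch q q (2 * p.2)))
        (qPochInf (-q ^ 3) (q ^ 8) * qPochInf (-q ^ 5) (q ^ 8) * qPochInf (q ^ 8) (q ^ 8)
          / (qPochInf q q * (qPochInf (q ^ 2) (q ^ 10) * qPochInf (q ^ 8) (q ^ 10)))) ∧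
      HasSum (fun p : ℕ × ℕ ↦
          q ^ ((3 * (p.1 : ℤ) ^ 2 - 2 * p.1 * p.2 + 3 * (p.2 : ℤ) ^ 2 + p.1 + 3 * p.2) / 2)
            / (qPoch q q (2 * p.1 + 1) * qPoch q q (2 * p.2 + 1)))
        (qPochInf (-q) (q ^ 8) * qPochInf (-q ^ 7) (q ^ 8) * qPochInf (q ^ 8) (q ^ 8)
          / (qPochInf q q * (qPochInf (q ^ 2) (q ^ 10) * qPochInf (q ^ 8) (q ^ 10)))) ∧
      HasSum (fun p : ℕ × ℕ ↦
          q ^ ((3 * (p.1 : ℤ) ^ 2 - 2 * p.1 * p.2 + 3 * (p.2 : ℤ) ^ 2 + 3 * p.1 + p.2) / 2)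
            / (qPoch q q (2 * p.1 + 1) * qPoch q q (2 * p.2)))
        (qPochInf (-q ^ 3) (q ^ 8) * qPochInf (-q ^ 5) (q ^ 8) * qPochInf (q ^ 8) (q ^ 8)
          / (qPochInf q q * (qPochInf (q ^ 4) (q ^ 10) * qPochInf (q ^ 6) (q ^ 10)))) ∧
      HasSum (fun p : ℕ × ℕ ↦
          q ^ ((3 * (p.1 : ℤ) ^ 2 - 2 * p.1 * p.2 + 3 * (p.2 : ℤ) ^ 2 - p.1 + 5 * p.2) / 2)
            / (qPoch q q (2 * p.1) * qPoch q q (2 * p.2 + 1)))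
        (qPochInf (-q) (q ^ 8) * qPochInf (-q ^ 7) (q ^ 8) * qPochInf (q ^ 8) (q ^ 8)
          / (qPochInf q q * (qPochInf (q ^ 4) (q ^ 10) * qPochInf (q ^ 6) (q ^ 10)))) := by
  rcases eq_or_ne q 0 with rfl | h0
  · refine ⟨?_, ?_, ?_, ?_⟩
    · simpa using hasSum_zero_zpow (e := fun i j ↦ 3 * i ^ 2 - 2 * i * j + 3 * j ^ 2 - i + j)
        (by simp) (fun i j hi hj h ↦ by
          linarith [two_le_quadratic (a := -1) (b := 1) hi hj h (by simp) (by simp)])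
        (fun i ↦ 2 * i) (fun j ↦ 2 * j)
    · simpa using hasSum_zero_zpow (e := fun i j ↦ 3 * i ^ 2 - 2 * i * j + 3 * j ^ 2 + i + 3 * j)
        (by simp) (fun i j hi hj h ↦ by
          linarith [two_le_quadratic (a := 1) (b := 3) hi hj h (by simp) (by simp)])
        (fun i ↦ 2 * i + 1) (fun j ↦ 2 * j + 1)
    · simpa using hasSum_zero_zpow (e := fun i j ↦ 3 * i ^ 2 - 2 * i * j + 3 * j ^ 2 + 3 * i + j)
        (by simp) (fun i j hi hj h ↦ by
          linarith [two_le_quadratic (a := 3) (b := 1) hi hj h (by simp) (by simp)])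
        (fun i ↦ 2 * i + 1) (fun j ↦ 2 * j)
    · simpa using hasSum_zero_zpow (e := fun i j ↦ 3 * i ^ 2 - 2 * i * j + 3 * j ^ 2 - i + 5 * j)
        (by simp) (fun i j hi hj h ↦ by
          linarith [two_le_quadratic (a := -1) (b := 5) hi hj h (by simp) (by simp)])
        (fun i ↦ 2 * i) (fun j ↦ 2 * j + 1)
  · obtain ⟨h1, h2⟩ := hasSum_lattice_zero hq h0
    obtain ⟨h3, h4⟩ := hasSum_lattice_one hq h0
    exact ⟨h1, h2, h3, h4⟩

/-! ### The theta function with real characteristics -/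

/-- The odd Jacobi theta function at the point `v₀ τ + v₁`, normalized by an exponential factor so
that `SL(2, ℤ)` acts on the characteristic `v` by right multiplication, up to a factor independent
of `v`. Up to a constant and a power of `η`, this is a Klein form. -/
noncomputable def charTheta (v : Fin 2 → ℝ) (τ : ℂ) : ℂ :=
  Complex.exp (Real.pi * Complex.I *
      ((v 0) ^ 2 * τ + v 0 * v 1 + τ / 4 - v 0 * τ - v 1 - 1 / 2)) *
    jacobiTheta₂ (v 0 * τ + v 1 - 1 / 2 - τ / 2) τ

/-- The right action of `SL(2, ℤ)` on real row vectors. -/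
noncomputable def rowAct (v : Fin 2 → ℝ) (γ : SL(2, ℤ)) : Fin 2 → ℝ :=
  Matrix.vecMul v (γ.1.map (Int.castRingHom ℝ))

lemma rowAct_mul (v : Fin 2 → ℝ) (γ δ : SL(2, ℤ)) :
    rowAct v (γ * δ) = rowAct (rowAct v γ) δ := by
  simp only [rowAct, Matrix.SpecialLinearGroup.coe_mul, Matrix.map_mul, Matrix.vecMul_vecMul]

lemma rowAct_one (v : Fin 2 → ℝ) : rowAct v 1 = v := by
  simp [rowAct, Matrix.map_one]

lemma rowAct_zero (v : Fin 2 → ℝ) (γ : SL(2, ℤ)) :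
    rowAct v γ 0 = v 0 * (γ.1 0 0 : ℤ) + v 1 * (γ.1 1 0 : ℤ) := by
  simp [rowAct, Matrix.vecMul, dotProduct, Fin.sum_univ_two]

lemma rowAct_one_apply (v : Fin 2 → ℝ) (γ : SL(2, ℤ)) :
    rowAct v γ 1 = v 0 * (γ.1 0 1 : ℤ) + v 1 * (γ.1 1 1 : ℤ) := by
  simp [rowAct, Matrix.vecMul, dotProduct, Fin.sum_univ_two]

lemma jacobiTheta₂_add_one_right (z τ : ℂ) :
    jacobiTheta₂ z (τ + 1) = jacobiTheta₂ (z + 1 / 2) τ := by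
  refine tsum_congr fun n ↦ ?_
  rw [jacobiTheta₂_term, jacobiTheta₂_term]
  -- the two exponents differ by `πi (n² - n)`, a multiple of `2πi`
  obtain ⟨k, hk⟩ : ∃ k : ℤ, n ^ 2 = n + 2 * k := by
    obtain ⟨k, hk⟩ := Int.even_mul_pred_self n
    exact ⟨k, by linarith⟩
  rw [Complex.exp_eq_exp_iff_exists_int]
  have hk' : (n : ℂ) ^ 2 = n + 2 * k := by exact_mod_cast hk
  exact ⟨k, by linear_combination Real.pi * Complex.I * hk'⟩

lemma charTheta_T (v : Fin 2 → ℝ) (τ : ℂ) :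
    charTheta v (τ + 1) = Complex.exp (Real.pi * Complex.I / 4) *
      charTheta (rowAct v ModularGroup.T) τ := by
  have h0 : rowAct v ModularGroup.T 0 = v 0 := by rw [rowAct_zero]; simp [ModularGroup.T]
  have h1 : rowAct v ModularGroup.T 1 = v 0 + v 1 := by rw [rowAct_one_apply]; simp [ModularGroup.T]
  rw [charTheta, charTheta, h0, h1, jacobiTheta₂_add_one_right, ← mul_assoc, ← Complex.exp_add]
  push_cast
  congr 2 <;> ring

lemma charTheta_S (v : Fin 2 → ℝ) {τ : ℂ} (hτ : τ ≠ 0) :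
    charTheta v (-1 / τ) = (-Complex.I * (-Complex.I * τ) ^ (1 / 2 : ℂ)) *
      charTheta (rowAct v ModularGroup.S) τ := by
  have h0 : rowAct v ModularGroup.S 0 = v 1 := by rw [rowAct_zero]; simp [ModularGroup.S]
  have h1 : rowAct v ModularGroup.S 1 = -v 0 := by rw [rowAct_one_apply]; simp [ModularGroup.S]
  have hr : (-Complex.I * τ) ^ (1 / 2 : ℂ) ≠ 0 := by simp [Complex.cpow_eq_zero_iff, hτ]
  rw [charTheta, charTheta, h0, h1]
  push_cast
  have e : (v 1 : ℂ) * τ + -v 0 - 1 / 2 - τ / 2 + 1 = v 1 * τ - v 0 + 1 / 2 - τ / 2 := by ring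
  rw [← jacobiTheta₂_add_left (v 1 * τ + -v 0 - 1 / 2 - τ / 2), e,
    jacobiTheta₂_functional_equation _ τ,
    show (v 0 * (-1 / τ) + v 1 - 1 / 2 - -1 / τ / 2 : ℂ) =
      (v 1 * τ - v 0 + 1 / 2 - τ / 2) / τ by field_simp; ring]
  have e2 : Complex.exp (Real.pi * Complex.I * (v 0 ^ 2 * (-1 / τ) + v 0 * v 1 + -1 / τ / 4 -
      v 0 * (-1 / τ) - v 1 - 1 / 2)) = -Complex.I *
      (Complex.exp (Real.pi * Complex.I * (v 1 ^ 2 * τ + v 1 * -v 0 + τ / 4 - v 1 * τ - -v 0 -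
        1 / 2)) *
        Complex.exp (-Real.pi * Complex.I * (v 1 * τ - v 0 + 1 / 2 - τ / 2) ^ 2 / τ)) := by
    have : -Complex.I = Complex.exp (-(Real.pi / 2 * Complex.I)) := by
      rw [Complex.exp_neg, Complex.exp_pi_div_two_mul_I, Complex.inv_I]
    rw [this, ← Complex.exp_add, ← Complex.exp_add]
    congr 1
    field_simp
    ring
  rw [e2]
  field_simp

/-- The automorphy factor of `charTheta` does not depend on the characteristic. -/
theorem exists_charTheta_smul (γ : SL(2, ℤ)) (τ : UpperHalfPlane) :
    ∃ μ : ℂ, μ ≠ 0 ∧ ∀ v, charTheta v (γ • τ : UpperHalfPlane) = μ * charTheta (rowAct v γ) τ := by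
  have hγ : γ ∈ Subgroup.closure {ModularGroup.S, ModularGroup.T} := by
    rw [SpecialLinearGroup.SL2Z_generators]; exact Subgroup.mem_top γ
  induction hγ using Subgroup.closure_induction generalizing τ with
  | mem γ hγ =>
    rcases hγ with rfl | rfl
    · refine ⟨-Complex.I * (-Complex.I * τ) ^ (1 / 2 : ℂ),
        by simp [Complex.cpow_eq_zero_iff, τ.ne_zero], fun v ↦ ?_⟩
      rw [UpperHalfPlane.modular_S_smul, UpperHalfPlane.coe_mk, inv_neg, ← one_div, ← neg_div]
      exact charTheta_S v τ.ne_zero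
    · refine ⟨Complex.exp (Real.pi * Complex.I / 4), Complex.exp_ne_zero _, fun v ↦ ?_⟩
      rw [UpperHalfPlane.modular_T_smul, UpperHalfPlane.coe_vadd, add_comm]
      exact_mod_cast charTheta_T v τ
  | one => exact ⟨1, one_ne_zero, fun v ↦ by rw [one_smul, rowAct_one, one_mul]⟩
  | mul γ δ _ _ hγ hδ =>
    obtain ⟨μ, hμ, h1⟩ := hγ (δ • τ)
    obtain ⟨ν, hν, h2⟩ := hδ τ
    exact ⟨μ * ν, mul_ne_zero hμ hν, fun v ↦ by rw [mul_smul, h1, h2, rowAct_mul, mul_assoc]⟩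
  | inv γ _ hγ =>
    obtain ⟨μ, hμ, h⟩ := hγ (γ⁻¹ • τ)
    refine ⟨μ⁻¹, inv_ne_zero hμ, fun v ↦ ?_⟩
    rw [← smul_assoc, smul_eq_mul, mul_inv_cancel, one_smul] at h
    rw [h, ← rowAct_mul, inv_mul_cancel, rowAct_one, inv_mul_cancel_left₀ hμ]

lemma charTheta_add_one_zero (a b : ℝ) (τ : ℂ) :
    charTheta ![a + 1, b] τ =
      Complex.exp (Real.pi * Complex.I * (1 - b)) * charTheta ![a, b] τ := by
  simp only [charTheta, Matrix.cons_val_zero, Matrix.cons_val_one]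
  push_cast
  rw [show ((a : ℂ) + 1) * τ + b - 1 / 2 - τ / 2 = a * τ + b - 1 / 2 - τ / 2 + τ by ring,
    jacobiTheta₂_add_left', ← mul_assoc, ← mul_assoc, ← Complex.exp_add, ← Complex.exp_add]
  congr 2
  ring

lemma charTheta_add_one_one (a b : ℝ) (τ : ℂ) :
    charTheta ![a, b + 1] τ =
      Complex.exp (Real.pi * Complex.I * (a - 1)) * charTheta ![a, b] τ := by
  simp only [charTheta, Matrix.cons_val_zero, Matrix.cons_val_one]
  push_cast
  rw [show (a : ℂ) * τ + (b + 1) - 1 / 2 - τ / 2 = a * τ + b - 1 / 2 - τ / 2 + 1 by ring,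
    jacobiTheta₂_add_left, ← mul_assoc, ← Complex.exp_add]
  congr 2
  ring

lemma eq_zpow_mul_of_add_one {f : ℤ → ℂ} {c : ℂ} (hc : c ≠ 0) (h : ∀ n, f (n + 1) = c * f n)
    (n : ℤ) : f n = c ^ n * f 0 := by
  induction n using Int.induction_on with
  | zero => simp
  | succ n ih => rw [h, ih, zpow_add_one₀ hc]; ring
  | pred n ih =>
    have := h (-n - 1)
    rw [sub_add_cancel, ih] at this
    rw [zpow_sub_one₀ hc]
    field_simp
    rw [this]; ring

lemma charTheta_add_int_zero (a b : ℝ) (n : ℤ) (τ : ℂ) :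
    charTheta ![a + n, b] τ =
      Complex.exp (Real.pi * Complex.I * (1 - b)) ^ n * charTheta ![a, b] τ := by
  have := eq_zpow_mul_of_add_one (f := fun n : ℤ ↦ charTheta ![a + n, b] τ) (Complex.exp_ne_zero _)
    (fun n ↦ by rw [← charTheta_add_one_zero]; push_cast; rw [add_assoc]) n
  simpa using this

lemma charTheta_add_int_one (a b : ℝ) (n : ℤ) (τ : ℂ) :
    charTheta ![a, b + n] τ =
      Complex.exp (Real.pi * Complex.I * (a - 1)) ^ n * charTheta ![a, b] τ := by
  have := eq_zpow_mul_of_add_one (f := fun n : ℤ ↦ charTheta ![a, b + n] τ) (Complex.exp_ne_zero _)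
    (fun n ↦ by rw [← charTheta_add_one_one]; push_cast; rw [add_assoc]) n
  simpa using this

/-- If `N v` is integral, then an element of the principal congruence subgroup of level `2 N²` moves
`v` by a vector of multiples of `2 N`, and `charTheta` is invariant under such a shift. -/
lemma charTheta_rowAct_of_mem_Gamma {N : ℕ} {v : Fin 2 → ℝ} {m n : ℤ}
    (hm : N * v 0 = m) (hn : N * v 1 = n) {γ : SL(2, ℤ)}
    (hγ : γ ∈ CongruenceSubgroup.Gamma (2 * N ^ 2)) (τ : ℂ) :
    charTheta (rowAct v γ) τ = charTheta v τ := by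
  rw [CongruenceSubgroup.Gamma_mem] at hγ
  obtain ⟨h00, h01, h10, h11⟩ := hγ
  have hdvd (z : ℤ) (h : (z : ZMod (2 * N ^ 2)) = 0) : ∃ k : ℤ, z = 2 * N ^ 2 * k := by
    obtain ⟨k, hk⟩ := (ZMod.intCast_zmod_eq_zero_iff_dvd _ _).1 h
    exact ⟨k, by rw [hk]; push_cast; ring⟩
  obtain ⟨k00, e00⟩ := hdvd (γ.1 0 0 - 1) (by push_cast; rw [h00, sub_self])
  obtain ⟨k01, e01⟩ := hdvd (γ.1 0 1) h01
  obtain ⟨k10, e10⟩ := hdvd (γ.1 1 0) h10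
  obtain ⟨k11, e11⟩ := hdvd (γ.1 1 1 - 1) (by push_cast; rw [h11, sub_self])
  have hv : rowAct v γ = ![v 0 + (N * 2 * (m * k00 + n * k10) : ℤ),
      v 1 + (N * 2 * (m * k01 + n * k11) : ℤ)] := by
    ext i
    fin_cases i
    · rw [Fin.zero_eta, rowAct_zero, eq_add_of_sub_eq e00, e10]
      push_cast
      rw [← hm, ← hn]
      ring
    · rw [Fin.mk_one, rowAct_one_apply, eq_add_of_sub_eq e11, e01]
      push_cast
      rw [← hm, ← hn]
      ring
  have hexp (c : ℝ) (l k : ℤ) (hc : N * c = l) :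
      Complex.exp (Real.pi * Complex.I * c) ^ (N * 2 * k) = 1 := by
    rw [← Complex.exp_int_mul, Complex.exp_eq_one_iff]
    have hc' : (N : ℂ) * c = l := by exact_mod_cast hc
    exact ⟨l * k, by push_cast; linear_combination 2 * Real.pi * Complex.I * k * hc'⟩
  have hA (b : ℝ) (l k : ℤ) (hc : N * b = l) :
      Complex.exp (Real.pi * Complex.I * (1 - b)) ^ (N * 2 * k) = 1 := by
    exact_mod_cast hexp (1 - b) (N - l) k (by push_cast; rw [← hc]; ring)
  have hB (a : ℝ) (l k : ℤ) (hc : N * a = l) :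
      Complex.exp (Real.pi * Complex.I * (a - 1)) ^ (N * 2 * k) = 1 := by
    exact_mod_cast hexp (a - 1) (l - N) k (by push_cast; rw [← hc]; ring)
  rw [hv, charTheta_add_int_one, charTheta_add_int_zero]
  rw [hA _ n _ hn]
  have : ∃ l : ℤ, (N : ℝ) * (v 0 + (N * 2 * (m * k00 + n * k10) : ℤ)) = l :=
    ⟨m + N * (N * 2 * (m * k00 + n * k10)), by push_cast; rw [← hm]; ring⟩
  obtain ⟨l, hl⟩ := this
  rw [hB _ l _ hl, one_mul, one_mul]
  congr 1
  ext i; fin_cases i <;> rfl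

/-- The product expansion of `charTheta`, from the Jacobi triple product. -/
lemma charTheta_eq_prod (v : Fin 2 → ℝ) {τ : ℂ} (hτ : 0 < τ.im) :
    charTheta v τ = Complex.exp (Real.pi * Complex.I *
        ((v 0) ^ 2 * τ + v 0 * v 1 + τ / 4 - v 0 * τ - v 1 - 1 / 2)) *
      (qPochInf (Complex.exp (2 * Real.pi * Complex.I * τ))
        (Complex.exp (2 * Real.pi * Complex.I * τ)) *
      (qPochInf (Complex.exp (2 * Real.pi * Complex.I * (v 0 * τ + v 1)))
        (Complex.exp (2 * Real.pi * Complex.I * τ)) *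
      qPochInf (Complex.exp (2 * Real.pi * Complex.I * (τ - (v 0 * τ + v 1))))
        (Complex.exp (2 * Real.pi * Complex.I * τ)))) := by
  rw [charTheta]
  congr 1
  have hx : ‖Complex.exp (Real.pi * Complex.I * τ)‖ < 1 := by
    rw [Complex.norm_exp]
    simp only [Complex.mul_re, Complex.mul_im, Complex.ofReal_re, Complex.ofReal_im, Complex.I_re,
      Complex.I_im]
    rw [Real.exp_lt_one_iff]
    nlinarith [Real.pi_pos, mul_pos Real.pi_pos hτ]
  set z : ℂ := v 0 * τ + v 1 - 1 / 2 - τ / 2 with hz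
  have h := hasSum_jacobi_triple_product hx (Complex.exp_ne_zero _)
    (Complex.exp_ne_zero (2 * Real.pi * Complex.I * z))
  have hj := (hasSum_jacobiTheta₂_term z hτ).congr_fun (g := fun n : ℤ ↦
    Complex.exp (Real.pi * Complex.I * τ) ^ (n ^ 2) *
      Complex.exp (2 * Real.pi * Complex.I * z) ^ n) fun n ↦ by
    rw [jacobiTheta₂_term, ← Complex.exp_int_mul, ← Complex.exp_int_mul, ← Complex.exp_add]
    congr 1; push_cast; ring
  rw [hj.unique h]
  have e1 : Complex.exp (Real.pi * Complex.I * τ) ^ 2 =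
      Complex.exp (2 * Real.pi * Complex.I * τ) := by
    rw [← Complex.exp_nat_mul]; congr 1; push_cast; ring
  have e2 : -(Complex.exp (2 * Real.pi * Complex.I * z) * Complex.exp (Real.pi * Complex.I * τ)) =
      Complex.exp (2 * Real.pi * Complex.I * (v 0 * τ + v 1)) := by
    rw [← neg_one_mul, ← Complex.exp_pi_mul_I, ← Complex.exp_add, ← Complex.exp_add]
    congr 1; rw [hz]; ring
  have e3 : -(Complex.exp (Real.pi * Complex.I * τ) / Complex.exp (2 * Real.pi * Complex.I * z)) =
      Complex.exp (2 * Real.pi * Complex.I * (τ - (v 0 * τ + v 1))) := by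
    rw [← neg_one_mul, ← Complex.exp_sub, ← Complex.exp_neg_pi_mul_I, ← Complex.exp_add]
    congr 1; rw [hz]; ring
  rw [e1, e2, e3]

/-! ### Zeros and growth of the theta functions -/

lemma norm_cexp_two_pi_I_mul (a b : ℝ) (τ : ℂ) :
    ‖Complex.exp (2 * Real.pi * Complex.I * (a * τ + b))‖ =
      Real.exp (-(2 * Real.pi * τ.im)) ^ a := by
  rw [Complex.norm_exp, ← Real.exp_mul]
  congr 1
  simp
  ring

lemma norm_nome (τ : ℂ) :
    ‖Complex.exp (2 * Real.pi * Complex.I * τ)‖ = Real.exp (-(2 * Real.pi * τ.im)) := by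
  simpa using norm_cexp_two_pi_I_mul 1 0 τ

lemma norm_nome_lt_one {τ : ℂ} (hτ : 0 < τ.im) :
    ‖Complex.exp (2 * Real.pi * Complex.I * τ)‖ < 1 := by
  rw [norm_nome, Real.exp_lt_one_iff]
  have := mul_pos Real.pi_pos hτ
  linarith

/-- `charTheta v` has no zeros in the upper half-plane unless `v` is integral. -/
lemma charTheta_ne_zero {v : Fin 2 → ℝ} (hv : ¬ ∃ m n : ℤ, v 0 = m ∧ v 1 = n) {τ : ℂ}
    (hτ : 0 < τ.im) : charTheta v τ ≠ 0 := by
  have hq := norm_nome_lt_one hτ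
  rw [charTheta_eq_prod v hτ]
  have key (k : ℤ) : Complex.exp (2 * Real.pi * Complex.I * (v 0 * τ + v 1 + k * τ)) ≠ 1 := by
    intro h
    obtain ⟨n, hn⟩ := Complex.exp_eq_one_iff.1 h
    have h2 : (v 0 * τ + v 1 + k * τ : ℂ) = n := by
      have := Complex.two_pi_I_ne_zero
      refine mul_left_cancel₀ this ?_
      linear_combination hn
    have him := congrArg Complex.im h2
    simp only [Complex.add_im, Complex.mul_im, Complex.ofReal_re, Complex.ofReal_im, zero_mul,
      add_zero, Complex.intCast_re, Complex.intCast_im] at him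
    have h0 : v 0 + k = 0 := by
      have : (v 0 + k) * τ.im = 0 := by linarith
      exact (mul_eq_zero.1 this).resolve_right hτ.ne'
    have hre := congrArg Complex.re h2
    simp only [Complex.add_re, Complex.mul_re, Complex.ofReal_re, Complex.ofReal_im, zero_mul,
      sub_zero, Complex.intCast_re, Complex.intCast_im] at hre
    refine hv ⟨-k, n, by push_cast; linarith, ?_⟩
    have : (v 0 + k) * τ.re = 0 := by rw [h0, zero_mul]
    linarith
  refine mul_ne_zero (Complex.exp_ne_zero _) (mul_ne_zero
    (qPochInf_ne_zero_of_norm_lt_one hq hq) (mul_ne_zero (qPochInf_ne_zero hq fun k ↦ ?_)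
      (qPochInf_ne_zero hq fun k ↦ ?_)))
  · rw [← Complex.exp_nat_mul, ← Complex.exp_add]
    have := key k
    rw [show 2 * Real.pi * Complex.I * (v 0 * τ + v 1) + k * (2 * Real.pi * Complex.I * τ) =
      2 * Real.pi * Complex.I * (v 0 * τ + v 1 + (k : ℤ) * τ) by push_cast; ring]
    exact this
  · rw [← Complex.exp_nat_mul, ← Complex.exp_add]
    have := key (-(k + 1))
    rw [← inv_ne_one, ← Complex.exp_neg] at this
    rw [show 2 * Real.pi * Complex.I * (τ - (v 0 * τ + v 1)) + k * (2 * Real.pi * Complex.I * τ) =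
      -(2 * Real.pi * Complex.I * (v 0 * τ + v 1 + ((-(k + 1) : ℤ) : ℂ) * τ)) by push_cast; ring]
    exact this

lemma norm_qPochInf_sub_one_le {a q : ℂ} (ha : ‖a‖ ≤ 1 / 8) (hq : ‖q‖ ≤ 1 / 2) :
    ‖qPochInf a q - 1‖ ≤ 1 / 2 := by
  have hq1 : ‖q‖ < 1 := hq.trans_lt (by norm_num)
  refine le_of_tendsto ((tendsto_qPoch a hq1).sub_const 1).norm (Eventually.of_forall fun n ↦ ?_)
  have h := Finset.norm_prod_one_add_sub_one_le (Finset.range n) fun k ↦ -(a * q ^ k)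
  simp only [← sub_eq_add_neg] at h
  have hs : ∑ k ∈ Finset.range n, ‖-(a * q ^ k)‖ ≤ 1 / 4 := by
    calc ∑ k ∈ Finset.range n, ‖-(a * q ^ k)‖
        ≤ ∑' k : ℕ, ‖-(a * q ^ k)‖ :=
          (summable_norm_mul_pow a hq1).sum_le_tsum _ fun _ _ ↦ norm_nonneg _
      _ = ‖a‖ * (1 - ‖q‖)⁻¹ := by
          simp only [norm_neg, norm_mul, norm_pow]
          rw [tsum_mul_left, tsum_geometric_of_lt_one (norm_nonneg q) hq1]
      _ ≤ 1 / 8 * (1 / 2)⁻¹ := by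
          gcongr
          linarith
      _ = 1 / 4 := by norm_num
  have he : Real.exp (1 / 4) ≤ 3 / 2 := by
    have := Real.exp_bound_div_one_sub_of_interval (x := 1 / 4) (by norm_num) (by norm_num)
    norm_num at this ⊢
    linarith
  have := Real.exp_le_exp.2 hs
  rw [qPoch]
  linarith

lemma norm_qPochInf_mem {a q : ℂ} (ha : ‖a‖ ≤ 1 / 8) (hq : ‖q‖ ≤ 1 / 2) :
    1 / 2 ≤ ‖qPochInf a q‖ ∧ ‖qPochInf a q‖ ≤ 3 / 2 := by
  have h := norm_qPochInf_sub_one_le ha hq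
  have h1 := norm_sub_norm_le (1 : ℂ) (1 - qPochInf a q)
  have h2 := norm_add_le (qPochInf a q - 1) 1
  rw [norm_one, norm_sub_rev, sub_sub_cancel] at h1
  rw [norm_one, sub_add_cancel] at h2
  constructor <;> linarith

lemma norm_charTheta_prefactor (v : Fin 2 → ℝ) (τ : ℂ) :
    ‖Complex.exp (Real.pi * Complex.I *
        ((v 0) ^ 2 * τ + v 0 * v 1 + τ / 4 - v 0 * τ - v 1 - 1 / 2))‖ =
      Real.exp (-(Real.pi * (v 0 - 1 / 2) ^ 2 * τ.im)) := by
  have e : (Real.pi * Complex.I *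
        ((v 0) ^ 2 * τ + v 0 * v 1 + τ / 4 - v 0 * τ - v 1 - 1 / 2) : ℂ) =
      ((Real.pi * (v 0 - 1 / 2) ^ 2 : ℝ) : ℂ) * (Complex.I * τ) +
        ((Real.pi * (v 0 * v 1 - v 1 - 1 / 2) : ℝ) : ℂ) * Complex.I := by
    push_cast; ring
  rw [e, Complex.norm_exp]
  generalize Real.pi * (v 0 - 1 / 2) ^ 2 = x
  congr 1
  simp

/-- If `0 ≤ v₀ < 1`, then up to the exponential prefactor and the factor
`1 - exp (2πi (v₀ τ + v₁))` the function `charTheta v` is bounded above and below near `i∞`. -/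
lemma exists_charTheta_bounds {v : Fin 2 → ℝ} (h0 : 0 ≤ v 0) (h1 : v 0 < 1) :
    ∃ A : ℝ, ∀ τ : ℂ, 0 < τ.im → A ≤ τ.im →
      ‖charTheta v τ‖ ≤ 27 / 2 ∧
      Real.exp (-(Real.pi / 4 * τ.im)) * ‖1 - Complex.exp (2 * Real.pi * Complex.I *
        (v 0 * τ + v 1))‖ / 16 ≤ ‖charTheta v τ‖ := by
  have hlim (c : ℝ) (hc : 0 < c) : ∀ᶠ t : ℝ in atTop,
      Real.exp (-(2 * Real.pi * t)) ^ c ≤ 1 / 8 := by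
    have ht : Tendsto (fun t : ℝ ↦ Real.exp (-(2 * Real.pi * t * c))) atTop (𝓝 0) := by
      refine Real.tendsto_exp_neg_atTop_nhds_zero.comp ?_
      exact ((tendsto_id.const_mul_atTop Real.two_pi_pos).atTop_mul_const hc)
    filter_upwards [ht.eventually (ge_mem_nhds (by norm_num : (0 : ℝ) < 1 / 8))] with t ht
    rwa [← Real.exp_mul, neg_mul]
  obtain ⟨A, hA⟩ := eventually_atTop.1 ((hlim 1 one_pos).and (hlim (1 - v 0) (sub_pos.2 h1)))
  refine ⟨A, fun τ hτ hAτ ↦ ?_⟩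
  obtain ⟨hq8, hu8⟩ := hA τ.im hAτ
  set q := Complex.exp (2 * Real.pi * Complex.I * τ) with hqdef
  set u := Complex.exp (2 * Real.pi * Complex.I * (v 0 * τ + v 1)) with hudef
  set w := Complex.exp (2 * Real.pi * Complex.I * (τ - (v 0 * τ + v 1))) with hwdef
  have hq : ‖q‖ ≤ 1 / 8 := by rw [hqdef, norm_nome, ← Real.rpow_one (Real.exp _)]; exact hq8
  have hw : ‖w‖ ≤ 1 / 8 := by
    have := norm_cexp_two_pi_I_mul (1 - v 0) (-v 1) τ
    rw [show ((1 - v 0 : ℝ) : ℂ) * τ + ((-v 1 : ℝ) : ℂ) = τ - (v 0 * τ + v 1) by push_cast; ring]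
      at this
    rw [hwdef, this]
    exact hu8
  have hu : ‖u‖ ≤ 1 := by
    rw [hudef, norm_cexp_two_pi_I_mul]
    refine Real.rpow_le_one (Real.exp_pos _).le (Real.exp_le_one_iff.2 ?_) h0
    have := mul_pos Real.pi_pos hτ
    linarith
  have hq1 : ‖q‖ < 1 := hq.trans_lt (by norm_num)
  have hq2 : ‖q‖ ≤ 1 / 2 := hq.trans (by norm_num)
  have huq : ‖u * q‖ ≤ 1 / 8 := by
    rw [norm_mul]; nlinarith [norm_nonneg u, norm_nonneg q]
  obtain ⟨l1, r1⟩ := norm_qPochInf_mem hq hq2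
  obtain ⟨l2, r2⟩ := norm_qPochInf_mem huq hq2
  obtain ⟨l3, r3⟩ := norm_qPochInf_mem hw hq2
  have r4 : ‖1 - u‖ ≤ 2 := (norm_sub_le _ _).trans (by rw [norm_one]; linarith)
  have hE : Real.exp (-(Real.pi * (v 0 - 1 / 2) ^ 2 * τ.im)) ≤ 1 :=
    Real.exp_le_one_iff.2 (neg_nonpos.2 (by positivity))
  have hE' : Real.exp (-(Real.pi / 4 * τ.im)) ≤
      Real.exp (-(Real.pi * (v 0 - 1 / 2) ^ 2 * τ.im)) := by
    refine Real.exp_le_exp.2 (neg_le_neg ?_)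
    have : (v 0 - 1 / 2) ^ 2 ≤ 1 / 4 := by nlinarith
    have := mul_le_mul_of_nonneg_left this (mul_pos Real.pi_pos hτ).le
    linarith
  rw [charTheta_eq_prod v hτ, norm_mul, norm_charTheta_prefactor, norm_mul, norm_mul,
    ← hqdef, ← hudef, ← hwdef, qPochInf_eq_one_sub_mul u hq1, norm_mul]
  constructor
  · refine le_trans (b := 1 * (3 / 2 * (2 * (3 / 2) * (3 / 2)))) ?_ (by norm_num)
    gcongr
  · calc _ = Real.exp (-(Real.pi / 4 * τ.im)) * (1 / 2 * (‖1 - u‖ * (1 / 2) * (1 / 4))) := by ring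
      _ ≤ Real.exp (-(Real.pi / 4 * τ.im)) * (1 / 2 * (‖1 - u‖ * (1 / 2) * (1 / 2))) := by
          gcongr; norm_num
      _ ≤ _ := by gcongr

lemma norm_exp_pi_I_mul_real (c : ℝ) : ‖Complex.exp (Real.pi * Complex.I * c)‖ = 1 := by
  rw [show (Real.pi * Complex.I * c : ℂ) = (Real.pi * c : ℝ) * Complex.I by push_cast; ring,
    Complex.norm_exp_ofReal_mul_I]

/-- Shifting the first characteristic by an integer does not change the absolute value. -/
lemma norm_charTheta_fract (v : Fin 2 → ℝ) (τ : ℂ) :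
    ‖charTheta ![Int.fract (v 0), v 1] τ‖ = ‖charTheta v τ‖ := by
  have h := charTheta_add_int_zero (Int.fract (v 0)) (v 1) ⌊v 0⌋ τ
  rw [Int.fract_add_floor] at h
  have hv : v = ![v 0, v 1] := by ext i; fin_cases i <;> rfl
  have hn := norm_exp_pi_I_mul_real (1 - v 1)
  push_cast at hn
  rw [← hv] at h
  rw [h, norm_mul, norm_zpow, hn, one_zpow, one_mul]

lemma exists_norm_charTheta_le (v : Fin 2 → ℝ) :
    ∃ A : ℝ, ∀ τ : ℂ, 0 < τ.im → A ≤ τ.im → ‖charTheta v τ‖ ≤ 27 / 2 := by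
  obtain ⟨A, hA⟩ := exists_charTheta_bounds (v := ![Int.fract (v 0), v 1]) (Int.fract_nonneg _)
    (Int.fract_lt_one _)
  refine ⟨A, fun τ hτ h ↦ ?_⟩
  rw [← norm_charTheta_fract]
  exact (hA τ hτ h).1

lemma exists_le_norm_charTheta {v : Fin 2 → ℝ} (hv : ¬ ∃ m n : ℤ, v 0 = m ∧ v 1 = n) :
    ∃ A c : ℝ, 0 < c ∧ ∀ τ : ℂ, 0 < τ.im → A ≤ τ.im →
      c * Real.exp (-(Real.pi / 4 * τ.im)) ≤ ‖charTheta v τ‖ := by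
  obtain ⟨A, hA⟩ := exists_charTheta_bounds (v := ![Int.fract (v 0), v 1]) (Int.fract_nonneg _)
    (Int.fract_lt_one _)
  -- a lower bound for the factor `1 - u`, which is constant if the first characteristic is integral
  obtain ⟨B, δ, hδ, hB⟩ : ∃ B δ : ℝ, 0 < δ ∧ ∀ τ : ℂ, B ≤ τ.im → δ ≤
      ‖1 - Complex.exp (2 * Real.pi * Complex.I * ((Int.fract (v 0) : ℝ) * τ + v 1))‖ := by
    rcases (Int.fract_nonneg (v 0)).eq_or_lt with h | h
    · refine ⟨0, ‖1 - Complex.exp (2 * Real.pi * Complex.I * v 1)‖, ?_, fun τ _ ↦ ?_⟩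
      · rw [norm_pos_iff, sub_ne_zero]
        intro h1
        obtain ⟨n, hn⟩ := Complex.exp_eq_one_iff.1 h1.symm
        have h2 : (v 1 : ℂ) = n := by
          refine mul_left_cancel₀ Complex.two_pi_I_ne_zero ?_
          linear_combination hn
        refine hv ⟨⌊v 0⌋, n, ?_, by exact_mod_cast h2⟩
        have := Int.floor_add_fract (v 0)
        rw [← h, add_zero] at this
        exact this.symm
      · rw [← h, Complex.ofReal_zero, zero_mul, zero_add]
    · have ht : Tendsto (fun t : ℝ ↦ Real.exp (-(2 * Real.pi * t * Int.fract (v 0)))) atTop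
          (𝓝 0) := by
        refine Real.tendsto_exp_neg_atTop_nhds_zero.comp ?_
        exact ((tendsto_id.const_mul_atTop Real.two_pi_pos).atTop_mul_const h)
      obtain ⟨B, hB⟩ := eventually_atTop.1
        (ht.eventually (ge_mem_nhds (by norm_num : (0 : ℝ) < 1 / 2)))
      refine ⟨B, 1 / 2, by norm_num, fun τ hτ ↦ ?_⟩
      have h3 := hB τ.im hτ
      have h4 := norm_cexp_two_pi_I_mul (Int.fract (v 0)) (v 1) τ
      rw [← Real.exp_mul, neg_mul] at h4
      have h5 := norm_sub_norm_le (1 : ℂ)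
        (Complex.exp (2 * Real.pi * Complex.I * ((Int.fract (v 0) : ℝ) * τ + v 1)))
      rw [norm_one, h4] at h5
      linarith
  refine ⟨max A B, δ / 16, by positivity, fun τ hτ h ↦ ?_⟩
  rw [← norm_charTheta_fract]
  refine le_trans ?_ (hA τ hτ (le_of_max_le_left h)).2
  have := hB τ (le_of_max_le_right h)
  rw [div_mul_eq_mul_div, mul_comm]
  gcongr
  exact this

/-! ### Quotients of theta functions are modular functions -/

lemma IsModularFunction.mul {f g : UpperHalfPlane → ℂ} (hf : IsModularFunction f)
    (hg : IsModularFunction g) : IsModularFunction fun τ ↦ f τ * g τ := by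
  obtain ⟨hf1, ⟨Γ, ⟨N, hN, hΓ⟩, hf2⟩, hf3⟩ := hf
  obtain ⟨hg1, ⟨Δ, ⟨M, hM, hΔ⟩, hg2⟩, hg3⟩ := hg
  have hmono {K L : ℕ} (h : K ∣ L) : CongruenceSubgroup.Gamma L ≤ CongruenceSubgroup.Gamma K := by
    intro γ hγ
    have hd (z : ℤ) (hz : (z : ZMod L) = 0) : (z : ZMod K) = 0 := by
      rw [ZMod.intCast_zmod_eq_zero_iff_dvd] at hz ⊢
      exact (Int.natCast_dvd_natCast.2 h).trans hz
    rw [CongruenceSubgroup.Gamma_mem] at hγ ⊢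
    obtain ⟨h1, h2, h3, h4⟩ := hγ
    have k1 := hd (γ.1 0 0 - 1) (by push_cast; rw [h1, sub_self])
    have k4 := hd (γ.1 1 1 - 1) (by push_cast; rw [h4, sub_self])
    push_cast at k1 k4
    exact ⟨sub_eq_zero.1 k1, hd _ h2, hd _ h3, sub_eq_zero.1 k4⟩
  refine ⟨?_, ⟨Γ ⊓ Δ, ⟨N * M, mul_ne_zero hN hM, le_inf ((hmono (dvd_mul_right N M)).trans hΓ)
    ((hmono (dvd_mul_left M N)).trans hΔ)⟩, fun γ hγ τ ↦ ?_⟩, fun γ ↦ ?_⟩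
  · rw [UpperHalfPlane.mdifferentiable_iff] at hf1 hg1 ⊢
    exact hf1.mul hg1
  · dsimp only
    rw [hf2 γ hγ.1, hg2 γ hγ.2]
  · obtain ⟨m, hm⟩ := hf3 γ
    obtain ⟨n, hn⟩ := hg3 γ
    refine ⟨m + n, ?_⟩
    have h := Filter.BoundedAtFilter.mul hm hn
    refine h.congr_left fun τ ↦ ?_
    have : nomePow τ (m + n : ℕ) = nomePow τ m * nomePow τ n := by
      rw [nomePow, nomePow, nomePow, ← Complex.exp_add]
      congr 1; push_cast; ring
    simp only [Pi.mul_apply]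
    rw [this]
    ring

lemma isModularFunction_const (c : ℂ) : IsModularFunction fun _ ↦ c := by
  refine ⟨mdifferentiable_const, ⟨⊤, ⟨1, one_ne_zero, le_top⟩, fun _ _ _ ↦ rfl⟩, fun γ ↦ ⟨0, ?_⟩⟩
  simpa [nomePow] using! Filter.const_boundedAtFilter UpperHalfPlane.atImInfty c

lemma IsModularFunction.prod {ι : Type*} (s : Finset ι) {f : ι → UpperHalfPlane → ℂ}
    (hf : ∀ i ∈ s, IsModularFunction (f i)) : IsModularFunction fun τ ↦ ∏ i ∈ s, f i τ := by
  classical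
  induction s using Finset.induction_on with
  | empty => simpa using isModularFunction_const 1
  | insert a s ha ih =>
    simp only [Finset.prod_insert ha]
    exact (hf a (Finset.mem_insert_self a s)).mul
      (ih fun i hi ↦ hf i (Finset.mem_insert_of_mem hi))

lemma differentiableAt_charTheta (v : Fin 2 → ℝ) {τ : ℂ} (hτ : 0 < τ.im) :
    DifferentiableAt ℂ (charTheta v) τ := by
  have h := (hasFDerivAt_jacobiTheta₂ (v 0 * τ + v 1 - 1 / 2 - τ / 2) hτ).differentiableAt
  have h2 : DifferentiableAt ℂ (fun τ : ℂ ↦ ((v 0 * τ + v 1 - 1 / 2 - τ / 2 : ℂ), τ)) τ := by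
    fun_prop
  exact DifferentiableAt.mul (by fun_prop) (DifferentiableAt.comp (f := fun τ : ℂ ↦
    ((v 0 * τ + v 1 - 1 / 2 - τ / 2 : ℂ), τ)) τ h h2)

lemma rowAct_not_integral {v : Fin 2 → ℝ} (hv : ¬ ∃ m n : ℤ, v 0 = m ∧ v 1 = n) (γ : SL(2, ℤ)) :
    ¬ ∃ m n : ℤ, rowAct v γ 0 = m ∧ rowAct v γ 1 = n := by
  rintro ⟨m, n, hm, hn⟩
  have e : v = rowAct (rowAct v γ) γ⁻¹ := by rw [← rowAct_mul, mul_inv_cancel, rowAct_one]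
  refine hv ⟨m * γ⁻¹.1 0 0 + n * γ⁻¹.1 1 0, m * γ⁻¹.1 0 1 + n * γ⁻¹.1 1 1, ?_, ?_⟩
  · rw [e, rowAct_zero, hm, hn]; push_cast; rfl
  · rw [e, rowAct_one_apply, hm, hn]; push_cast; rfl

/-- For rational characteristics, a quotient of two theta functions is a modular function: the
automorphy factors cancel, and the denominator has no zeros and decays at most exponentially. -/
theorem isModularFunction_charTheta_div {N : ℕ} (hN : N ≠ 0) {v w : Fin 2 → ℝ} {a b c d : ℤ}
    (ha : N * v 0 = a) (hb : N * v 1 = b) (hc : N * w 0 = c) (hd : N * w 1 = d)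
    (hv : ¬ ∃ m n : ℤ, v 0 = m ∧ v 1 = n) :
    IsModularFunction fun τ ↦ charTheta w τ / charTheta v τ := by
  have hsmul (γ : SL(2, ℤ)) (τ : UpperHalfPlane) :
      charTheta w (γ • τ : UpperHalfPlane) / charTheta v (γ • τ : UpperHalfPlane) =
        charTheta (rowAct w γ) τ / charTheta (rowAct v γ) τ := by
    obtain ⟨μ, hμ, h⟩ := exists_charTheta_smul γ τ
    rw [h, h, mul_div_mul_left _ _ hμ]
  refine ⟨?_, ⟨CongruenceSubgroup.Gamma (2 * N ^ 2), ⟨2 * N ^ 2, by positivity, le_rfl⟩,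
    fun γ hγ τ ↦ ?_⟩, fun γ ↦ ⟨1, ?_⟩⟩
  · rw [UpperHalfPlane.mdifferentiable_iff]
    have : DifferentiableOn ℂ (fun z ↦ charTheta w z / charTheta v z) {z | 0 < z.im} :=
      fun z hz ↦ ((differentiableAt_charTheta w hz).div (differentiableAt_charTheta v hz)
        (charTheta_ne_zero hv hz)).differentiableWithinAt
    refine this.congr fun z hz ↦ ?_
    simp [UpperHalfPlane.ofComplex_apply_of_im_pos hz]
  · dsimp only
    rw [hsmul, charTheta_rowAct_of_mem_Gamma ha hb hγ, charTheta_rowAct_of_mem_Gamma hc hd hγ]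
  · obtain ⟨A, hA⟩ := exists_norm_charTheta_le (rowAct w γ)
    obtain ⟨B, κ, hκ, hB⟩ := exists_le_norm_charTheta (rowAct_not_integral hv γ)
    rw [UpperHalfPlane.isBoundedAtImInfty_iff]
    refine ⟨27 / 2 / κ, max A B, fun τ hτ ↦ ?_⟩
    have h1 := hA τ τ.im_pos (le_of_max_le_left hτ)
    have h2 := hB τ τ.im_pos (le_of_max_le_right hτ)
    have h3 : ‖nomePow τ (1 : ℕ)‖ ≤ Real.exp (-(Real.pi / 4 * (τ : ℂ).im)) := by
      have e : nomePow τ (1 : ℕ) = Complex.exp (2 * Real.pi * Complex.I * τ) := by simp [nomePow]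
      rw [e, norm_nome, Real.exp_le_exp]
      have := mul_pos Real.pi_pos τ.im_pos
      rw [UpperHalfPlane.coe_im]
      linarith
    dsimp only
    rw [hsmul, norm_mul, norm_div]
    have h4 : 0 < κ * Real.exp (-(Real.pi / 4 * (τ : ℂ).im)) := by positivity
    calc _ ≤ Real.exp (-(Real.pi / 4 * (τ : ℂ).im)) *
          (27 / 2 / (κ * Real.exp (-(Real.pi / 4 * (τ : ℂ).im)))) := by gcongr
      _ = 27 / 2 / κ := by field_simp

/-! ### Modularity of the infinite products -/

lemma nomePow_add (τ : UpperHalfPlane) (x y : ℚ) :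
    nomePow τ (x + y) = nomePow τ x * nomePow τ y := by
  rw [nomePow, nomePow, nomePow, ← Complex.exp_add]
  congr 1; push_cast; ring

@[simp] lemma nomePow_zero (τ : UpperHalfPlane) : nomePow τ 0 = 1 := by simp [nomePow]

lemma nomePow_int_mul (τ : UpperHalfPlane) (x : ℚ) (n : ℤ) :
    nomePow τ (n * x) = nomePow τ x ^ n := by
  rw [nomePow, nomePow, ← Complex.exp_int_mul]
  congr 1; push_cast; ring

lemma nomePow_natCast_mul (τ : UpperHalfPlane) (x : ℚ) (n : ℕ) :
    nomePow τ (n * x) = nomePow τ x ^ n := by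
  exact_mod_cast nomePow_int_mul τ x n

lemma nomePow_sum (τ : UpperHalfPlane) {ι : Type*} (s : Finset ι) (r : ι → ℚ) :
    nomePow τ (∑ i ∈ s, r i) = ∏ i ∈ s, nomePow τ (r i) := by
  classical
  induction s using Finset.induction_on with
  | empty => simp
  | insert a s ha ih => rw [Finset.sum_insert ha, Finset.prod_insert ha, nomePow_add, ih]

lemma nomePow_one_eq (τ : UpperHalfPlane) :
    nomePow τ 1 = Complex.exp (2 * Real.pi * Complex.I * τ) := by simp [nomePow]

lemma norm_nomePow_one_lt_one (τ : UpperHalfPlane) : ‖nomePow τ 1‖ < 1 := by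
  rw [nomePow_one_eq]; exact norm_nome_lt_one τ.im_pos

/-- The product expansion of `charTheta` at a rational characteristic `(a, b)`, in terms of the
nome and of `ω = exp (2πi b)`. -/
lemma exists_charTheta_rat (a b : ℚ) : ∃ C : ℂ, C ≠ 0 ∧ ∀ τ : UpperHalfPlane,
    charTheta ![(a : ℝ), (b : ℝ)] τ = C * nomePow τ ((a - 1 / 2) ^ 2 / 2) *
      (qPochInf (nomePow τ 1) (nomePow τ 1) *
        (qPochInf (nomePow τ a * Complex.exp (2 * Real.pi * Complex.I * b)) (nomePow τ 1) *
          qPochInf (nomePow τ (1 - a) * Complex.exp (-(2 * Real.pi * Complex.I * b)))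
            (nomePow τ 1))) := by
  refine ⟨Complex.exp (Real.pi * Complex.I * (a * b - b - 1 / 2)), Complex.exp_ne_zero _,
    fun τ ↦ ?_⟩
  rw [charTheta_eq_prod _ τ.im_pos, nomePow_one_eq, nomePow, nomePow, nomePow, ← Complex.exp_add,
    ← Complex.exp_add, ← Complex.exp_add]
  simp only [Matrix.cons_val_zero, Matrix.cons_val_one]
  push_cast
  congr 3
  · ring
  · congr 2; ring
  · congr 2; ring

/-- The theta function used as a common reference: `charTheta (1/2, 0)`. -/
noncomputable def thetaRef (τ : ℂ) : ℂ := charTheta ![((1 / 2 : ℚ) : ℝ), ((0 : ℚ) : ℝ)] τ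

lemma half_not_integral {v : Fin 2 → ℝ} {x : ℚ} (hv : v 0 = x) (h0 : 0 < x) (h1 : x < 1) :
    ¬ ∃ m n : ℤ, v 0 = m ∧ v 1 = n := by
  rintro ⟨m, n, hm, _⟩
  rw [hv] at hm
  have hm' : x = m := by exact_mod_cast hm
  rw [hm'] at h0 h1
  have h0' : 0 < m := by exact_mod_cast h0
  have h1' : m < 1 := by exact_mod_cast h1
  lia

lemma thetaRef_ne_zero (τ : UpperHalfPlane) : thetaRef τ ≠ 0 :=
  charTheta_ne_zero (half_not_integral (x := 1 / 2) (by simp) (by norm_num) (by norm_num)) τ.im_pos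

/-- The product of `thetaRef / charTheta (x/n, j/n)` over `j` modulo `n`. -/
noncomputable def thetaBlock (n x : ℕ) (τ : UpperHalfPlane) : ℂ :=
  ∏ j ∈ Finset.range n,
    thetaRef τ / charTheta ![((x / n : ℚ) : ℝ), ((j / n : ℚ) : ℝ)] τ

lemma isModularFunction_thetaBlock {n x : ℕ} (hx : 0 < x) (hxn : x < n) :
    IsModularFunction (thetaBlock n x) := by
  have hn : (n : ℝ) ≠ 0 := by have : n ≠ 0 := by lia
                              exact_mod_cast this
  have hxn' : (x : ℚ) / n < 1 := by
    rw [div_lt_one (by exact_mod_cast hx.trans hxn)]; exact_mod_cast hxn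
  refine IsModularFunction.prod _ fun j _ ↦ isModularFunction_charTheta_div (N := 2 * n)
    (a := 2 * x) (b := 2 * j) (c := n) (d := 0) (by lia) ?_ ?_ ?_ ?_
    (half_not_integral (x := x / n) rfl ?_ hxn')
  · simp; field_simp
  · simp; field_simp
  · simp; ring
  · simp
  · have : 0 < n := by lia
    positivity

/-- The symmetric product `(q^x, q^(n-x); q^n)_∞`. -/
noncomputable def symmPoch (q : ℂ) (n x : ℕ) : ℂ :=
  qPochInf (q ^ x) (q ^ n) * qPochInf (q ^ (n - x)) (q ^ n)

lemma symmPoch_ne_zero {q : ℂ} (hq : ‖q‖ < 1) {n x : ℕ} (hx : 0 < x) (hxn : x < n) :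
    symmPoch q n x ≠ 0 := by
  have hn := norm_pow_lt_one hq (n := n) (by lia)
  exact mul_ne_zero (qPochInf_ne_zero_of_norm_lt_one (norm_pow_lt_one hq (by lia)) hn)
    (qPochInf_ne_zero_of_norm_lt_one (norm_pow_lt_one hq (by lia)) hn)

lemma exists_thetaBlock_eq {n x : ℕ} (hx : 0 < x) (hxn : x < n) :
    ∃ C : ℂ, C ≠ 0 ∧ ∀ τ : UpperHalfPlane, thetaBlock n x τ =
      C * nomePow τ (-((2 * x - n) ^ 2 / (8 * n))) / symmPoch (nomePow τ 1) n x *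
        (thetaRef τ / qPochInf (nomePow τ 1) (nomePow τ 1)) ^ n := by
  have hn : n ≠ 0 := by lia
  have hnq : (n : ℚ) ≠ 0 := by exact_mod_cast hn
  have hnc : (n : ℂ) ≠ 0 := by exact_mod_cast hn
  choose C hC0 hC using fun j : ℕ ↦ exists_charTheta_rat (x / n) (j / n)
  refine ⟨(∏ j ∈ Finset.range n, C j)⁻¹, inv_ne_zero (Finset.prod_ne_zero_iff.2 fun j _ ↦ hC0 j),
    fun τ ↦ ?_⟩
  set q := nomePow τ 1 with hqdef
  have hq : ‖q‖ < 1 := norm_nomePow_one_lt_one τ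
  have hζ := Complex.isPrimitiveRoot_exp n hn
  have h1 := prod_qPochInf_rootsOfUnity hn hζ (nomePow τ (x / n)) hq
  have h2 := prod_qPochInf_rootsOfUnity hn hζ.inv (nomePow τ (1 - x / n)) hq
  have e1 : nomePow τ (x / n) ^ n = q ^ x := by
    rw [← nomePow_natCast_mul, hqdef, ← nomePow_natCast_mul]; congr 1; field_simp
  have e2 : nomePow τ (1 - x / n) ^ n = q ^ (n - x) := by
    rw [← nomePow_natCast_mul, hqdef, ← nomePow_natCast_mul, Nat.cast_sub hxn.le]
    congr 1; field_simp
  rw [e1] at h1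
  rw [e2] at h2
  have hroot (j : ℕ) : Complex.exp (2 * Real.pi * Complex.I * (j / n : ℚ)) =
      Complex.exp (2 * Real.pi * Complex.I / n) ^ j := by
    rw [← Complex.exp_nat_mul]; congr 1; push_cast; field_simp
  have hden : ∏ j ∈ Finset.range n, charTheta ![((x / n : ℚ) : ℝ), ((j / n : ℚ) : ℝ)] τ =
      (∏ j ∈ Finset.range n, C j) * nomePow τ ((2 * x - n) ^ 2 / (8 * n)) *
        (qPochInf q q ^ n * symmPoch q n x) := by
    rw [Finset.prod_congr rfl fun j _ ↦ hC j τ]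
    simp only [Finset.prod_mul_distrib, Finset.prod_const, Finset.card_range, Complex.exp_neg,
      hroot]
    simp only [← inv_pow, mul_comm (nomePow τ _) (_ ^ _)]
    rw [h1, h2, symmPoch, ← nomePow_natCast_mul]
    congr 3
    field_simp
    ring
  have hS := symmPoch_ne_zero hq hx hxn
  have hP := qPochInf_ne_zero_of_norm_lt_one hq hq
  have hN : nomePow τ (-((2 * x - n) ^ 2 / (8 * n))) =
      (nomePow τ ((2 * x - n) ^ 2 / (8 * n)))⁻¹ := by
    refine eq_inv_of_mul_eq_one_left ?_
    rw [← nomePow_add, neg_add_cancel, nomePow_zero]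
  rw [thetaBlock, Finset.prod_div_distrib, hden, Finset.prod_const, Finset.card_range, hN, div_pow]
  field_simp

/-- The product of the other two even theta constants, divided by `thetaRef²`. -/
noncomputable def thetaCompl (τ : UpperHalfPlane) : ℂ :=
  charTheta ![((0 : ℚ) : ℝ), ((1 / 2 : ℚ) : ℝ)] τ / thetaRef τ *
    (charTheta ![((1 / 2 : ℚ) : ℝ), ((1 / 2 : ℚ) : ℝ)] τ / thetaRef τ)

lemma isModularFunction_thetaCompl : IsModularFunction thetaCompl := by
  have hv := half_not_integral (v := ![((1 / 2 : ℚ) : ℝ), ((0 : ℚ) : ℝ)]) (x := 1 / 2) (by simp)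
    (by norm_num) (by norm_num)
  refine (isModularFunction_charTheta_div (N := 2) (a := 1) (b := 0) (c := 0) (d := 1) two_ne_zero
    ?_ ?_ ?_ ?_ hv).mul (isModularFunction_charTheta_div (N := 2) (a := 1) (b := 0) (c := 1)
      (d := 1) two_ne_zero ?_ ?_ ?_ ?_ hv) <;> simp

/-- The product of the three even theta constants is a multiple of `η³`, so `thetaCompl` is a
multiple of `η³ / thetaRef³`. -/
lemma exists_thetaCompl_eq : ∃ C : ℂ, C ≠ 0 ∧ ∀ τ : UpperHalfPlane, thetaCompl τ =
    C * nomePow τ (1 / 8) / (thetaRef τ / qPochInf (nomePow τ 1) (nomePow τ 1)) ^ 3 := by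
  obtain ⟨C₁, hC₁, h1⟩ := exists_charTheta_rat (1 / 2) 0
  obtain ⟨C₂, hC₂, h2⟩ := exists_charTheta_rat 0 (1 / 2)
  obtain ⟨C₃, hC₃, h3⟩ := exists_charTheta_rat (1 / 2) (1 / 2)
  refine ⟨2 * C₁ * C₂ * C₃, by simp [*], fun τ ↦ ?_⟩
  set q := nomePow τ 1 with hqdef
  have hq : ‖q‖ < 1 := norm_nomePow_one_lt_one τ
  have hP := qPochInf_ne_zero_of_norm_lt_one hq hq
  have hR := thetaRef_ne_zero τ
  have e1 : Complex.exp (2 * Real.pi * Complex.I * (1 / 2 : ℚ)) = -1 := by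
    rw [← Complex.exp_pi_mul_I]; congr 1; push_cast; ring
  have e2 : Complex.exp (-(2 * Real.pi * Complex.I * (1 / 2 : ℚ))) = -1 := by
    rw [Complex.exp_neg, e1, inv_neg, inv_one]
  have e3 : nomePow τ (1 / 2) ^ 2 = q := by rw [← nomePow_natCast_mul, hqdef]; norm_num
  have hA := qPochInf_mul_qPochInf_neg (nomePow τ (1 / 2)) hq
  rw [e3] at hA
  have hB := qPochInf_mul_qPochInf_neg q hq
  have hD := prod_qPochInf_residues q hq two_ne_zero
  rw [Finset.prod_range_succ, Finset.prod_range_one, pow_zero, pow_one, mul_one, ← sq] at hD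
  -- Euler's identity `(q; q²)_∞ (-q; q)_∞ = 1`
  have hE : qPochInf q (q ^ 2) * qPochInf (-q) q = 1 := by
    refine mul_left_cancel₀ hP ?_
    linear_combination qPochInf q (q ^ 2) * hB + hD
  have hM : qPochInf (-1) q = 2 * qPochInf (-q) q := by
    rw [qPochInf_eq_one_sub_mul (-1) hq]; norm_num
  have h1' := h1 τ
  have h2' := h2 τ
  have h3' := h3 τ
  rw [← thetaRef] at h1'
  rw [e1, e2] at h2' h3'
  rw [show (1 - 1 / 2 : ℚ) = 1 / 2 by norm_num] at h1' h3'
  simp only [sub_zero, sub_self, ne_eq, OfNat.ofNat_ne_zero, not_false_eq_true, zero_pow, zero_div,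
    nomePow_zero, mul_one, Rat.cast_zero, mul_zero, Complex.exp_zero, neg_zero,
    mul_neg_one] at h1' h2' h3'
  rw [hM, show ((0 - 1 / 2) ^ 2 / 2 : ℚ) = 1 / 8 by norm_num] at h2'
  rw [thetaCompl, Rat.cast_zero, h2', h3']
  simp only [← hqdef]
  field_simp
  rw [h1']
  simp only [← hqdef]
  generalize qPochInf (nomePow τ (1 / 2)) q = X at *
  generalize qPochInf (-nomePow τ (1 / 2)) q = Y at *
  generalize qPochInf q (q ^ 2) = Z at *
  generalize qPochInf (-q) q = W at *
  have hXY : X ^ 2 * Y ^ 2 * W ^ 2 = 1 := by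
    rw [← mul_pow, hA, ← mul_pow, hE, one_pow]
  linear_combination (nomePow τ (1 / 8) * C₁ * qPochInf q q) * hXY

/-- The modular functions behind the four products: eight factors at level `16` and one at level
`10` involve `138 = 3 * 46` theta functions, which `thetaCompl ^ 46` balances. -/
theorem isModularFunction_symmPoch {x : Fin 8 → ℕ} (hx : ∀ i, 0 < x i ∧ x i < 16) {y : ℕ}
    (hy : 0 < y ∧ y < 10) : IsModularFunction fun τ ↦
      nomePow τ (23 / 4 - ∑ i, (2 * (x i : ℚ) - 16) ^ 2 / 128 - (2 * (y : ℚ) - 10) ^ 2 / 80) /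
        ((∏ i, symmPoch (nomePow τ 1) 16 (x i)) * symmPoch (nomePow τ 1) 10 y) := by
  choose C hC0 hC using fun i ↦ exists_thetaBlock_eq (hx i).1 (hx i).2
  obtain ⟨D, hD0, hD⟩ := exists_thetaBlock_eq hy.1 hy.2
  obtain ⟨E, hE0, hE⟩ := exists_thetaCompl_eq
  have h := (isModularFunction_const ((∏ i, C i) * D * E ^ 46)⁻¹).mul
    (((IsModularFunction.prod Finset.univ fun i _ ↦
      isModularFunction_thetaBlock (hx i).1 (hx i).2).mul
        (isModularFunction_thetaBlock hy.1 hy.2)).mul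
          (IsModularFunction.prod (Finset.range 46) fun _ _ ↦ isModularFunction_thetaCompl))
  convert h using 2 with τ
  have hq := norm_nomePow_one_lt_one τ
  have hP := qPochInf_ne_zero_of_norm_lt_one hq hq
  have hR := thetaRef_ne_zero τ
  have hCp : ∏ i, C i ≠ 0 := Finset.prod_ne_zero_iff.2 fun i _ ↦ hC0 i
  have hk : thetaRef τ / qPochInf (nomePow τ 1) (nomePow τ 1) ≠ 0 := div_ne_zero hR hP
  have hS : ∏ i, symmPoch (nomePow τ 1) 16 (x i) ≠ 0 :=
    Finset.prod_ne_zero_iff.2 fun i _ ↦ symmPoch_ne_zero hq (hx i).1 (hx i).2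
  have hS' := symmPoch_ne_zero hq hy.1 hy.2
  have e : nomePow τ (23 / 4 - ∑ i, (2 * (x i : ℚ) - 16) ^ 2 / 128 - (2 * (y : ℚ) - 10) ^ 2 / 80) =
      (∏ i, nomePow τ (-((2 * (x i : ℚ) - (16 : ℕ)) ^ 2 / (8 * (16 : ℕ))))) *
        nomePow τ (-((2 * (y : ℚ) - (10 : ℕ)) ^ 2 / (8 * (10 : ℕ)))) * nomePow τ (1 / 8) ^ 46 := by
    rw [← nomePow_sum, ← nomePow_natCast_mul, ← nomePow_add, ← nomePow_add, Finset.sum_neg_distrib]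
    congr 1
    push_cast
    norm_num
    ring
  rw [e, Finset.prod_congr rfl fun i _ ↦ hC i τ, hD, Finset.prod_const, Finset.card_range, hE]
  simp only [Finset.prod_mul_distrib, Finset.prod_div_distrib, Finset.prod_const, Finset.card_univ,
    Fintype.card_fin]
  generalize thetaRef τ / qPochInf (nomePow τ 1) (nomePow τ 1) = k at *
  field_simp

/-! ### The four products as products over symmetric residue pairs -/

/-- The residues modulo `16` in the denominators of `(-q^3, -q^5, q^8; q^8)_∞ / (q; q)_∞`. -/
def residuesA : Fin 8 → ℕ := ![1, 7, 2, 3, 3, 5, 5, 4]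

/-- The residues modulo `16` in the denominators of `(-q, -q^7, q^8; q^8)_∞ / (q; q)_∞`. -/
def residuesB : Fin 8 → ℕ := ![1, 1, 3, 4, 5, 6, 7, 7]

/-- The dissection of `(q; q)_∞` into residues modulo `8`, refined to residues modulo `16`. -/
lemma qPochInf_self_eq_mul {q : ℂ} (hq : ‖q‖ < 1) :
    qPochInf q q = symmPoch q 16 1 * symmPoch q 16 2 * symmPoch q 16 3 * symmPoch q 16 4 *
      symmPoch q 16 5 * symmPoch q 16 6 * symmPoch q 16 7 * qPochInf (q ^ 8) (q ^ 8) := by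
  have h8 := norm_pow_lt_one hq (n := 8) (by norm_num)
  have h1 := prod_qPochInf_residues q hq (m := 16) (by norm_num)
  have h2 := prod_qPochInf_residues (q ^ 8) h8 (m := 2) (by norm_num)
  simp only [Finset.prod_range_succ, Finset.prod_range_zero, one_mul, mul_one,
    ← pow_succ', ← pow_mul, ← pow_add, pow_one, Nat.reduceMul, Nat.reduceAdd] at h1 h2
  rw [← h1, ← h2]
  simp only [symmPoch, Nat.reduceSub, pow_one]
  ring

/-- The factors `(-q^a, -q^(8-a); q^8)_∞` in terms of residues modulo `16`. -/
lemma qPochInf_neg_pow_mul {q : ℂ} (hq : ‖q‖ < 1) (a : ℕ) (ha : a < 8) :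
    qPochInf (-q ^ a) (q ^ 8) * qPochInf (-q ^ (8 - a)) (q ^ 8) *
      (symmPoch q 16 a * symmPoch q 16 (8 - a)) = symmPoch q 16 (2 * a) := by
  have h8 := norm_pow_lt_one hq (n := 8) (by norm_num)
  have key : ∀ b, qPochInf (-q ^ b) (q ^ 8) *
      (qPochInf (q ^ b) (q ^ 16) * qPochInf (q ^ (b + 8)) (q ^ 16)) =
        qPochInf (q ^ (2 * b)) (q ^ 16) := by
    intro b
    have h1 := prod_qPochInf_residues (q ^ b) h8 (m := 2) (by norm_num)
    have h2 := qPochInf_mul_qPochInf_neg (q ^ b) h8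
    simp only [Finset.prod_range_succ, Finset.prod_range_zero, one_mul, ← pow_mul, ← pow_add,
      add_zero, mul_one, Nat.reduceMul] at h1 h2
    rw [h1, mul_comm, h2, mul_comm b 2]
  have k1 := key a
  have k2 := key (8 - a)
  rw [symmPoch, symmPoch, symmPoch, show 16 - (8 - a) = a + 8 by lia,
    show 16 - a = 8 - a + 8 by lia, show 16 - 2 * a = 2 * (8 - a) by lia, ← k1, ← k2]
  ring

lemma product_eq_symmPoch_residuesA {q : ℂ} (hq : ‖q‖ < 1) (X : ℂ) :
    qPochInf (-q ^ 3) (q ^ 8) * qPochInf (-q ^ 5) (q ^ 8) * qPochInf (q ^ 8) (q ^ 8) /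
      (qPochInf q q * X) = 1 / ((∏ i, symmPoch q 16 (residuesA i)) * X) := by
  have hs : ∀ n, 0 < n → n < 16 → symmPoch q 16 n ≠ 0 := fun n h h' ↦ symmPoch_ne_zero hq h h'
  have h8 := norm_pow_lt_one hq (n := 8) (by norm_num)
  have hE := qPochInf_ne_zero_of_norm_lt_one h8 h8
  have h := qPochInf_neg_pow_mul hq 3 (by norm_num)
  simp only [Nat.reduceSub, Nat.reduceMul] at h
  rw [← div_div, ← div_div, qPochInf_self_eq_mul hq]
  congr 1
  simp only [Fin.prod_univ_eight, residuesA, Matrix.cons_val]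
  have h1 := hs 1 (by norm_num) (by norm_num)
  have h2 := hs 2 (by norm_num) (by norm_num)
  have h3 := hs 3 (by norm_num) (by norm_num)
  have h4 := hs 4 (by norm_num) (by norm_num)
  have h5 := hs 5 (by norm_num) (by norm_num)
  have h6 := hs 6 (by norm_num) (by norm_num)
  have h7 := hs 7 (by norm_num) (by norm_num)
  rw [div_eq_div_iff (by simp [*]) (by simp [*])]
  linear_combination (symmPoch q 16 1 * symmPoch q 16 7 * symmPoch q 16 2 * symmPoch q 16 3 *
    symmPoch q 16 5 * symmPoch q 16 4 * qPochInf (q ^ 8) (q ^ 8)) * h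

lemma product_eq_symmPoch_residuesB {q : ℂ} (hq : ‖q‖ < 1) (X : ℂ) :
    qPochInf (-q) (q ^ 8) * qPochInf (-q ^ 7) (q ^ 8) * qPochInf (q ^ 8) (q ^ 8) /
      (qPochInf q q * X) = 1 / ((∏ i, symmPoch q 16 (residuesB i)) * X) := by
  have hs : ∀ n, 0 < n → n < 16 → symmPoch q 16 n ≠ 0 := fun n h h' ↦ symmPoch_ne_zero hq h h'
  have h8 := norm_pow_lt_one hq (n := 8) (by norm_num)
  have hE := qPochInf_ne_zero_of_norm_lt_one h8 h8
  have h := qPochInf_neg_pow_mul hq 1 (by norm_num)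
  simp only [Nat.reduceSub, Nat.reduceMul, pow_one] at h
  rw [← div_div, ← div_div, qPochInf_self_eq_mul hq]
  congr 1
  simp only [Fin.prod_univ_eight, residuesB, Matrix.cons_val]
  have h1 := hs 1 (by norm_num) (by norm_num)
  have h2 := hs 2 (by norm_num) (by norm_num)
  have h3 := hs 3 (by norm_num) (by norm_num)
  have h4 := hs 4 (by norm_num) (by norm_num)
  have h5 := hs 5 (by norm_num) (by norm_num)
  have h6 := hs 6 (by norm_num) (by norm_num)
  have h7 := hs 7 (by norm_num) (by norm_num)
  rw [div_eq_div_iff (by simp [*]) (by simp [*])]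
  linear_combination (symmPoch q 16 1 * symmPoch q 16 7 * symmPoch q 16 3 *
    symmPoch q 16 4 * symmPoch q 16 5 * symmPoch q 16 6 * qPochInf (q ^ 8) (q ^ 8)) * h

lemma isModularFunction_product_residuesA {y : ℕ} (hy : 0 < y ∧ y < 10) {c : ℚ}
    (hc : c = 7 / 16 - (2 * (y : ℚ) - 10) ^ 2 / 80) :
    IsModularFunction fun τ ↦ nomePow τ c *
      (qPochInf (-nomePow τ 1 ^ 3) (nomePow τ 1 ^ 8) *
        qPochInf (-nomePow τ 1 ^ 5) (nomePow τ 1 ^ 8) *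
          qPochInf (nomePow τ 1 ^ 8) (nomePow τ 1 ^ 8) /
        (qPochInf (nomePow τ 1) (nomePow τ 1) * symmPoch (nomePow τ 1) 10 y)) := by
  have h := isModularFunction_symmPoch (x := residuesA) (by decide) hy
  convert h using 2 with τ
  rw [product_eq_symmPoch_residuesA (norm_nomePow_one_lt_one τ), mul_one_div]
  congr 2
  rw [hc]
  simp only [Fin.sum_univ_eight, residuesA, Matrix.cons_val]
  push_cast
  ring

lemma isModularFunction_product_residuesB {y : ℕ} (hy : 0 < y ∧ y < 10) {c : ℚ}
    (hc : c = 15 / 16 - (2 * (y : ℚ) - 10) ^ 2 / 80) :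
    IsModularFunction fun τ ↦ nomePow τ c *
      (qPochInf (-nomePow τ 1) (nomePow τ 1 ^ 8) *
        qPochInf (-nomePow τ 1 ^ 7) (nomePow τ 1 ^ 8) *
          qPochInf (nomePow τ 1 ^ 8) (nomePow τ 1 ^ 8) /
        (qPochInf (nomePow τ 1) (nomePow τ 1) * symmPoch (nomePow τ 1) 10 y)) := by
  have h := isModularFunction_symmPoch (x := residuesB) (by decide) hy
  convert h using 2 with τ
  rw [product_eq_symmPoch_residuesB (norm_nomePow_one_lt_one τ), mul_one_div]
  congr 2
  rw [hc]
  simp only [Fin.sum_univ_eight, residuesB, Matrix.cons_val]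
  push_cast
  ring

/-! ### Nahm sums over the cosets of the even lattice -/

lemma mem_evenLattice_iff {n : Fin 2 → ℤ} : n ∈ evenLattice ↔ 2 ∣ n 0 ∧ 2 ∣ n 1 := by
  rw [evenLattice, AddSubgroup.mem_closure_pair]
  constructor
  · rintro ⟨a, b, rfl⟩
    simp
  · rintro ⟨⟨a, ha⟩, b, hb⟩
    refine ⟨a, b, funext fun k ↦ ?_⟩
    fin_cases k
    · simp [ha, mul_comm]
    · simp [hb, mul_comm]

/-- A Nahm sum over `v + 2ℤ²`, with `v` a vector of zeros and ones, is a double sum over `ℕ × ℕ`: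
the terms with a negative coordinate vanish. The double sum is written with exponents `E i j / 2`,
where `E` takes even values. -/
lemma hasSum_nahmTerm_evenLattice {A : Matrix (Fin 2) (Fin 2) ℚ} {B : Fin 2 → ℚ} {C : ℚ}
    (τ : UpperHalfPlane) {a b : ℕ} (ha : a ≤ 1) (hb : b ≤ 1) {E : ℤ → ℤ → ℤ} {c : ℚ}
    (hdvd : ∀ i j, 2 ∣ E i j)
    (hE : ∀ i j : ℤ, nahmExponent A B C ![2 * i + a, 2 * j + b] = c + E i j / 2) {S : ℂ}
    (h : HasSum (fun p : ℕ × ℕ ↦ nomePow τ 1 ^ (E p.1 p.2 / 2) /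
      (qPoch (nomePow τ 1) (nomePow τ 1) (2 * p.1 + a) *
        qPoch (nomePow τ 1) (nomePow τ 1) (2 * p.2 + b))) S) :
    HasSum (fun n : latticeCoset ![(a : ℤ), (b : ℤ)] evenLattice ↦ nahmTerm A B C τ n)
      (nomePow τ c * S) := by
  let g : ℕ × ℕ → latticeCoset ![(a : ℤ), (b : ℤ)] evenLattice := fun p ↦
    ⟨![2 * (p.1 : ℤ) + a, 2 * (p.2 : ℤ) + b], by simp [latticeCoset, mem_evenLattice_iff]⟩
  have hg : Function.Injective g := by
    rintro ⟨i, j⟩ ⟨k, l⟩ hkl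
    have h' := congrArg Subtype.val hkl
    have h0 := congrFun h' 0
    have h1 := congrFun h' 1
    simp only [g, Matrix.cons_val_zero, Matrix.cons_val_one] at h0 h1
    rw [Prod.mk.injEq]
    lia
  refine (hg.hasSum_iff ?_).1 ?_
  · rintro ⟨n, hn⟩ hng
    have hn' : 2 ∣ n 0 - a ∧ 2 ∣ n 1 - b := by
      simpa only [Pi.sub_apply, Matrix.cons_val_zero, Matrix.cons_val_one] using
        mem_evenLattice_iff.1 hn
    obtain ⟨⟨i, hi⟩, j, hj⟩ := hn'
    have hneg : n 0 < 0 ∨ n 1 < 0 := by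
      by_contra! hc
      refine hng ⟨(i.toNat, j.toNat), Subtype.ext (funext fun k ↦ ?_)⟩
      fin_cases k
      · simp only [g]; simp; lia
      · simp only [g]; simp; lia
    rw [nahmTerm, Fin.prod_univ_two]
    rcases hneg with hc | hc
    · rw [invQPoch_of_neg _ hc, zero_mul, mul_zero]
    · rw [invQPoch_of_neg _ hc, mul_zero, mul_zero]
  · refine HasSum.congr_fun (h.mul_left (nomePow τ c)) fun p ↦ ?_
    have e0 := invQPoch_natCast (nomePow τ 1) (2 * p.1 + a)
    have e1 := invQPoch_natCast (nomePow τ 1) (2 * p.2 + b)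
    push_cast at e0 e1
    have e2 : nomePow τ ((E p.1 p.2 : ℚ) / 2) = nomePow τ 1 ^ (E p.1 p.2 / 2) := by
      rw [← nomePow_int_mul, Int.cast_div (hdvd _ _) (by norm_num)]
      simp
    simp only [Function.comp_apply, g, nahmTerm, Fin.prod_univ_two, Matrix.cons_val_zero,
      Matrix.cons_val_one]
    rw [hE, nomePow_add, e0, e1, e2]
    ring

lemma isModularQuadruple_evenLattice {A : Matrix (Fin 2) (Fin 2) ℚ} {B : Fin 2 → ℚ} {C : ℚ}
    {a b : ℕ} (ha : a ≤ 1) (hb : b ≤ 1) {E : ℤ → ℤ → ℤ} {c : ℚ} (hdvd : ∀ i j, 2 ∣ E i j)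
    (hE : ∀ i j : ℤ, nahmExponent A B C ![2 * i + a, 2 * j + b] = c + E i j / 2) {S : ℂ → ℂ}
    (h : ∀ q : ℂ, ‖q‖ < 1 → HasSum (fun p : ℕ × ℕ ↦ q ^ (E p.1 p.2 / 2) /
      (qPoch q q (2 * p.1 + a) * qPoch q q (2 * p.2 + b))) (S q))
    (hS : IsModularFunction fun τ ↦ nomePow τ c * S (nomePow τ 1)) :
    IsModularQuadruple A B C ![(a : ℤ), (b : ℤ)] evenLattice := by
  have h' := fun τ ↦ hasSum_nahmTerm_evenLattice τ ha hb hdvd hE (h _ (norm_nomePow_one_lt_one τ))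
  exact ⟨fun τ ↦ (h' τ).summable.norm, by
    rwa [show latticeNahmSum A B C _ evenLattice = _ from funext fun τ ↦ (h' τ).tsum_eq]⟩

lemma hasSum_swap {E : ℤ → ℤ → ℤ} {a b : ℕ} {q S : ℂ}
    (h : HasSum (fun p : ℕ × ℕ ↦ q ^ (E p.1 p.2 / 2) /
      (qPoch q q (2 * p.1 + a) * qPoch q q (2 * p.2 + b))) S) :
    HasSum (fun p : ℕ × ℕ ↦ q ^ (E p.2 p.1 / 2) /
      (qPoch q q (2 * p.1 + b) * qPoch q q (2 * p.2 + a))) S :=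
  HasSum.congr_fun ((Equiv.prodComm ℕ ℕ).hasSum_iff.2 h) fun p ↦ by
    simp only [Function.comp_apply, Equiv.prodComm_apply, Prod.fst_swap, Prod.snd_swap]
    rw [mul_comm (qPoch q q (2 * p.1 + b))]

/-- The symmetry `n₁ ↔ n₂` of the matrix gives the quadruple with `B` and `v` reversed. -/
lemma isModularQuadruple_pair {β γ C : ℚ} {a b : ℕ} (ha : a ≤ 1) (hb : b ≤ 1)
    {E : ℤ → ℤ → ℤ} {c : ℚ} (hdvd : ∀ i j, 2 ∣ E i j)
    (hE : ∀ i j : ℤ, nahmExponent (symMat (3 / 4) (-1 / 4) (3 / 4)) ![β, γ] C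
      ![2 * i + a, 2 * j + b] = c + E i j / 2) {S : ℂ → ℂ}
    (h : ∀ q : ℂ, ‖q‖ < 1 → HasSum (fun p : ℕ × ℕ ↦ q ^ (E p.1 p.2 / 2) /
      (qPoch q q (2 * p.1 + a) * qPoch q q (2 * p.2 + b))) (S q))
    (hS : IsModularFunction fun τ ↦ nomePow τ c * S (nomePow τ 1)) :
    IsModularQuadruple (symMat (3 / 4) (-1 / 4) (3 / 4)) ![β, γ] C ![(a : ℤ), (b : ℤ)]
        evenLattice ∧
      IsModularQuadruple (symMat (3 / 4) (-1 / 4) (3 / 4)) ![γ, β] C ![(b : ℤ), (a : ℤ)]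
        evenLattice := by
  refine ⟨isModularQuadruple_evenLattice ha hb hdvd hE h hS,
    isModularQuadruple_evenLattice hb ha (E := fun i j ↦ E j i) (fun i j ↦ hdvd j i)
      (fun i j ↦ ?_) (fun q hq ↦ hasSum_swap (h q hq)) hS⟩
  rw [← hE]
  simp [nahmExponent, symMat, Matrix.mulVec, dotProduct, Fin.sum_univ_two]
  ring

theorem mainTheorem1 :
    (∀ q : ℂ, ‖q‖ < 1 →
      HasSum (fun p : ℕ × ℕ ↦
          q ^ ((3 * (p.1 : ℤ) ^ 2 - 2 * p.1 * p.2 + 3 * (p.2 : ℤ) ^ 2 - p.1 + p.2) / 2)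
            / (qPoch q q (2 * p.1) * qPoch q q (2 * p.2)))
        (qPochInf (-q ^ 3) (q ^ 8) * qPochInf (-q ^ 5) (q ^ 8) * qPochInf (q ^ 8) (q ^ 8)
          / (qPochInf q q * (qPochInf (q ^ 2) (q ^ 10) * qPochInf (q ^ 8) (q ^ 10)))) ∧
      HasSum (fun p : ℕ × ℕ ↦
          q ^ ((3 * (p.1 : ℤ) ^ 2 - 2 * p.1 * p.2 + 3 * (p.2 : ℤ) ^ 2 + p.1 + 3 * p.2) / 2)
            / (qPoch q q (2 * p.1 + 1) * qPoch q q (2 * p.2 + 1)))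
        (qPochInf (-q) (q ^ 8) * qPochInf (-q ^ 7) (q ^ 8) * qPochInf (q ^ 8) (q ^ 8)
          / (qPochInf q q * (qPochInf (q ^ 2) (q ^ 10) * qPochInf (q ^ 8) (q ^ 10)))) ∧
      HasSum (fun p : ℕ × ℕ ↦
          q ^ ((3 * (p.1 : ℤ) ^ 2 - 2 * p.1 * p.2 + 3 * (p.2 : ℤ) ^ 2 + 3 * p.1 + p.2) / 2)
            / (qPoch q q (2 * p.1 + 1) * qPoch q q (2 * p.2)))
        (qPochInf (-q ^ 3) (q ^ 8) * qPochInf (-q ^ 5) (q ^ 8) * qPochInf (q ^ 8) (q ^ 8)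
          / (qPochInf q q * (qPochInf (q ^ 4) (q ^ 10) * qPochInf (q ^ 6) (q ^ 10)))) ∧
      HasSum (fun p : ℕ × ℕ ↦
          q ^ ((3 * (p.1 : ℤ) ^ 2 - 2 * p.1 * p.2 + 3 * (p.2 : ℤ) ^ 2 - p.1 + 5 * p.2) / 2)
            / (qPoch q q (2 * p.1) * qPoch q q (2 * p.2 + 1)))
        (qPochInf (-q) (q ^ 8) * qPochInf (-q ^ 7) (q ^ 8) * qPochInf (q ^ 8) (q ^ 8)
          / (qPochInf q q * (qPochInf (q ^ 4) (q ^ 10) * qPochInf (q ^ 6) (q ^ 10))))) ∧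
    (∀ B ∈ ({![-1 / 4, 1 / 4], ![1 / 4, -1 / 4]} : Set (Fin 2 → ℚ)),
      ∀ v ∈ ({![0, 0], ![1, 1]} : Set (Fin 2 → ℤ)),
        IsModularQuadruple (symMat (3 / 4) (-1 / 4) (3 / 4)) B (-1 / 80) v evenLattice) ∧
    (∀ B ∈ ({![0, 1 / 2], ![1 / 2, 0]} : Set (Fin 2 → ℚ)),
      ∀ v ∈ ({![1, 0], ![0, 1]} : Set (Fin 2 → ℤ)),
        IsModularQuadruple (symMat (3 / 4) (-1 / 4) (3 / 4)) B (1 / 80) v evenLattice) := by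
  obtain ⟨h1, h2⟩ := isModularQuadruple_pair (β := -1 / 4) (γ := 1 / 4) (C := -1 / 80) (a := 0)
    (b := 0) (E := fun i j ↦ 3 * i ^ 2 - 2 * i * j + 3 * j ^ 2 - i + j) (c := -1 / 80)
    (by simp) (by simp)
    (fun i j ↦ by rw [← even_iff_two_dvd]; simp [parity_simps]; tauto)
    (fun i j ↦ by
      simp [nahmExponent, symMat, Matrix.mulVec, dotProduct, Fin.sum_univ_two]; ring)
    (fun q hq ↦ (hasSum_lattice_sums q hq).1)
    (isModularFunction_product_residuesA (y := 2) (by norm_num) (by norm_num))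
  obtain ⟨h3, h4⟩ := isModularQuadruple_pair (β := -1 / 4) (γ := 1 / 4) (C := -1 / 80) (a := 1)
    (b := 1) (E := fun i j ↦ 3 * i ^ 2 - 2 * i * j + 3 * j ^ 2 + i + 3 * j) (c := 39 / 80)
    (by simp) (by simp)
    (fun i j ↦ by rw [← even_iff_two_dvd]; simp [parity_simps]; tauto)
    (fun i j ↦ by
      simp [nahmExponent, symMat, Matrix.mulVec, dotProduct, Fin.sum_univ_two]; ring)
    (fun q hq ↦ (hasSum_lattice_sums q hq).2.1)
    (isModularFunction_product_residuesB (y := 2) (by norm_num) (by norm_num))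
  obtain ⟨h5, h6⟩ := isModularQuadruple_pair (β := 0) (γ := 1 / 2) (C := 1 / 80) (a := 1)
    (b := 0) (E := fun i j ↦ 3 * i ^ 2 - 2 * i * j + 3 * j ^ 2 + 3 * i + j) (c := 31 / 80)
    (by simp) (by simp)
    (fun i j ↦ by rw [← even_iff_two_dvd]; simp [parity_simps]; tauto)
    (fun i j ↦ by
      simp [nahmExponent, symMat, Matrix.mulVec, dotProduct, Fin.sum_univ_two]; ring)
    (fun q hq ↦ (hasSum_lattice_sums q hq).2.2.1)
    (isModularFunction_product_residuesA (y := 4) (by norm_num) (by norm_num))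
  obtain ⟨h7, h8⟩ := isModularQuadruple_pair (β := 0) (γ := 1 / 2) (C := 1 / 80) (a := 0)
    (b := 1) (E := fun i j ↦ 3 * i ^ 2 - 2 * i * j + 3 * j ^ 2 - i + 5 * j) (c := 71 / 80)
    (by simp) (by simp)
    (fun i j ↦ by rw [← even_iff_two_dvd]; simp [parity_simps]; tauto)
    (fun i j ↦ by
      simp [nahmExponent, symMat, Matrix.mulVec, dotProduct, Fin.sum_univ_two]; ring)
    (fun q hq ↦ (hasSum_lattice_sums q hq).2.2.2)
    (isModularFunction_product_residuesB (y := 4) (by norm_num) (by norm_num))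
  refine ⟨hasSum_lattice_sums, ?_, ?_⟩
  · rintro B (rfl | rfl) v (rfl | rfl)
    exacts [h1, h3, h2, h4]
  · rintro B (rfl | rfl) v (rfl | rfl)
    exacts [h5, h7, h8, h6]
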